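/- Let $d\ge 0$ and let $\mathcal P$ be a simplicial tiling of $\mathbb R^d$ of translational finite local complexity: a geometric simplicial complex with underlying space $\mathbb R^d$, each of whose simplices is a face of a $d$-simplex (a tile), with only finitely many tiles up to translation, together with a total order on the vertices of every tile such that the orders of two tiles agree on common faces and such that, whenever $t$ and $t+x$ are tiles, translation by $x$ carries the order of $t$ to that of $t+x$. Forms. For $x\in\mathbb R^d$ and $R>0$ write $B_R[\mathcal P-x]=B_R[\mathcal P-y]$ if the tilings $\mathcal P-x$ and $\mathcal P-y$ coincide on the ball of radius $R$ around $0$, i.e. their tiles have the same traces on that ball. A smooth $l$-form $\omega:\mathbb R^d\to\Lambda^l(\mathbb R^d)^*$ is strongly pattern equivariant (s-PE) if there is $R>0$ such that $B_R[\mathcal P-x]=B_R[\mathcal P-y]$ implies $\omega(x)=\omega(y)$. It is weakly pattern equivariant (w-PE) if it lies in the closure of the s-PE $l$-forms in the space of smooth $l$-forms with all derivatives bounded, for the Fréchet topology given by the seminorms $s_k(\omega)=\sup_{|\kappa|\le k}\|D^\kappa\omega\|_\infty$, $k\in\mathbb N$. Let $H^l_{s\text{-}\mathcal P}(\mathbb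 R^d)$ and $H^l_{w\text{-}\mathcal P}(\mathbb R^d)$ be the degree $l$ cohomologies of the complexes of s-PE and of w-PE forms with the exterior derivative. Cochains. A real $l$-cochain $c$ assigns a real number to each $l$-simplex $\sigma=(v_0<\dots<v_l)$ of $\mathcal P$; the coboundary is $(d_Sc)(\tau)=\sum_{i}(-1)^i c(\partial_i\tau)$, where $\partial_i$ omits the $i$th vertex. The $1$-neighbourhood of $\sigma$ is the set of tiles which touch $\sigma$, and its $(k+1)$-neighbourhood is the set of tiles which touch $\sigma$ or a tile of its $k$-neighbourhood. The cochain $c$ is s-PE if there is $k>0$ such that $c(\sigma)=c(\sigma')$ whenever some translation carries $\sigma$ with its $k$-neighbourhood to $\sigma'$ with its $k$-neighbourhood; it is w-PE if it lies in the closure of the s-PE cochains in the bounded cochains for uniform convergence. Let $H^l_{s\text{-}\mathcal P}(\mathcal P,\mathbb R)$ and $H^l_{w\text{-}\mathcal P}(\mathcal P,\mathbb R)$ be the degree $l$ cohomologies of the complexes of s-PE and of w-PE cochains with $d_S$. Theorem (PE de Rham theorem). For every $l\ge 0$ the integration map $J_l(\omega)(\sigma)=\int_\sigma\omega$ (the integral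 over the standard $l$-simplex of the pullback of $\omega$ along the affine map sending its $i$th vertex to $v_i$) induces, by $[\omega]\mapsto[J_l(\omega)]$, a linear isomorphism $$H^l_{s\text{-}\mathcal P}(\mathbb R^d)\;\cong\; H^l_{s\text{-}\mathcal P}(\mathcal P,\mathbb R)$$ and also a linear isomorphism $$H^l_{w\text{-}\mathcal P}(\mathbb R^d)\;\cong\; H^l_{w\text{-}\mathcal P}(\mathcal P,\mathbb R).$$ -/

import Mathlib

noncomputable section

namespace PatternEquivariant

/-- Euclidean `d`-space. -/
abbrev Euc (d : ℕ) : Type := EuclideanSpace ℝ (Fin d)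

/-! ### Cohomology of a subcomplex of a sequence of linear maps -/

section Cohomology

variable {X : ℕ → Type} [∀ l, AddCommGroup (X l)] [∀ l, Module ℝ (X l)]

/-- Degree `l` cocycles of the subcomplex `A` of `(X, D)`. -/
def cocycles (D : ∀ l, X l →ₗ[ℝ] X (l + 1)) (A : ∀ l, Submodule ℝ (X l)) (l : ℕ) :
    Submodule ℝ (X l) :=
  A l ⊓ LinearMap.ker (D l)

/-- Degree `l` coboundaries of the subcomplex `A` of `(X, D)`. -/
def coboundaries (D : ∀ l, X l →ₗ[ℝ] X (l + 1)) (A : ∀ l, Submodule ℝ (X l)) :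
    ∀ l, Submodule ℝ (X l)
  | 0 => ⊥
  | l + 1 => (A l).map (D l)

/-- Degree `l` cohomology (cocycles modulo coboundaries) of the subcomplex `A` of `(X, D)`. -/
abbrev Cohomology (D : ∀ l, X l →ₗ[ℝ] X (l + 1)) (A : ∀ l, Submodule ℝ (X l)) (l : ℕ) : Type :=
  cocycles D A l ⧸ (coboundaries D A l).submoduleOf (cocycles D A l)

/-- The map `f` from `X l` to `Y l` induces an isomorphism from the degree `l` cohomology of the
subcomplex `A` of `(X, D)` to that of the subcomplex `C` of `(Y, D')`: it maps cocycles to cocycles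
and there is a linear isomorphism which sends the class of each cocycle `ω` to the class of
`f ω`. -/
def InducesIsoOnCohomology {Y : ℕ → Type} [∀ l, AddCommGroup (Y l)] [∀ l, Module ℝ (Y l)]
    (D : ∀ l, X l →ₗ[ℝ] X (l + 1)) (A : ∀ l, Submodule ℝ (X l))
    (D' : ∀ l, Y l →ₗ[ℝ] Y (l + 1)) (C : ∀ l, Submodule ℝ (Y l))
    (l : ℕ) (f : X l →ₗ[ℝ] Y l) : Prop :=
  ∃ e : Cohomology D A l ≃ₗ[ℝ] Cohomology D' C l, ∀ ω : cocycles D A l,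
    ∃ h : f ω.1 ∈ cocycles D' C l, e (Submodule.Quotient.mk ω) = Submodule.Quotient.mk ⟨f ω.1, h⟩

end Cohomology

/-! ### Smooth differential forms -/

/-- Smooth `l`-forms on `ℝ^d`. -/
def smoothForms (d l : ℕ) : Submodule ℝ (Euc d → (Euc d) [⋀^Fin l]→L[ℝ] ℝ) where
  carrier := {ω | ContDiff ℝ (⊤ : ℕ∞) ω}
  add_mem' {ω η} h₁ h₂ := by
    rw [Set.mem_ofPred_eq] at *
    exact h₁.add h₂
  zero_mem' := by
    rw [Set.mem_ofPred_eq]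
    exact contDiff_const
  smul_mem' c ω h := by
    rw [Set.mem_ofPred_eq] at *
    exact h.const_smul c

theorem contDiff_form {d l : ℕ} (ω : smoothForms d l) : ContDiff ℝ (⊤ : ℕ∞) ω.1 := ω.2

theorem contDiffAt_form {d l : ℕ} (ω : smoothForms d l) (k : ℕ) (x : Euc d) :
    ContDiffAt ℝ k ω.1 x :=
  (contDiff_form ω).contDiffAt.of_le (by exact_mod_cast le_top)

theorem contDiff_extDeriv {d l : ℕ} {ω : Euc d → (Euc d) [⋀^Fin l]→L[ℝ] ℝ}
    (h : ContDiff ℝ (⊤ : ℕ∞) ω) : ContDiff ℝ (⊤ : ℕ∞) (extDeriv ω) := by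
  have h' : ContDiff ℝ (⊤ : ℕ∞) (fderiv ℝ ω) := h.fderiv_right (by simp)
  exact (ContinuousAlternatingMap.alternatizeUncurryFinCLM ℝ (Euc d) ℝ).contDiff.comp h'

/-- The exterior derivative on smooth forms. -/
def extD (d l : ℕ) : smoothForms d l →ₗ[ℝ] smoothForms d (l + 1) where
  toFun ω := ⟨extDeriv ω.1, contDiff_extDeriv (contDiff_form ω)⟩
  map_add' ω η := Subtype.ext <| funext fun x =>
    extDeriv_add ((contDiff_form ω).differentiable (by simp) x)
      ((contDiff_form η).differentiable (by simp) x)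
  map_smul' c ω := Subtype.ext <| funext fun x => extDeriv_smul c ω.1

/-- Smooth `l`-forms all of whose derivatives (of every order `≥ 0`) are bounded. -/
def boundedForms (d l : ℕ) : Submodule ℝ (smoothForms d l) where
  carrier := {ω | ∀ k : ℕ, ∃ C : ℝ, ∀ x, ‖iteratedFDeriv ℝ k ω.1 x‖ ≤ C}
  add_mem' := by
    intro ω η hω hη k
    obtain ⟨C, hC⟩ := hω k
    obtain ⟨C', hC'⟩ := hη k
    refine ⟨C + C', fun x => ?_⟩
    have e : iteratedFDeriv ℝ k (ω + η).1 x
        = iteratedFDeriv ℝ k ω.1 x + iteratedFDeriv ℝ k η.1 x :=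
      iteratedFDeriv_add_apply (contDiffAt_form ω k x) (contDiffAt_form η k x)
    rw [e]
    exact (norm_add_le _ _).trans (add_le_add (hC x) (hC' x))
  zero_mem' := by
    intro k
    refine ⟨0, fun x => ?_⟩
    have e : ((0 : smoothForms d l) : Euc d → (Euc d) [⋀^Fin l]→L[ℝ] ℝ) = fun _ => 0 := rfl
    rw [e, iteratedFDeriv_fun_zero]
    simp
  smul_mem' := by
    intro c ω hω k
    obtain ⟨C, hC⟩ := hω k
    refine ⟨‖c‖ * C, fun x => ?_⟩
    have e : iteratedFDeriv ℝ k (c • ω).1 x = c • iteratedFDeriv ℝ k ω.1 x :=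
      iteratedFDeriv_const_smul_apply (contDiffAt_form ω k x)
    rw [e, norm_smul]
    exact mul_le_mul_of_nonneg_left (hC x) (norm_nonneg _)

/-- The translate `x + s` of a finite set of points. -/
def translate {d : ℕ} (x : Euc d) (s : Finset (Euc d)) : Finset (Euc d) :=
  s.map (Equiv.addLeft x).toEmbedding

/-! ### Simplicial tilings -/

/-- A simplicial tiling of `ℝ^d` of translational finite local complexity: a geometric simplicial
complex covering `ℝ^d` each of whose faces is a face of a `d`-simplex (a tile), with finitely many
tiles up to translation, together with an ordering of the vertices of each tile.  The orderings of
different tiles agree on common faces (they come from one relation `vlt` on points, of which only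
the values on pairs of vertices of a common tile matter), and the ordering is pattern equivariant:
tiles which differ by a translation have orderings which differ by that translation. -/
structure SimplicialTiling (d : ℕ) extends Geometry.SimplicialComplex ℝ (Euc d) where
  covers : toSimplicialComplex.space = Set.univ
  exists_tile : ∀ s ∈ faces, ∃ t ∈ faces, t.card = d + 1 ∧ s ⊆ t
  finite_prototiles : ∃ F : Set (Finset (Euc d)), F.Finite ∧
    ∀ t ∈ faces, t.card = d + 1 → ∃ t₀ ∈ F, ∃ x, t = translate x t₀
  vlt : Euc d → Euc d → Prop
  vlt_irrefl : ∀ t ∈ faces, t.card = d + 1 → ∀ u ∈ t, ¬ vlt u u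
  vlt_trans : ∀ t ∈ faces, t.card = d + 1 → ∀ u ∈ t, ∀ v ∈ t, ∀ w ∈ t,
    vlt u v → vlt v w → vlt u w
  vlt_total : ∀ t ∈ faces, t.card = d + 1 → ∀ u ∈ t, ∀ v ∈ t, u ≠ v → vlt u v ∨ vlt v u
  vlt_translate : ∀ t ∈ faces, t.card = d + 1 → ∀ x, translate x t ∈ faces →
    ∀ u ∈ t, ∀ v ∈ t, vlt u v → vlt (x + u) (x + v)

namespace SimplicialTiling

variable {d : ℕ} (P : SimplicialTiling d)

/-- The tiles (as vertex sets). -/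
def tiles : Set (Finset (Euc d)) := {t | t ∈ P.faces ∧ t.card = d + 1}

/-- The set covered by the tile with vertex set `t`. -/
def supp (t : Finset (Euc d)) : Set (Euc d) := convexHull ℝ (t : Set (Euc d))

/-- `B_R[P - x]`: the tiling `P - x` on the `R`-ball around `0`, as the collection of the traces
of its tiles on that ball. -/
def patch (x : Euc d) (R : ℝ) : Set (Set (Euc d)) :=
  {A | ∃ t ∈ P.tiles, A = {z | z + x ∈ supp t} ∩ Metric.closedBall 0 R}

/-- A function on `ℝ^d` is pattern equivariant with range `R`. -/
def IsPEWithRange {Y : Type} (f : Euc d → Y) (R : ℝ) : Prop :=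
  ∀ x y, P.patch x R = P.patch y R → f x = f y

/-- A function on `ℝ^d` is strongly pattern equivariant. -/
def IsStronglyPE {Y : Type} (f : Euc d → Y) : Prop := ∃ R > 0, P.IsPEWithRange f R

variable {P} in
theorem patch_mono {x y : Euc d} {R R' : ℝ} (h : R ≤ R') (e : P.patch x R' = P.patch y R') :
    P.patch x R = P.patch y R := by
  have key : ∀ x y : Euc d, P.patch x R' = P.patch y R' → P.patch x R ⊆ P.patch y R := by
    rintro x y e A ⟨t, ht, rfl⟩
    have : {z | z + x ∈ supp t} ∩ Metric.closedBall 0 R' ∈ P.patch y R' := e ▸ ⟨t, ht, rfl⟩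
    obtain ⟨t', ht', e'⟩ := this
    refine ⟨t', ht', ?_⟩
    have hb : Metric.closedBall (0 : Euc d) R = Metric.closedBall 0 R' ∩ Metric.closedBall 0 R :=
      (Set.inter_eq_right.2 (Metric.closedBall_subset_closedBall h)).symm
    rw [hb, ← Set.inter_assoc, ← Set.inter_assoc, e']
  exact (key x y e).antisymm (key y x e.symm)

/-- Strongly pattern equivariant smooth `l`-forms. -/
def sForms (l : ℕ) : Submodule ℝ (smoothForms d l) where
  carrier := {ω | P.IsStronglyPE ω.1}
  add_mem' := by
    rintro ω η ⟨R, hR, h⟩ ⟨R', hR', h'⟩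
    refine ⟨max R R', lt_max_of_lt_left hR, fun x y e => ?_⟩
    exact congrArg₂ (· + ·) (h x y (patch_mono (le_max_left _ _) e))
      (h' x y (patch_mono (le_max_right _ _) e))
  zero_mem' := ⟨1, one_pos, fun _ _ _ => rfl⟩
  smul_mem' := by
    rintro c ω ⟨R, hR, h⟩
    exact ⟨R, hR, fun x y e => congrArg (c • ·) (h x y e)⟩

/-- Weakly pattern equivariant smooth `l`-forms: the closure of the strongly pattern equivariant
forms in the bounded forms, for the Fréchet topology of uniform convergence of all derivatives
(the seminorm of order `k` is the supremum of the norms of all derivatives of order `≤ k`). -/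
def wForms (l : ℕ) : Submodule ℝ (smoothForms d l) where
  carrier := {ω | ω ∈ boundedForms d l ∧ ∀ k : ℕ, ∀ ε > 0, ∃ η ∈ P.sForms l,
    ∀ j ≤ k, ∀ x, ‖iteratedFDeriv ℝ j (ω.1 - η.1) x‖ ≤ ε}
  add_mem' := by
    rintro ω₁ ω₂ ⟨b₁, h₁⟩ ⟨b₂, h₂⟩
    refine ⟨add_mem b₁ b₂, fun k ε hε => ?_⟩
    obtain ⟨η₁, m₁, e₁⟩ := h₁ k (ε / 2) (half_pos hε)
    obtain ⟨η₂, m₂, e₂⟩ := h₂ k (ε / 2) (half_pos hε)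
    refine ⟨η₁ + η₂, add_mem m₁ m₂, fun j hj x => ?_⟩
    have e : iteratedFDeriv ℝ j ((ω₁ + ω₂).1 - (η₁ + η₂).1) x
        = iteratedFDeriv ℝ j (ω₁.1 - η₁.1) x + iteratedFDeriv ℝ j (ω₂.1 - η₂.1) x := by
      rw [Submodule.coe_add, Submodule.coe_add, add_sub_add_comm]
      exact iteratedFDeriv_add_apply
        ((contDiffAt_form ω₁ j x).sub (contDiffAt_form η₁ j x))
        ((contDiffAt_form ω₂ j x).sub (contDiffAt_form η₂ j x))
    rw [e]
    exact (norm_add_le _ _).trans ((add_le_add (e₁ j hj x) (e₂ j hj x)).trans_eq (add_halves ε))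
  zero_mem' := by
    refine ⟨zero_mem _, fun k ε hε => ⟨0, zero_mem _, fun j _ x => ?_⟩⟩
    have e : ((0 : smoothForms d l).1 - (0 : smoothForms d l).1) = fun _ => 0 := by
      rw [sub_self]; rfl
    rw [e, iteratedFDeriv_fun_zero]
    simpa using hε.le
  smul_mem' := by
    rintro c ω ⟨b, h⟩
    refine ⟨Submodule.smul_mem _ c b, fun k ε hε => ?_⟩
    obtain ⟨η, m, e⟩ := h k (ε / (‖c‖ + 1)) (by positivity)
    refine ⟨c • η, Submodule.smul_mem _ c m, fun j hj x => ?_⟩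
    have e' : iteratedFDeriv ℝ j ((c • ω).1 - (c • η).1) x = c • iteratedFDeriv ℝ j (ω.1 - η.1) x := by
      rw [Submodule.coe_smul, Submodule.coe_smul, ← smul_sub]
      exact iteratedFDeriv_const_smul_apply
        ((contDiffAt_form ω j x).sub (contDiffAt_form η j x))
    rw [e', norm_smul]
    calc ‖c‖ * ‖iteratedFDeriv ℝ j (ω.1 - η.1) x‖
        ≤ (‖c‖ + 1) * (ε / (‖c‖ + 1)) :=
          mul_le_mul (by linarith) (e j hj x) (norm_nonneg _) (by positivity)
      _ = ε := by field_simp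

/-! ### Simplices and cochains -/

/-- An `n`-simplex of the tiling: a face with `n + 1` vertices, listed in increasing order.  It
stands for the affine characteristic map of the face which sends the `i`th vertex of the standard
simplex to `vertex i`. -/
@[ext]
structure Simplex (n : ℕ) where
  vertex : Fin (n + 1) → Euc d
  isFace : ∃ s ∈ P.faces, (s : Set (Euc d)) = Set.range vertex
  ordered : ∀ i j, i < j → P.vlt (vertex i) (vertex j)

variable {P}

/-- The set of points of a simplex. -/
def Simplex.carrier {n : ℕ} (σ : P.Simplex n) : Set (Euc d) := convexHull ℝ (Set.range σ.vertex)

/-- The `i`th face of a simplex (omit the `i`th vertex). -/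
def Simplex.face {n : ℕ} (σ : P.Simplex (n + 1)) (i : Fin (n + 2)) : P.Simplex n where
  vertex j := σ.vertex (i.succAbove j)
  isFace := by
    classical
    obtain ⟨s, hs, e⟩ := σ.isFace
    refine ⟨Finset.univ.image fun j => σ.vertex (i.succAbove j), ?_, by simp⟩
    refine P.toSimplicialComplex.down_closed hs ?_ (Finset.univ_nonempty.image _)
    intro v hv
    obtain ⟨j, -, rfl⟩ := Finset.mem_image.1 hv
    exact Finset.mem_coe.1 (e ▸ Set.mem_range_self _)
  ordered j k h := σ.ordered _ _ (Fin.strictMono_succAbove i h)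

variable (P)

/-- Real simplicial `n`-cochains of the tiling, given by their values on the `n`-simplices. -/
abbrev Cochain (n : ℕ) : Type := P.Simplex n → ℝ

/-- The simplicial coboundary operator. -/
def dS (n : ℕ) : P.Cochain n →ₗ[ℝ] P.Cochain (n + 1) where
  toFun c τ := ∑ i : Fin (n + 2), (-1) ^ (i : ℕ) * c (τ.face i)
  map_add' c c' := by
    funext τ
    simp [mul_add, Finset.sum_add_distrib]
  map_smul' a c := by
    funext τ
    simp [Finset.mul_sum, mul_left_comm]

/-- The tiles of the `k`-neighbourhood of a set `S` (`k ≥ 1`): the `1`-neighbourhood consists of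
the tiles which touch `S`, and the `(k+1)`-neighbourhood of the tiles which touch `S` or a tile of
the `k`-neighbourhood. -/
def nbhd (S : Set (Euc d)) : ℕ → Set (Finset (Euc d))
  | 0 => ∅
  | k + 1 => {t | t ∈ P.tiles ∧ (supp t ∩ (S ∪ ⋃ t' ∈ nbhd S k, supp t')).Nonempty}

/-- `σ'` together with its `k`-neighbourhood is the translate by `x` of `σ` together with its
`k`-neighbourhood. -/
def NbhdTranslate {n : ℕ} (k : ℕ) (x : Euc d) (σ σ' : P.Simplex n) : Prop :=
  (∀ i, σ'.vertex i = x + σ.vertex i) ∧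
    P.nbhd σ'.carrier k = translate x '' P.nbhd σ.carrier k

theorem nbhd_mono {S S' : Set (Euc d)} (h : S ⊆ S') (k : ℕ) : P.nbhd S k ⊆ P.nbhd S' k := by
  induction k with
  | zero => exact subset_rfl
  | succ k ih =>
    rintro t ⟨ht, hn⟩
    exact ⟨ht, hn.mono (Set.inter_subset_inter_right _
      (Set.union_subset_union h (Set.biUnion_subset_biUnion_left ih)))⟩

theorem nbhd_succ (S : Set (Euc d)) (k : ℕ) : P.nbhd S k ⊆ P.nbhd S (k + 1) := by
  induction k with
  | zero => exact Set.empty_subset _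
  | succ k ih =>
    rintro t ⟨ht, hn⟩
    exact ⟨ht, hn.mono (Set.inter_subset_inter_right _
      (Set.union_subset_union_right _ (Set.biUnion_subset_biUnion_left ih)))⟩

theorem supp_translate (x : Euc d) (t : Finset (Euc d)) :
    supp (translate x t) = (fun z => x + z) '' supp t := by
  have h := (AffineEquiv.constVAdd ℝ (Euc d) x).toAffineMap.image_convexHull (t : Set (Euc d))
  simp only [supp, translate, Finset.coe_map]
  exact h.symm

/-- If neighbourhoods of two larger sets `T`, `x + T` correspond, so do those of smaller ones. -/
theorem image_nbhd_subset {S T S' T' : Set (Euc d)} (x : Euc d) (hS : S ⊆ T)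
    (hS' : (fun z => x + z) '' S ⊆ S') (k : ℕ)
    (e : translate x '' P.nbhd T k ⊆ P.nbhd T' k) (j : ℕ) (hj : j ≤ k) :
    translate x '' P.nbhd S j ⊆ P.nbhd S' j := by
  have tile : ∀ t ∈ P.nbhd S k, translate x t ∈ P.tiles := by
    intro t ht
    have := e ⟨t, P.nbhd_mono hS k ht, rfl⟩
    cases k with
    | zero => exact ht.elim
    | succ k => exact this.1
  induction j with
  | zero => rintro _ ⟨t, ht, rfl⟩; exact ht.elim
  | succ j ih =>
    rintro _ ⟨t, ht, rfl⟩
    have hk : t ∈ P.nbhd S k :=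
      (monotone_nat_of_le_succ (P.nbhd_succ S) hj) ht
    refine ⟨tile t hk, ?_⟩
    obtain ⟨z, hz, hz'⟩ := ht.2
    refine ⟨x + z, ?_, ?_⟩
    · rw [supp_translate]; exact ⟨z, hz, rfl⟩
    · rcases hz' with hz' | hz'
      · exact Or.inl (hS' ⟨z, hz', rfl⟩)
      · right
        obtain ⟨t', ht', hzt⟩ := Set.mem_iUnion₂.1 hz'
        refine Set.mem_iUnion₂.2 ⟨translate x t', ih (by omega) ⟨t', ht', rfl⟩, ?_⟩
        rw [supp_translate]; exact ⟨z, hzt, rfl⟩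

variable {P} in
theorem NbhdTranslate.symm {n k : ℕ} {x : Euc d} {σ σ' : P.Simplex n}
    (h : P.NbhdTranslate k x σ σ') : P.NbhdTranslate k (-x) σ' σ := by
  refine ⟨fun i => by rw [h.1 i]; simp, ?_⟩
  rw [h.2, Set.image_image]
  have : ∀ t : Finset (Euc d), translate (-x) (translate x t) = t := by
    intro t
    ext z
    simp [translate]
  simp [this]

variable {P} in
theorem carrier_translate {n : ℕ} {x : Euc d} {σ σ' : P.Simplex n}
    (h : ∀ i, σ'.vertex i = x + σ.vertex i) : σ'.carrier = (fun z => x + z) '' σ.carrier := by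
  have e := (AffineEquiv.constVAdd ℝ (Euc d) x).toAffineMap.image_convexHull (Set.range σ.vertex)
  simp only [Simplex.carrier]
  refine Eq.trans ?_ e.symm
  congr 1
  rw [← Set.range_comp]
  congr 1
  funext i
  exact h i

variable {P} in
theorem NbhdTranslate.of_subset {n m k j : ℕ} {x : Euc d} {σ σ' : P.Simplex n}
    (h : P.NbhdTranslate k x σ σ') (hj : j ≤ k) {τ τ' : P.Simplex m}
    (hτ : ∀ i, τ'.vertex i = x + τ.vertex i) (hs : τ.carrier ⊆ σ.carrier) :
    P.NbhdTranslate j x τ τ' := by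
  have hc := carrier_translate hτ
  have hs' : τ'.carrier ⊆ σ'.carrier := by
    rw [hc, carrier_translate h.1]; exact Set.image_mono hs
  refine ⟨hτ, Set.Subset.antisymm ?_
    (P.image_nbhd_subset x hs hc.symm.subset k h.2.symm.subset j hj)⟩
  have h' := P.image_nbhd_subset (S' := τ.carrier) (-x) hs'
    (by rw [hc, Set.image_image]; simp) k h.symm.2.symm.subset j hj
  intro t ht
  refine ⟨translate (-x) t, h' ⟨t, ht, rfl⟩, ?_⟩
  ext z
  simp [translate]

/-- Strongly pattern equivariant cochains: the value on a simplex depends only on the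
`k`-neighbourhood (up to translation) of the simplex, for some fixed `k > 0`. -/
def sCochains (n : ℕ) : Submodule ℝ (P.Cochain n) where
  carrier := {c | ∃ k > 0, ∀ x σ σ', P.NbhdTranslate k x σ σ' → c σ = c σ'}
  add_mem' := by
    rintro c c' ⟨k, hk, h⟩ ⟨k', hk', h'⟩
    refine ⟨max k k', lt_max_of_lt_left hk, fun x σ σ' e => ?_⟩
    exact congrArg₂ (· + ·) (h x σ σ' (e.of_subset (le_max_left _ _) e.1 subset_rfl))
      (h' x σ σ' (e.of_subset (le_max_right _ _) e.1 subset_rfl))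
  zero_mem' := ⟨1, one_pos, fun _ _ _ _ => rfl⟩
  smul_mem' := by
    rintro a c ⟨k, hk, h⟩
    exact ⟨k, hk, fun x σ σ' e => congrArg (a • ·) (h x σ σ' e)⟩

/-- Bounded cochains. -/
def boundedCochains (n : ℕ) : Submodule ℝ (P.Cochain n) where
  carrier := {c | ∃ C : ℝ, ∀ σ, |c σ| ≤ C}
  add_mem' := by
    rintro c c' ⟨C, h⟩ ⟨C', h'⟩
    exact ⟨C + C', fun σ => (abs_add_le _ _).trans (add_le_add (h σ) (h' σ))⟩
  zero_mem' := ⟨0, fun σ => by simp⟩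
  smul_mem' := by
    rintro a c ⟨C, h⟩
    exact ⟨|a| * C, fun σ => by
      simpa [abs_mul] using mul_le_mul_of_nonneg_left (h σ) (abs_nonneg a)⟩

/-- Weakly pattern equivariant cochains: the closure of the strongly pattern equivariant cochains
in the bounded cochains for uniform convergence. -/
def wCochains (n : ℕ) : Submodule ℝ (P.Cochain n) where
  carrier := {c | c ∈ P.boundedCochains n ∧
    ∀ ε > 0, ∃ c' ∈ P.sCochains n, ∀ σ, |c σ - c' σ| ≤ ε}
  add_mem' := by
    rintro c₁ c₂ ⟨b₁, h₁⟩ ⟨b₂, h₂⟩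
    refine ⟨add_mem b₁ b₂, fun ε hε => ?_⟩
    obtain ⟨c₁', m₁, e₁⟩ := h₁ (ε / 2) (half_pos hε)
    obtain ⟨c₂', m₂, e₂⟩ := h₂ (ε / 2) (half_pos hε)
    refine ⟨c₁' + c₂', add_mem m₁ m₂, fun σ => ?_⟩
    simp only [Pi.add_apply, add_sub_add_comm]
    exact (abs_add_le _ _).trans ((add_le_add (e₁ σ) (e₂ σ)).trans_eq (add_halves ε))
  zero_mem' := ⟨zero_mem _, fun ε hε => ⟨0, zero_mem _, fun σ => by simpa using hε.le⟩⟩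
  smul_mem' := by
    rintro a c ⟨b, h⟩
    refine ⟨Submodule.smul_mem _ a b, fun ε hε => ?_⟩
    obtain ⟨c', m, e⟩ := h (ε / (|a| + 1)) (by positivity)
    refine ⟨a • c', Submodule.smul_mem _ a m, fun σ => ?_⟩
    simp only [Pi.smul_apply, smul_eq_mul, ← mul_sub, abs_mul]
    calc |a| * |c σ - c' σ| ≤ (|a| + 1) * (ε / (|a| + 1)) :=
          mul_le_mul (by linarith) (e σ) (abs_nonneg _) (by positivity)
      _ = ε := by field_simp

/-! ### The strongly and weakly pattern equivariant forms and cochains are subcomplexes -/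

theorem extD_extD (l : ℕ) (ω : smoothForms d l) : extD d (l + 1) (extD d l ω) = 0 :=
  Subtype.ext (extDeriv_extDeriv (contDiff_form ω) (by
    simp only [minSmoothness_of_isRCLikeNormedField]
    exact WithTop.coe_le_coe.2 (le_top : (2 : ℕ∞) ≤ ⊤)))

variable {P} in
theorem patch_shift {x y h : Euc d} {R : ℝ} (hh : ‖h‖ ≤ 1)
    (e : P.patch x (R + 1) = P.patch y (R + 1)) :
    P.patch (x + h) R = P.patch (y + h) R := by
  have key : ∀ x y : Euc d, P.patch x (R + 1) = P.patch y (R + 1) →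
      P.patch (x + h) R ⊆ P.patch (y + h) R := by
    rintro x y e A ⟨t, ht, rfl⟩
    have : {z | z + x ∈ supp t} ∩ Metric.closedBall 0 (R + 1) ∈ P.patch y (R + 1) := e ▸ ⟨t, ht, rfl⟩
    obtain ⟨t', ht', e'⟩ := this
    refine ⟨t', ht', ?_⟩
    ext z
    have hz := Set.ext_iff.1 e' (z + h)
    simp only [Set.mem_inter_iff, Set.mem_ofPred_eq, mem_closedBall_zero_iff] at hz ⊢
    refine and_congr_left fun hR => ?_
    have : ‖z + h‖ ≤ R + 1 := (norm_add_le _ _).trans (add_le_add hR hh)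
    simp only [this, and_true] at hz
    rw [show z + (x + h) = z + h + x by abel, show z + (y + h) = z + h + y by abel]
    exact hz
  exact (key x y e).antisymm (key y x e.symm)

theorem extD_mem_sForms (l : ℕ) (ω : smoothForms d l) (hω : ω ∈ P.sForms l) :
    extD d l ω ∈ P.sForms (l + 1) := by
  obtain ⟨R, hR, h⟩ := hω
  refine ⟨R + 1, by positivity, fun x y e => ?_⟩
  have hev : (fun z => ω.1 (z + (x - y))) =ᶠ[nhds y] ω.1 := by
    filter_upwards [Metric.ball_mem_nhds y one_pos] with z hz
    have := h _ _ (patch_shift (h := z - y) (by rw [← dist_eq_norm]; exact (Metric.mem_ball.1 hz).le) e)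
    rw [show z + (x - y) = x + (z - y) by abel, this, show y + (z - y) = z by abel]
  have h1 := hev.fderiv_eq (𝕜 := ℝ)
  rw [fderiv_comp_add_right, show y + (x - y) = x by abel] at h1
  show extDeriv ω.1 x = extDeriv ω.1 y
  simp only [extDeriv, h1]

theorem norm_iteratedFDeriv_extDeriv {l : ℕ} (f : Euc d → (Euc d) [⋀^Fin l]→L[ℝ] ℝ)
    (hf : ContDiff ℝ (⊤ : ℕ∞) f) (j : ℕ) (x : Euc d) :
    ‖iteratedFDeriv ℝ j (extDeriv f) x‖ ≤ (l + 1) * ‖iteratedFDeriv ℝ (j + 1) f x‖ := by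
  have h' : ContDiff ℝ (⊤ : ℕ∞) (fderiv ℝ f) := hf.fderiv_right (by simp)
  rw [← norm_iteratedFDeriv_fderiv]
  have e : iteratedFDeriv ℝ j (extDeriv f) x =
      (ContinuousAlternatingMap.alternatizeUncurryFinCLM ℝ (Euc d) ℝ
        (n := l)).compContinuousMultilinearMap (iteratedFDeriv ℝ j (fderiv ℝ f) x) :=
    ContinuousLinearMap.iteratedFDeriv_comp_left _ (n := (j : ℕ))
      (h'.contDiffAt.of_le (by exact_mod_cast le_top)) le_rfl
  rw [e]
  refine ContinuousMultilinearMap.opNorm_le_bound (by positivity) fun m => ?_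
  refine (ContinuousAlternatingMap.norm_alternatizeUncurryFin_le _).trans ?_
  rw [mul_assoc]
  exact mul_le_mul_of_nonneg_left (ContinuousMultilinearMap.le_opNorm _ _) (by positivity)

theorem extD_mem_wForms (l : ℕ) (ω : smoothForms d l) (hω : ω ∈ P.wForms l) :
    extD d l ω ∈ P.wForms (l + 1) := by
  obtain ⟨hb, h⟩ := hω
  set M : ℝ := l + 1 with hM
  have hM0 : 0 ≤ M := by positivity
  refine ⟨fun k => ?_, fun k ε hε => ?_⟩
  · obtain ⟨C, hC⟩ := hb (k + 1)
    exact ⟨M * C, fun x => (norm_iteratedFDeriv_extDeriv _ (contDiff_form ω) k x).trans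
      (mul_le_mul_of_nonneg_left (hC x) hM0)⟩
  · obtain ⟨η, m, e⟩ := h (k + 1) (ε / (M + 1)) (by positivity)
    refine ⟨extD d l η, P.extD_mem_sForms l η m, fun j hj x => ?_⟩
    have e' : (extD d l ω).1 - (extD d l η).1 = extDeriv (ω.1 - η.1) := by
      funext x
      have h1 : fderiv ℝ (ω.1 - η.1) x = fderiv ℝ ω.1 x - fderiv ℝ η.1 x :=
        fderiv_sub ((contDiff_form ω).differentiable (by simp) x)
          ((contDiff_form η).differentiable (by simp) x)
      exact ((congrArg ContinuousAlternatingMap.alternatizeUncurryFin h1).trans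
        ((ContinuousAlternatingMap.alternatizeUncurryFinCLM ℝ (Euc d) ℝ).map_sub _ _)).symm
    rw [e']
    refine (norm_iteratedFDeriv_extDeriv _ ((contDiff_form ω).sub (contDiff_form η)) j x).trans ?_
    calc M * ‖iteratedFDeriv ℝ (j + 1) (ω.1 - η.1) x‖ ≤ (M + 1) * (ε / (M + 1)) :=
          mul_le_mul (by linarith) (e _ (by omega) x) (norm_nonneg _) (by positivity)
      _ = ε := by field_simp

theorem dS_mem_sCochains (n : ℕ) (c : P.Cochain n) (hc : c ∈ P.sCochains n) :
    P.dS n c ∈ P.sCochains (n + 1) := by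
  obtain ⟨k, hk, h⟩ := hc
  refine ⟨k, hk, fun x σ σ' e => ?_⟩
  simp only [dS, LinearMap.coe_mk, AddHom.coe_mk]
  refine Finset.sum_congr rfl fun i _ => ?_
  rw [h x (σ.face i) (σ'.face i) (e.of_subset le_rfl (fun j => e.1 _) (convexHull_mono ?_))]
  rintro _ ⟨j, rfl⟩
  exact ⟨_, rfl⟩

theorem dS_bound (n : ℕ) (c : P.Cochain n) (C : ℝ) (hc : ∀ σ, |c σ| ≤ C) (τ) :
    |P.dS n c τ| ≤ (n + 2) * C := by
  simp only [dS, LinearMap.coe_mk, AddHom.coe_mk]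
  refine (Finset.abs_sum_le_sum_abs _ _).trans ?_
  refine (Finset.sum_le_sum (g := fun _ => C) fun i _ => ?_).trans (by simp)
  simpa [abs_mul, abs_pow] using hc (τ.face i)

theorem dS_mem_wCochains (n : ℕ) (c : P.Cochain n) (hc : c ∈ P.wCochains n) :
    P.dS n c ∈ P.wCochains (n + 1) := by
  obtain ⟨⟨C, hC⟩, h⟩ := hc
  refine ⟨⟨_, P.dS_bound n c C hC⟩, fun ε hε => ?_⟩
  obtain ⟨c', m, e⟩ := h (ε / (n + 2)) (by positivity)
  refine ⟨P.dS n c', P.dS_mem_sCochains n c' m, fun τ => ?_⟩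
  have := P.dS_bound n (c - c') _ e τ
  rw [map_sub, mul_div_cancel₀ _ (by positivity)] at this
  exact this

theorem dS_dS (n : ℕ) (c : P.Cochain n) : P.dS (n + 1) (P.dS n c) = 0 := by
  funext τ
  simp only [dS, LinearMap.coe_mk, AddHom.coe_mk, Finset.mul_sum, Pi.zero_apply]
  rw [← Finset.sum_product', Finset.univ_product_univ]
  refine Finset.sum_involution
    (fun p _ => if h : (p.2 : ℕ) < p.1 then
        (⟨p.2, by omega⟩, ⟨p.1 - 1, by omega⟩)
      else (⟨p.2 + 1, by omega⟩, ⟨p.1, by omega⟩)) ?_ ?_ (fun _ _ => Finset.mem_univ _) ?_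
  · rintro ⟨i, j⟩ -
    have hf : ∀ (i i' : Fin (n + 3)) (j j' : Fin (n + 2)),
        (∀ k, i.succAbove (j.succAbove k) = i'.succAbove (j'.succAbove k)) →
        (τ.face i).face j = (τ.face i').face j' := by
      intro i i' j j' h
      ext1
      funext k
      simp only [Simplex.face, h]
    split_ifs with h
    · rw [hf ⟨j, by omega⟩ i ⟨i - 1, by omega⟩ j]
      · obtain ⟨i', hi'⟩ : ∃ i', (i : ℕ) = i' + 1 := ⟨i - 1, by simp at h; omega⟩
        simp only [hi']
        simp [pow_succ]; ring
      · intro k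
        ext
        simp only [Fin.succAbove, Fin.lt_def] at h ⊢
        grind
    · rw [hf ⟨j + 1, by omega⟩ i ⟨i, by simp at h; omega⟩ j]
      · simp [pow_succ]; ring
      · intro k
        ext
        simp only [Fin.succAbove, Fin.lt_def] at h ⊢
        grind
  · rintro ⟨i, j⟩ - -
    split_ifs with h <;> simp [Fin.ext_iff] at h ⊢ <;> omega
  · rintro ⟨i, j⟩ -
    by_cases h : (j : ℕ) < i <;> simp [h] <;> grind

/-! ### Integration -/

/-- The standard `l`-simplex in the coordinates `x₁, …, x_l` (the coordinate `x₀ = 1 - ∑ xᵢ` of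
the `0`th vertex being omitted). -/
def stdSimplexCoords (l : ℕ) : Set (Fin l → ℝ) := {x | (∀ i, 0 ≤ x i) ∧ ∑ i, x i ≤ 1}

/-- The affine characteristic map of a simplex, on `stdSimplexCoords`. -/
def Simplex.charMap {P : SimplicialTiling d} {l : ℕ} (σ : P.Simplex l) (x : Fin l → ℝ) : Euc d :=
  σ.vertex 0 + ∑ i : Fin l, x i • (σ.vertex i.succ - σ.vertex 0)

/-- `∫_σ ω`: the integral over the standard simplex of the pullback of the `l`-form `ω` along the
characteristic map of the `l`-simplex `σ`, whose partial derivatives are the edge vectors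
`σ.vertex i.succ - σ.vertex 0`. -/
def Simplex.integral {P : SimplicialTiling d} {l : ℕ} (σ : P.Simplex l)
    (ω : Euc d → (Euc d) [⋀^Fin l]→L[ℝ] ℝ) : ℝ :=
  ∫ x in stdSimplexCoords l, ω (σ.charMap x) fun i : Fin l => σ.vertex i.succ - σ.vertex 0

theorem isCompact_stdSimplexCoords (l : ℕ) : IsCompact (stdSimplexCoords l) := by
  refine (isCompact_univ_pi fun _ : Fin l => isCompact_Icc (a := (0 : ℝ)) (b := 1)).of_isClosed_subset
    ?_ ?_
  · have e : stdSimplexCoords l = Set.Ici 0 ∩ {x | ∑ i, x i ≤ 1} := rfl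
    rw [e]
    exact isClosed_Ici.inter (isClosed_le (by fun_prop) continuous_const)
  · rintro x ⟨h0, h1⟩ i -
    exact ⟨h0 i, (Finset.single_le_sum (fun j _ => h0 j) (Finset.mem_univ i)).trans h1⟩

theorem integrableOn_pullback {P : SimplicialTiling d} {l : ℕ} (σ : P.Simplex l)
    (ω : smoothForms d l) : MeasureTheory.IntegrableOn
      (fun x => ω.1 (σ.charMap x) fun i : Fin l => σ.vertex i.succ - σ.vertex 0)
      (stdSimplexCoords l) := by
  refine ContinuousOn.integrableOn_compact (isCompact_stdSimplexCoords l) (Continuous.continuousOn ?_)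
  have h : Continuous fun x => ω.1 (σ.charMap x) :=
    (contDiff_form ω).continuous.comp (by unfold Simplex.charMap; fun_prop)
  exact (ContinuousAlternatingMap.apply ℝ (Euc d) ℝ _).continuous.comp h

/-- The integration map `J_l` from smooth `l`-forms to `l`-cochains. -/
def J (l : ℕ) : smoothForms d l →ₗ[ℝ] P.Cochain l where
  toFun ω σ := σ.integral ω.1
  map_add' ω η := funext fun σ =>
    MeasureTheory.integral_add (integrableOn_pullback σ ω) (integrableOn_pullback σ η)
  map_smul' c _ := funext fun _ => MeasureTheory.integral_const_mul c _

end SimplicialTiling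

end PatternEquivariant

end

noncomputable section

namespace PatternEquivariant

open MeasureTheory Metric

/-! ### Integrals of smooth families -/

section ParametricIntegral

/-! The argument is a Čech–de Rham comparison for the cover of `ℝ^d` by the stars of the vertices,
run on the mapping cone of integration. By Stokes' theorem (`simplexIntegral_extDeriv`) the map `J`
is a morphism of complexes, and it induces isomorphisms on cohomology as soon as its mapping cone,
with differential `(ω, c) ↦ (dω, Jω - dc)`, is exact (`inducesIsoOnCohomology_of_exact`).

To prove exactness, the cone is placed as the column `p = 0` of a double complex. Its entry `(p, q)`
consists of families, indexed by `p`-tuples of points, of a `q`-form and a `(q - 1)`-cochain. Such a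
family only counts on the star of the tuple, the union of the tiles having all its points as
vertices, and everything holds up to families vanishing there. The empty tuple has all of `ℝ^d` as
its star and gives back the global complexes. If all rows are exact, and the columns `p ≥ 1` are
exact, then a diagram chase makes the column `p = 0` exact (`ExactDoubleComplex.exact_zero`,
`ExactDoubleComplex.exact_succ`).

A column `p ≥ 1` is exact because stars are contractible in both senses. Tiles are convex and
contain the first point of the tuple, so the cone operator of the Poincaré lemma contracts forms;
signed insertion of that point into simplices contracts cochains. In degree zero the remaining
constants are matched by constant forms (`exists_coneD_primitive`). The rows are exact because
families can be glued: forms by a smooth partition of unity subordinate to the stars, cochains by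
assigning each simplex to its first vertex.

What makes this work for pattern equivariant objects is that every operator in sight has finite
range and is uniformly bounded. Finite range sends strongly pattern equivariant families to strongly
pattern equivariant ones; boundedness for the seminorms then carries closures to closures, so the
weak case follows from the same formulas (`PESpace.IsPEOp`, `IsPEOp.map_W`). The cone operators
never leave a tile, so their range and norm are controlled by a common bound for the diameters of
the tiles.

The partition of unity needs the most care. Finite local complexity yields one `ε > 0` such that all
tiles touching any `ε`-ball share a vertex (`exists_lebesgue_number`). Each point is assigned to the
smallest such vertex, in the given equivariant order, and the indicator functions of the resulting
regions are mollified. Smoothness, uniform bounds, equivariance and summation to one are all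
inherited from this construction.

Pattern equivariance itself is expressed through `LocEq`, which says that a translation matches the
tiles near two points. It is compared with the patches used for forms and the combinatorial
neighbourhoods used for cochains in `mem_sForms_iff` and `mem_sCochains_iff`. -/

theorem integrable_of_continuous_of_ae_mem_compact {α F : Type} [NormedAddCommGroup α]
    [MeasurableSpace α] [BorelSpace α] [SecondCountableTopology α] [NormedAddCommGroup F]
    {μ : Measure α} [IsFiniteMeasure μ] {K : Set α} (hK : IsCompact K) (hμ : ∀ᵐ s ∂μ, s ∈ K)
    {f : α → F} (hf : Continuous f) : Integrable f μ := by
  obtain ⟨C, hC⟩ := hK.exists_bound_of_continuousOn hf.continuousOn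
  exact Integrable.of_bound hf.aestronglyMeasurable C (hμ.mono fun s hs => hC s hs)

variable {α : Type} [NormedAddCommGroup α] [NormedSpace ℝ α] {E : Type} [NormedAddCommGroup E]
  [NormedSpace ℝ E]

/-- The derivative of a function of two variables with respect to the second one. -/
def sndFDeriv {F : Type} [NormedAddCommGroup F] [NormedSpace ℝ F] (g : α × E → F) (p : α × E) :
    E →L[ℝ] F :=
  (fderiv ℝ g p).comp (ContinuousLinearMap.inr ℝ α E)

theorem contDiff_sndFDeriv {F : Type} [NormedAddCommGroup F] [NormedSpace ℝ F] {g : α × E → F}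
    (hg : ContDiff ℝ (⊤ : ℕ∞) g) : ContDiff ℝ (⊤ : ℕ∞) (sndFDeriv g) := by
  have h' : ContDiff ℝ (⊤ : ℕ∞) (fderiv ℝ g) := hg.fderiv_right (by simp)
  exact h'.clm_comp contDiff_const

theorem hasFDerivAt_snd {F : Type} [NormedAddCommGroup F] [NormedSpace ℝ F] {g : α × E → F}
    (hg : ContDiff ℝ (⊤ : ℕ∞) g) (s : α) (x : E) :
    HasFDerivAt (fun x => g (s, x)) (sndFDeriv g (s, x)) x :=
  ((hg.differentiable (by simp) (s, x)).hasFDerivAt).comp x (hasFDerivAt_prodMk_right s x)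

variable [MeasurableSpace α] [BorelSpace α] [SecondCountableTopology α]

variable [ProperSpace E] {μ : Measure α} [IsFiniteMeasure μ] {K : Set α}

/-- Differentiation under the integral sign: the parameter lives almost surely in the compact set
`K`, so the partial derivative is bounded on `K` times the closed unit ball around `x`, and that
constant is the dominating function. -/
theorem hasFDerivAt_integral_of_contDiff {F : Type} [NormedAddCommGroup F] [NormedSpace ℝ F]
    (hK : IsCompact K) (hμ : ∀ᵐ s ∂μ, s ∈ K)
    {g : α × E → F} (hg : ContDiff ℝ (⊤ : ℕ∞) g) (x : E) :
    HasFDerivAt (fun x => ∫ s, g (s, x) ∂μ) (∫ s, sndFDeriv g (s, x) ∂μ) x := by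
  have hc : Continuous (sndFDeriv g) := (contDiff_sndFDeriv hg).continuous
  obtain ⟨C, hC⟩ := (hK.prod (isCompact_closedBall x 1)).exists_bound_of_continuousOn
    hc.continuousOn
  refine hasFDerivAt_integral_of_dominated_of_fderiv_le (F := fun x s => g (s, x))
    (F' := fun x s => sndFDeriv g (s, x)) (bound := fun _ => C)
    (closedBall_mem_nhds x one_pos) ?_ ?_ ?_ ?_ (integrable_const _) ?_
  · exact Filter.Eventually.of_forall fun y =>
      (hg.continuous.comp (Continuous.prodMk_left y)).aestronglyMeasurable
  · exact integrable_of_continuous_of_ae_mem_compact hK hμ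
      (hg.continuous.comp (Continuous.prodMk_left x))
  · exact (hc.comp (Continuous.prodMk_left x)).aestronglyMeasurable
  · exact hμ.mono fun s hs y hy => hC (s, y) ⟨hs, hy⟩
  · exact Filter.Eventually.of_forall fun s y _ => hasFDerivAt_snd hg s y

theorem fderiv_integral_of_contDiff {F : Type} [NormedAddCommGroup F] [NormedSpace ℝ F]
    (hK : IsCompact K) (hμ : ∀ᵐ s ∂μ, s ∈ K)
    {g : α × E → F} (hg : ContDiff ℝ (⊤ : ℕ∞) g) :
    fderiv ℝ (fun x => ∫ s, g (s, x) ∂μ) = fun x => ∫ s, sndFDeriv g (s, x) ∂μ :=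
  funext fun x => (hasFDerivAt_integral_of_contDiff hK hμ hg x).fderiv

theorem contDiff_integral {F : Type} [NormedAddCommGroup F] [NormedSpace ℝ F]
    (hK : IsCompact K) (hμ : ∀ᵐ s ∂μ, s ∈ K)
    {g : α × E → F} (hg : ContDiff ℝ (⊤ : ℕ∞) g) :
    ContDiff ℝ (⊤ : ℕ∞) (fun x => ∫ s, g (s, x) ∂μ) := by
  refine contDiff_infty.2 fun n => ?_
  -- The derivative is again the integral of a smooth family, but with values in `E →L[ℝ] F`, so the
  -- target space has to vary in the induction.
  induction n generalizing F with
  | zero =>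
    exact contDiff_zero.2 (continuous_iff_continuousAt.2 fun x =>
      (hasFDerivAt_integral_of_contDiff hK hμ hg x).continuousAt)
  | succ n ih =>
    have := contDiff_succ_iff_fderiv (𝕜 := ℝ) (n := n) (f := fun x => ∫ s, g (s, x) ∂μ)
    push_cast
    refine this.2 ⟨fun x => (hasFDerivAt_integral_of_contDiff hK hμ hg x).differentiableAt,
      by simp, ?_⟩
    rw [fderiv_integral_of_contDiff hK hμ hg]
    exact ih (contDiff_sndFDeriv hg)

theorem norm_iteratedFDeriv_integral_le {F : Type} [NormedAddCommGroup F] [NormedSpace ℝ F]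
    (hK : IsCompact K) (hμ : ∀ᵐ s ∂μ, s ∈ K)
    {g : α × E → F} (hg : ContDiff ℝ (⊤ : ℕ∞) g) (j : ℕ) (x : E) (C : ℝ)
    (hC : ∀ s ∈ K, ‖iteratedFDeriv ℝ j (fun x => g (s, x)) x‖ ≤ C) :
    ‖iteratedFDeriv ℝ j (fun x => ∫ s, g (s, x) ∂μ) x‖ ≤ C * μ.real Set.univ := by
  induction j generalizing F with
  | zero =>
    simp only [norm_iteratedFDeriv_zero] at hC ⊢
    exact norm_integral_le_of_norm_le_const (hμ.mono hC)
  | succ j ih =>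
    rw [← norm_iteratedFDeriv_fderiv, fderiv_integral_of_contDiff hK hμ hg]
    refine ih (contDiff_sndFDeriv hg) fun s hs => ?_
    have e : (fun x => sndFDeriv g (s, x)) = fderiv ℝ (fun x => g (s, x)) :=
      funext fun x => (hasFDerivAt_snd hg s x).fderiv.symm
    rw [e, norm_iteratedFDeriv_fderiv]
    exact hC s hs

end ParametricIntegral

end PatternEquivariant

end

noncomputable section

namespace PatternEquivariant

set_option maxSynthPendingDepth 3

open MeasureTheory Metric ContinuousAlternatingMap

/-! ### The cone operator of the Poincaré lemma -/

section Poincare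

variable {d : ℕ}

/-- Currying of the first argument, as a continuous linear map. -/
def curryCLM (d l : ℕ) :
    ((Euc d) [⋀^Fin (l + 1)]→L[ℝ] ℝ) →L[ℝ] (Euc d →L[ℝ] (Euc d) [⋀^Fin l]→L[ℝ] ℝ) :=
  curryLeftLI.toContinuousLinearMap

@[simp]
theorem curryCLM_apply {l : ℕ} (f : (Euc d) [⋀^Fin (l + 1)]→L[ℝ] ℝ) :
    curryCLM d l f = f.curryLeft := rfl

theorem norm_curryCLM_le (l : ℕ) : ‖curryCLM d l‖ ≤ 1 :=
  LinearIsometry.norm_toContinuousLinearMap_le _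

/-- Contraction of alternating forms with a vector. -/
def contract (l : ℕ) (w : Euc d) :
    ((Euc d) [⋀^Fin (l + 1)]→L[ℝ] ℝ) →L[ℝ] ((Euc d) [⋀^Fin l]→L[ℝ] ℝ) :=
  (ContinuousLinearMap.apply ℝ _ w).comp (curryCLM d l)

@[simp]
theorem contract_apply {l : ℕ} (w : Euc d) (f : (Euc d) [⋀^Fin (l + 1)]→L[ℝ] ℝ) :
    contract l w f = f.curryLeft w := rfl

/-- The algebraic half of Cartan's formula: in the alternating sum, the term that differentiates
along `w` is `f w`, and in every other term `w` stays the first argument of the form, which gives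
the contraction with the opposite sign. -/
theorem curryLeft_alternatizeUncurryFin {l : ℕ}
    (f : Euc d →L[ℝ] (Euc d) [⋀^Fin (l + 1)]→L[ℝ] ℝ) (w : Euc d) :
    (alternatizeUncurryFin f).curryLeft w =
      f w - alternatizeUncurryFin ((contract l w).comp f) := by
  ext u
  have h : ∀ (i : Fin (l + 1)), Fin.removeNth i.succ (Matrix.vecCons w u) =
      Matrix.vecCons w (Fin.removeNth i u) := by
    intro i
    ext j
    refine Fin.cases ?_ (fun j => ?_) j <;> simp [Fin.removeNth]
  have h0 : Fin.removeNth 0 (Matrix.vecCons w u) = u := by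
    ext j
    simp [Fin.removeNth]
  rw [curryLeft_apply_apply, alternatizeUncurryFin_apply, Fin.sum_univ_succ,
    ContinuousAlternatingMap.sub_apply,
    alternatizeUncurryFin_apply]
  simp only [h, h0, Fin.val_zero, pow_zero, one_smul, Matrix.cons_val_zero, Fin.val_succ, pow_succ,
    mul_neg, mul_one, neg_smul, Matrix.cons_val_succ, Finset.sum_neg_distrib,
    ContinuousLinearMap.comp_apply, contract_apply, curryLeft_apply_apply, sub_eq_add_neg]

theorem curryLeft_alternatizeUncurryFin_zero
    (f : Euc d →L[ℝ] (Euc d) [⋀^Fin 0]→L[ℝ] ℝ) (w : Euc d) :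
    (alternatizeUncurryFin f).curryLeft w = f w := by
  ext u
  rw [curryLeft_apply_apply, alternatizeUncurryFin_apply, Fin.sum_univ_succ]
  rw [show Fin.removeNth 0 (Matrix.vecCons w u) = u from Subsingleton.elim _ _]
  simp

/-- The integrand of the cone operator with apex `v`. -/
def coneIntegrand {l : ℕ} (v : Euc d) (ω : Euc d → (Euc d) [⋀^Fin (l + 1)]→L[ℝ] ℝ)
    (p : ℝ × Euc d) : (Euc d) [⋀^Fin l]→L[ℝ] ℝ :=
  p.1 ^ l • (ω (v + p.1 • (p.2 - v))).curryLeft (p.2 - v)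

/-- The cone operator with apex `v`. -/
def cone {l : ℕ} (v : Euc d) (ω : Euc d → (Euc d) [⋀^Fin (l + 1)]→L[ℝ] ℝ) (x : Euc d) :
    (Euc d) [⋀^Fin l]→L[ℝ] ℝ :=
  ∫ s in Set.Icc (0 : ℝ) 1, coneIntegrand v ω (s, x)

variable {l : ℕ} {v : Euc d}

theorem contDiff_coneIntegrand {ω : Euc d → (Euc d) [⋀^Fin (l + 1)]→L[ℝ] ℝ}
    (hω : ContDiff ℝ (⊤ : ℕ∞) ω) : ContDiff ℝ (⊤ : ℕ∞) (coneIntegrand v ω) := by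
  unfold coneIntegrand
  refine (contDiff_fst.pow l).smul (ContDiff.clm_apply ?_ (contDiff_snd.sub contDiff_const))
  refine (curryCLM d l).contDiff.comp (hω.comp ?_)
  exact contDiff_const.add (contDiff_fst.smul (contDiff_snd.sub contDiff_const))

theorem ae_mem_Icc : ∀ᵐ s ∂(volume.restrict (Set.Icc (0 : ℝ) 1)), s ∈ Set.Icc (0 : ℝ) 1 :=
  ae_restrict_mem measurableSet_Icc

theorem contDiff_cone {ω : Euc d → (Euc d) [⋀^Fin (l + 1)]→L[ℝ] ℝ}
    (hω : ContDiff ℝ (⊤ : ℕ∞) ω) : ContDiff ℝ (⊤ : ℕ∞) (cone v ω) :=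
  contDiff_integral isCompact_Icc ae_mem_Icc (contDiff_coneIntegrand hω)

theorem integrable_coneIntegrand {ω : Euc d → (Euc d) [⋀^Fin (l + 1)]→L[ℝ] ℝ}
    (hω : ContDiff ℝ (⊤ : ℕ∞) ω) (x : Euc d) :
    IntegrableOn (fun s => coneIntegrand v ω (s, x)) (Set.Icc (0 : ℝ) 1) :=
  integrable_of_continuous_of_ae_mem_compact isCompact_Icc ae_mem_Icc
    ((contDiff_coneIntegrand hω).continuous.comp (Continuous.prodMk_left x))

theorem sndFDeriv_coneIntegrand {ω : Euc d → (Euc d) [⋀^Fin (l + 1)]→L[ℝ] ℝ}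
    (hω : ContDiff ℝ (⊤ : ℕ∞) ω) (s : ℝ) (x : Euc d) :
    sndFDeriv (coneIntegrand v ω) (s, x) =
      s ^ (l + 1) • (contract l (x - v)).comp (fderiv ℝ ω (v + s • (x - v))) +
        s ^ l • (ω (v + s • (x - v))).curryLeft := by
  have h1 := hasFDerivAt_snd (contDiff_coneIntegrand (v := v) hω) s x
  refine h1.unique ?_
  have h2 : HasFDerivAt (fun x => v + s • (x - v)) (s • ContinuousLinearMap.id ℝ (Euc d)) x :=
    (((hasFDerivAt_id x).sub_const v).const_smul s).const_add v
  have h3 := ((hω.differentiable (by simp) _).hasFDerivAt).comp x h2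
  have h4 := (curryCLM d l).hasFDerivAt.comp x h3
  have h5 := (h4.clm_apply ((hasFDerivAt_id x).sub_const v)).const_smul (s ^ l)
  refine h5.congr_fderiv ?_
  ext u w
  simp [pow_succ, mul_assoc, add_comm]

theorem hasDerivAt_pow_smul_ray {ω : Euc d → (Euc d) [⋀^Fin l]→L[ℝ] ℝ}
    (hω : ContDiff ℝ (⊤ : ℕ∞) ω) (k : ℕ) (x : Euc d) (s : ℝ) :
    HasDerivAt (fun s : ℝ => s ^ k • ω (v + s • (x - v)))
      (s ^ k • fderiv ℝ ω (v + s • (x - v)) (x - v) +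
        (k * s ^ (k - 1)) • ω (v + s • (x - v))) s := by
  have h2 : HasDerivAt (fun s : ℝ => v + s • (x - v)) (x - v) s := by
    simpa using ((hasDerivAt_id s).smul_const (x - v)).const_add v
  have h3 := ((hω.differentiable (by simp) (v + s • (x - v))).hasFDerivAt).comp_hasDerivAt s h2
  exact (hasDerivAt_pow k s).smul h3

/-- The fundamental theorem of calculus along the ray from `v` to `x`. The case `k = l + 1` drives
the homotopy formula, since the contribution of the apex vanishes; the case `k = 0` keeps `ω v` and
serves for functions. -/
theorem setIntegral_deriv_pow_smul_ray {ω : Euc d → (Euc d) [⋀^Fin l]→L[ℝ] ℝ}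
    (hω : ContDiff ℝ (⊤ : ℕ∞) ω) (k : ℕ) (x : Euc d) :
    ∫ s in Set.Icc (0 : ℝ) 1, (s ^ k • fderiv ℝ ω (v + s • (x - v)) (x - v) +
        (k * s ^ (k - 1)) • ω (v + s • (x - v))) = ω x - (0 : ℝ) ^ k • ω v := by
  rw [integral_Icc_eq_integral_Ioc, ← intervalIntegral.integral_of_le zero_le_one,
    intervalIntegral.integral_eq_sub_of_hasDerivAt
      (fun s _ => hasDerivAt_pow_smul_ray (v := v) hω k x s)]
  · simp
  · have h' : Continuous (fderiv ℝ ω) := hω.continuous_fderiv (by simp)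
    have := hω.continuous
    apply Continuous.intervalIntegrable
    fun_prop

/-- By Cartan's formula the contraction terms of the two summands cancel under the integral, and
what is left is the derivative in `s` of `s ^ (l + 1) • ω (v + s • (x - v))`. -/
theorem extDeriv_cone {ω : Euc d → (Euc d) [⋀^Fin (l + 1)]→L[ℝ] ℝ}
    (hω : ContDiff ℝ (⊤ : ℕ∞) ω) (x : Euc d) :
    extDeriv (cone v ω) x + cone v (extDeriv ω) x = ω x := by
  have hsm := contDiff_sndFDeriv (contDiff_coneIntegrand (v := v) hω)
  have hint : IntegrableOn (fun s => sndFDeriv (coneIntegrand v ω) (s, x)) (Set.Icc (0 : ℝ) 1) :=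
    integrable_of_continuous_of_ae_mem_compact isCompact_Icc ae_mem_Icc
      (hsm.continuous.comp (Continuous.prodMk_left x))
  have h1 : extDeriv (cone v ω) x = ∫ s in Set.Icc (0 : ℝ) 1,
      alternatizeUncurryFin (sndFDeriv (coneIntegrand v ω) (s, x)) := by
    have e := (hasFDerivAt_integral_of_contDiff isCompact_Icc ae_mem_Icc
      (contDiff_coneIntegrand (v := v) hω) x).fderiv
    have e2 := (alternatizeUncurryFinCLM ℝ (Euc d) ℝ (n := l)).integral_comp_comm hint
    simp only [alternatizeUncurryFinCLM_apply] at e2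
    rw [e2, ← e]
    rfl
  have hint1 : IntegrableOn (fun s => alternatizeUncurryFin
      (sndFDeriv (coneIntegrand v ω) (s, x))) (Set.Icc (0 : ℝ) 1) :=
    ContinuousLinearMap.integrable_comp (alternatizeUncurryFinCLM ℝ (Euc d) ℝ (n := l)) hint
  rw [h1, cone, ← integral_add hint1 (integrable_coneIntegrand (contDiff_extDeriv hω) x)]
  have := setIntegral_deriv_pow_smul_ray (v := v) hω (l + 1) x
  simp only [ne_eq, Nat.add_eq_zero_iff, one_ne_zero, and_false, not_false_eq_true, zero_pow,
    zero_smul, sub_zero] at this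
  rw [← this]
  refine setIntegral_congr_fun measurableSet_Icc fun s _ => ?_
  simp only [sndFDeriv_coneIntegrand hω, coneIntegrand, extDeriv, curryLeft_alternatizeUncurryFin,
    alternatizeUncurryFin_add, alternatizeUncurryFin_smul, alternatizeUncurryFin_curryLeft,
    smul_sub, add_tsub_cancel_right]
  rw [← Nat.cast_smul_eq_nsmul ℝ, smul_smul, mul_comm (s ^ l)]
  push_cast
  abel

theorem cone_extDeriv_zero {ω : Euc d → (Euc d) [⋀^Fin 0]→L[ℝ] ℝ}
    (hω : ContDiff ℝ (⊤ : ℕ∞) ω) (x : Euc d) : cone v (extDeriv ω) x = ω x - ω v := by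
  have := setIntegral_deriv_pow_smul_ray (v := v) hω 0 x
  simp only [pow_zero, one_smul, CharP.cast_eq_zero, zero_mul, zero_smul, add_zero] at this
  rw [← this]
  refine setIntegral_congr_fun measurableSet_Icc fun s _ => ?_
  simp only [coneIntegrand, extDeriv, curryLeft_alternatizeUncurryFin_zero, pow_zero, one_smul]

/-- The cone operator reads the form only on the segment from the apex. This locality is the reason
why it preserves strong pattern equivariance. -/
theorem cone_congr_add {ω η : Euc d → (Euc d) [⋀^Fin (l + 1)]→L[ℝ] ℝ} (z x : Euc d)
    (h : ∀ y ∈ segment ℝ v x, η (z + y) = ω y) : cone (z + v) η (z + x) = cone v ω x := by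
  refine setIntegral_congr_fun measurableSet_Icc fun s hs => ?_
  have hy : v + s • (x - v) ∈ segment ℝ v x := by
    rw [segment_eq_image']
    exact ⟨s, hs, rfl⟩
  simp only [coneIntegrand, add_sub_add_left_eq_sub, add_assoc, h _ hy]

theorem cone_add {ω η : Euc d → (Euc d) [⋀^Fin (l + 1)]→L[ℝ] ℝ}
    (hω : ContDiff ℝ (⊤ : ℕ∞) ω) (hη : ContDiff ℝ (⊤ : ℕ∞) η) :
    cone v (ω + η) = cone v ω + cone v η := by
  funext x
  rw [Pi.add_apply, cone, cone, cone,
    ← integral_add (integrable_coneIntegrand hω x) (integrable_coneIntegrand hη x)]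
  simp [coneIntegrand]

theorem cone_smul {ω : Euc d → (Euc d) [⋀^Fin (l + 1)]→L[ℝ] ℝ} (c : ℝ) :
    cone v (c • ω) = c • cone v ω := by
  funext x
  rw [Pi.smul_apply, cone, cone, ← integral_smul]
  simp only [coneIntegrand, Pi.smul_apply, curryLeft_smul, _root_.smul_apply,
    smul_comm c]

theorem norm_iteratedFDeriv_sub_const_le (i : ℕ) (x : Euc d) :
    ‖iteratedFDeriv ℝ i (fun x => x - v) x‖ ≤ ‖x - v‖ + 1 := by
  cases i with
  | zero => rw [norm_iteratedFDeriv_zero]; linarith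
  | succ i =>
    have e : fderiv ℝ (fun x => x - v) = fun _ => ContinuousLinearMap.id ℝ (Euc d) :=
      funext fun x => ((hasFDerivAt_id x).sub_const v).fderiv
    rw [← norm_iteratedFDeriv_fderiv, e]
    have h1 := norm_nonneg (x - v)
    cases i with
    | zero =>
      rw [norm_iteratedFDeriv_zero]
      exact ContinuousLinearMap.norm_id_le.trans (by linarith)
    | succ i =>
      rw [iteratedFDeriv_succ_const]
      simpa using by linarith

theorem norm_iteratedFDeriv_comp_ray_le {F : Type} [NormedAddCommGroup F] [NormedSpace ℝ F]
    {f : Euc d → F} (hf : ContDiff ℝ (⊤ : ℕ∞) f) {s : ℝ} (hs : s ∈ Set.Icc (0 : ℝ) 1)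
    (i : ℕ) (x : Euc d) :
    ‖iteratedFDeriv ℝ i (fun x => f (v + s • (x - v))) x‖ ≤
      ‖iteratedFDeriv ℝ i f (v + s • (x - v))‖ := by
  have e : (fun x => f (v + s • (x - v))) =
      (fun y => f (y + (v - s • v))) ∘ (s • ContinuousLinearMap.id ℝ (Euc d)) := by
    funext x
    simp only [Function.comp, _root_.smul_apply, ContinuousLinearMap.id_apply]
    congr 1
    rw [smul_sub]; abel
  have hf' : ContDiff ℝ (⊤ : ℕ∞) (fun y => f (y + (v - s • v))) :=
    hf.comp (contDiff_id.add contDiff_const)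
  rw [e, ContinuousLinearMap.iteratedFDeriv_comp_right _ hf' x (i := i)
    (by exact_mod_cast le_top)]
  refine (ContinuousMultilinearMap.norm_compContinuousLinearMap_le _ _).trans ?_
  have e2 : (s • ContinuousLinearMap.id ℝ (Euc d)) x + (v - s • v) = v + s • (x - v) := by
    simp only [_root_.smul_apply, ContinuousLinearMap.id_apply, smul_sub]; abel
  rw [iteratedFDeriv_comp_add_right, e2]
  refine mul_le_of_le_one_right (norm_nonneg _) (Finset.prod_le_one (fun _ _ => norm_nonneg _) ?_)
  intro _ _
  refine (norm_smul_le _ _).trans ?_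
  rw [Real.norm_of_nonneg hs.1]
  exact mul_le_one₀ hs.2 (norm_nonneg _) ContinuousLinearMap.norm_id_le

/-- The Leibniz rule for the contraction pairing, which has norm at most `1`: the factor `x - v` has
all derivatives bounded by `‖x - v‖ + 1`, composition with the ray does not increase norms since `s
≤ 1`, and the binomial coefficients sum to `2 ^ j`. -/
theorem norm_iteratedFDeriv_cone_le {ω : Euc d → (Euc d) [⋀^Fin (l + 1)]→L[ℝ] ℝ}
    (hω : ContDiff ℝ (⊤ : ℕ∞) ω) (j : ℕ) (x : Euc d) {M : ℝ}
    (h : ∀ i ≤ j, ∀ y ∈ segment ℝ v x, ‖iteratedFDeriv ℝ i ω y‖ ≤ M) :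
    ‖iteratedFDeriv ℝ j (cone v ω) x‖ ≤ 2 ^ j * (‖x - v‖ + 1) * M := by
  have hb := norm_iteratedFDeriv_integral_le isCompact_Icc ae_mem_Icc
    (contDiff_coneIntegrand (v := v) hω) j x (2 ^ j * (‖x - v‖ + 1) * M) ?_
  · rw [measureReal_restrict_apply_univ, Real.volume_real_Icc_of_le zero_le_one, sub_zero,
      mul_one] at hb
    exact hb
  intro s hs
  have hy : v + s • (x - v) ∈ segment ℝ v x := by
    rw [segment_eq_image']
    exact ⟨s, hs, rfl⟩
  have hM : 0 ≤ M := (norm_nonneg _).trans (h 0 (Nat.zero_le _) _ hy)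
  have hr : ContDiff ℝ (⊤ : ℕ∞) (fun x => ω (v + s • (x - v))) :=
    hω.comp (contDiff_const.add ((contDiff_id.sub contDiff_const).const_smul s))
  have hg : ContDiff ℝ (⊤ : ℕ∞) (fun x : Euc d => x - v) := contDiff_id.sub contDiff_const
  have hB := ContinuousLinearMap.norm_iteratedFDeriv_le_of_bilinear_of_le_one
    (curryCLM d l)
    hr hg x (n := j) (by exact_mod_cast le_top) (norm_curryCLM_le l)
  have e : (fun x => coneIntegrand v ω (s, x)) = s ^ l • fun x =>
      (curryCLM d l)
        (ω (v + s • (x - v))) (x - v) := rfl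
  have hsm : ContDiff ℝ (⊤ : ℕ∞) fun x =>
      (curryCLM d l)
        (ω (v + s • (x - v))) (x - v) :=
    ((curryCLM d l).contDiff.comp hr).clm_apply hg
  rw [e, iteratedFDeriv_const_smul_apply (hsm.contDiffAt.of_le (by exact_mod_cast le_top)),
    norm_smul]
  refine (mul_le_of_le_one_left (norm_nonneg _) ?_).trans (hB.trans ?_)
  · rw [norm_pow, Real.norm_of_nonneg hs.1]
    exact pow_le_one₀ hs.1 hs.2
  calc _ ≤ ∑ i ∈ Finset.range (j + 1), (j.choose i : ℝ) * M * (‖x - v‖ + 1) := by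
        refine Finset.sum_le_sum fun i hi => ?_
        have hi' : i ≤ j := Nat.lt_succ_iff.1 (Finset.mem_range.1 hi)
        gcongr
        · exact (norm_iteratedFDeriv_comp_ray_le hω hs i x).trans (h i hi' _ hy)
        · exact norm_iteratedFDeriv_sub_const_le _ _
    _ = 2 ^ j * (‖x - v‖ + 1) * M := by
        rw [← Finset.sum_mul, ← Finset.sum_mul, ← Nat.cast_sum, Nat.sum_range_choose]
        push_cast; ring

end Poincare

end PatternEquivariant

end

noncomputable section

namespace PatternEquivariant

set_option maxSynthPendingDepth 3

open MeasureTheory Metric ContinuousAlternatingMap SimplicialTiling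

/-! ### Stokes' theorem for affine simplices -/

section Stokes

variable {d l : ℕ}

/-- A shear followed by a permutation of the factors. The new coordinate is the sum of all
coordinates, which is the radial variable seen from the vertex `0`. -/
theorem measurePreserving_cons_sub_sum (l : ℕ) :
    MeasurePreserving (fun p : (Fin l → ℝ) × ℝ =>
      (Fin.cons (p.2 - ∑ i, p.1 i) p.1 : Fin (l + 1) → ℝ)) := by
  have h1 : MeasurePreserving (fun p : (Fin l → ℝ) × ℝ => (p.1, p.2 - ∑ i, p.1 i))
      (volume.prod volume) (volume.prod volume) := by
    refine (MeasurePreserving.id volume).skew_product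
      (g := fun (z : Fin l → ℝ) (s : ℝ) => s - ∑ i, z i) ?_ ?_
    · exact (by fun_prop : Continuous fun p : (Fin l → ℝ) × ℝ => p.2 - ∑ i, p.1 i).measurable
    · exact Filter.Eventually.of_forall fun z => (measurePreserving_sub_right volume _).map_eq
  have h2 : MeasurePreserving (Prod.swap : (Fin l → ℝ) × ℝ → ℝ × (Fin l → ℝ))
      (volume.prod volume) (volume.prod volume) := Measure.measurePreserving_swap
  have h3 := (volume_preserving_piFinSuccAbove (fun _ : Fin (l + 1) => ℝ) 0).symm
  have h4 := h3.comp (h2.comp h1)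
  have e : (fun p : (Fin l → ℝ) × ℝ => (Fin.cons (p.2 - ∑ i, p.1 i) p.1 : Fin (l + 1) → ℝ)) =
      (MeasurableEquiv.piFinSuccAbove (fun _ : Fin (l + 1) => ℝ) 0).symm ∘ Prod.swap ∘
        (fun p : (Fin l → ℝ) × ℝ => (p.1, p.2 - ∑ i, p.1 i)) := by
    funext p
    simp [MeasurableEquiv.piFinSuccAbove, Fin.insertNthEquiv]
  rw [e]
  exact h4

theorem cons_mem_stdSimplexCoords {z : Fin l → ℝ} {a : ℝ} :
    (Fin.cons a z : Fin (l + 1) → ℝ) ∈ stdSimplexCoords (l + 1) ↔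
      0 ≤ a ∧ (∀ i, 0 ≤ z i) ∧ a + ∑ i, z i ≤ 1 := by
  simp [stdSimplexCoords, Fin.forall_fin_succ, Fin.sum_univ_succ, and_assoc]

theorem measurableSet_stdSimplexCoords (l : ℕ) : MeasurableSet (stdSimplexCoords l) :=
  (isCompact_stdSimplexCoords l).isClosed.measurableSet

theorem smul_cons_mem_stdSimplexCoords {s : ℝ} (h0 : 0 < s) (h1 : s ≤ 1) (y : Fin l → ℝ) :
    (Fin.cons (s - ∑ i, (s • y) i) (s • y) : Fin (l + 1) → ℝ) ∈ stdSimplexCoords (l + 1) ↔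
      y ∈ stdSimplexCoords l := by
  rw [cons_mem_stdSimplexCoords]
  simp only [Pi.smul_apply, smul_eq_mul, ← Finset.mul_sum, stdSimplexCoords, Set.mem_ofPred_eq]
  constructor
  · rintro ⟨h2, h3, -⟩
    refine ⟨fun i => nonneg_of_mul_nonneg_right (h3 i) h0, ?_⟩
    exact le_of_mul_le_mul_left (by linarith) h0
  · rintro ⟨h2, h3⟩
    refine ⟨?_, fun i => mul_nonneg h0.le (h2 i), by linarith⟩
    nlinarith

/-- Integration over the standard simplex in polar coordinates with respect to the vertex `0`. -/
theorem setIntegral_stdSimplexCoords_succ {f : (Fin (l + 1) → ℝ) → ℝ} (hf : Continuous f) :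
    ∫ x in stdSimplexCoords (l + 1), f x = ∫ y in stdSimplexCoords l,
      ∫ s in Set.Icc (0 : ℝ) 1, s ^ l * f (Fin.cons (s - ∑ i, (s • y) i) (s • y)) := by
  set T : (Fin l → ℝ) × ℝ → (Fin (l + 1) → ℝ) := fun p => Fin.cons (p.2 - ∑ i, p.1 i) p.1 with hT
  have hMP : MeasurePreserving T := measurePreserving_cons_sub_sum l
  have hms := measurableSet_stdSimplexCoords (l + 1)
  set F : (Fin (l + 1) → ℝ) → ℝ := (stdSimplexCoords (l + 1)).indicator f with hF
  have hFi : Integrable F := (integrable_indicator_iff hms).2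
    (hf.continuousOn.integrableOn_compact (isCompact_stdSimplexCoords _))
  have hFT : Integrable (F ∘ T) (volume.prod volume) := hMP.integrable_comp_of_integrable hFi
  rw [← integral_indicator hms, ← hF]
  have h1 : ∫ x, F x = ∫ p, F (T p) := by
    rw [← hMP.map_eq]
    exact integral_map hMP.measurable.aemeasurable (by rw [hMP.map_eq]; exact hFi.1)
  have h2 : ∫ p, F (T p) = ∫ s : ℝ, ∫ z : Fin l → ℝ, F (T (z, s)) := integral_prod_symm _ hFT
  -- On the slice at height `s` the substitution `z = s • y` produces the Jacobian `s ^ l`. Height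
  -- `0` is left aside: scaling degenerates there, and it is a null set.
  have h3 : ∀ s : ℝ, ∫ z : Fin l → ℝ, F (T (z, s)) = (Set.Ioc (0 : ℝ) 1).indicator (fun s =>
      ∫ y in stdSimplexCoords l, s ^ l * f (Fin.cons (s - ∑ i, (s • y) i) (s • y))) s ∨ s = 0 := by
    intro s
    by_cases hs : s ∈ Set.Ioc (0 : ℝ) 1
    · left
      rw [Set.indicator_of_mem hs, integral_const_mul]
      have := Measure.integral_comp_smul_of_nonneg (volume : Measure (Fin l → ℝ))
        (fun z => F (T (z, s))) s (hR := hs.1.le)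
      rw [Module.finrank_fin_fun, smul_eq_mul] at this
      rw [← integral_indicator (measurableSet_stdSimplexCoords l)]
      have e : ∀ y : Fin l → ℝ, F (T (s • y, s)) = (stdSimplexCoords l).indicator
          (fun y => f (Fin.cons (s - ∑ i, (s • y) i) (s • y))) y := by
        intro y
        by_cases hy : y ∈ stdSimplexCoords l
        · rw [Set.indicator_of_mem hy, hF, Set.indicator_of_mem]
          exact (smul_cons_mem_stdSimplexCoords hs.1 hs.2 y).2 hy
        · rw [Set.indicator_of_notMem hy, hF, Set.indicator_of_notMem]
          exact fun h => hy ((smul_cons_mem_stdSimplexCoords hs.1 hs.2 y).1 h)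
      simp only [e] at this
      rw [this, mul_inv_cancel_left₀ (pow_ne_zero _ hs.1.ne')]
    · by_cases h0 : s = 0
      · exact Or.inr h0
      left
      rw [Set.indicator_of_notMem hs]
      have : ∀ z : Fin l → ℝ, F (T (z, s)) = 0 := by
        intro z
        rw [hF, Set.indicator_of_notMem]
        rw [hT, cons_mem_stdSimplexCoords]
        rintro ⟨h1, h2, h3⟩
        have := Finset.sum_nonneg fun i (_ : i ∈ Finset.univ) => h2 i
        exact hs ⟨lt_of_le_of_ne (by linarith) (Ne.symm h0), by linarith⟩
      simp [this]
  rw [h1, h2]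
  have h4 : ∫ s : ℝ, ∫ z : Fin l → ℝ, F (T (z, s)) = ∫ s in Set.Icc (0 : ℝ) 1,
      ∫ y in stdSimplexCoords l, s ^ l * f (Fin.cons (s - ∑ i, (s • y) i) (s • y)) := by
    rw [integral_Icc_eq_integral_Ioc, ← integral_indicator measurableSet_Ioc]
    refine integral_congr_ae ?_
    have : ∀ᵐ s : ℝ, s ≠ 0 := by simp [ae_iff, measure_singleton]
    filter_upwards [this] with s hs
    exact (h3 s).resolve_right hs
  rw [h4]
  refine integral_integral_swap ?_
  have : Continuous (Function.uncurry fun (s : ℝ) (y : Fin l → ℝ) =>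
      s ^ l * f (Fin.cons (s - ∑ i, (s • y) i) (s • y))) := by
    unfold Function.uncurry
    refine (continuous_fst.pow l).mul (hf.comp ?_)
    refine continuous_pi fun i => Fin.cases ?_ (fun i => ?_) i <;> simp <;> fun_prop
  rw [Measure.prod_restrict]
  exact this.continuousOn.integrableOn_compact
    (isCompact_Icc.prod (isCompact_stdSimplexCoords l))

/-! ### Affine simplices as cones over the face opposite to the vertex `0` -/

/-- The affine map on `stdSimplexCoords` with vertices `τ`. -/
def affineSimplex (τ : Fin (l + 1) → Euc d) (x : Fin l → ℝ) : Euc d :=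
  τ 0 + ∑ i : Fin l, x i • (τ i.succ - τ 0)

/-- The integral of a form over the affine simplex with vertices `τ`. -/
def simplexIntegral (τ : Fin (l + 1) → Euc d) (ω : Euc d → (Euc d) [⋀^Fin l]→L[ℝ] ℝ) : ℝ :=
  ∫ x in stdSimplexCoords l, ω (affineSimplex τ x) fun i : Fin l => τ i.succ - τ 0

theorem continuous_affineSimplex (τ : Fin (l + 1) → Euc d) : Continuous (affineSimplex τ) := by
  unfold affineSimplex; fun_prop

theorem continuous_pullback {n : ℕ} (u : Fin n → Euc d) {ω : Euc d → (Euc d) [⋀^Fin n]→L[ℝ] ℝ}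
    (hω : Continuous ω) (τ : Fin (l + 1) → Euc d) :
    Continuous fun x => ω (affineSimplex τ x) u :=
  (ContinuousAlternatingMap.apply ℝ (Euc d) ℝ u).continuous.comp
    (hω.comp (continuous_affineSimplex τ))

theorem map_sub_of_vanish (g : (Euc d) [⋀^Fin l]→L[ℝ] ℝ) (e : Euc d)
    (hg : ∀ u : Fin l → Euc d, (∃ i, u i = -e) → g u = 0) (u : Fin l → Euc d) :
    g (fun i => u i - e) = g u := by
  classical
  have : (fun i => u i - e) = u + fun _ => -e := by
    funext i; simp [sub_eq_add_neg]
  rw [this, g.map_add_univ, Finset.sum_eq_single Finset.univ]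
  · congr 1; funext i; simp
  · intro s _ hs
    obtain ⟨i, hi⟩ : ∃ i, i ∉ s := by
      by_contra! h
      exact hs (Finset.eq_univ_iff_forall.2 h)
    exact hg _ ⟨i, by simp [hi]⟩
  · simp

/-- The ray to a point of the opposite face, together with the edges of that face, arises from the
edges `e` at the apex by unimodular operations. Here the sum in the first slot repeats later
arguments, and subtracting `e 0` from the later slots is invisible once `e 0` is in the first. -/
theorem alternating_cone_edges (g : (Euc d) [⋀^Fin (l + 1)]→L[ℝ] ℝ) (e : Fin (l + 1) → Euc d)
    (y : Fin l → ℝ) :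
    g (Matrix.vecCons (e 0 + ∑ i, y i • (e i.succ - e 0)) fun i : Fin l => e i.succ - e 0) =
      g e := by
  have h1 : ∀ i : Fin l, g.curryLeft (e i.succ - e 0) (fun i : Fin l => e i.succ - e 0) = 0 := by
    intro i
    rw [curryLeft_apply_apply]
    exact g.map_eq_zero_of_eq _ (i := 0) (j := i.succ) (by simp) (Fin.succ_ne_zero i).symm
  rw [← curryLeft_apply_apply, _root_.map_add, _root_.map_sum, ContinuousAlternatingMap.add_apply,
    ContinuousAlternatingMap.sum_apply, Finset.sum_eq_zero, add_zero]
  · rw [map_sub_of_vanish (g.curryLeft (e 0)) (e 0), curryLeft_apply_apply]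
    · congr 1
      funext i
      refine Fin.cases rfl (fun i => rfl) i
    · rintro u ⟨i, hi⟩
      have hu : u = Function.update u i (-e 0) := by rw [← hi, Function.update_eq_self]
      have h2 : (g.curryLeft (e 0)) (Function.update u i (e 0)) = 0 := by
        rw [curryLeft_apply_apply]
        exact g.map_eq_zero_of_eq _ (i := 0) (j := i.succ) (by simp) (Fin.succ_ne_zero i).symm
      rw [hu, ← neg_one_smul ℝ (e 0), ContinuousAlternatingMap.map_update_smul, h2, smul_zero]
  · intro i _
    rw [_root_.map_smul, ContinuousAlternatingMap.smul_apply, h1, smul_zero]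

/-- The integral over a simplex is the integral over the face opposite to the vertex `0` of the
image under the cone operator. -/
theorem simplexIntegral_eq_cone (τ : Fin (l + 2) → Euc d)
    {ω : Euc d → (Euc d) [⋀^Fin (l + 1)]→L[ℝ] ℝ} (hω : ContDiff ℝ (⊤ : ℕ∞) ω) :
    simplexIntegral τ ω = simplexIntegral (fun i => τ i.succ) (cone (τ 0) ω) := by
  rw [simplexIntegral, setIntegral_stdSimplexCoords_succ (continuous_pullback _ hω.continuous τ),
    simplexIntegral]
  refine setIntegral_congr_fun (measurableSet_stdSimplexCoords l) fun y _ => ?_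
  simp only [cone]
  have hc := (ContinuousAlternatingMap.apply ℝ (Euc d) ℝ
    (fun i : Fin l => τ i.succ.succ - τ (Fin.succ 0))).integral_comp_comm
    (integrable_coneIntegrand (v := τ 0) hω (affineSimplex (fun i => τ i.succ) y))
  refine Eq.trans ?_ hc
  refine setIntegral_congr_fun measurableSet_Icc fun s _ => ?_
  have hd : affineSimplex (fun i => τ i.succ) y - τ 0 =
      (τ (Fin.succ 0) - τ 0) + ∑ i : Fin l, y i • ((τ i.succ.succ - τ 0) - (τ (Fin.succ 0) - τ 0)) := by
    simp only [affineSimplex, sub_sub_sub_cancel_right]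
    abel
  -- In these coordinates `s` is the parameter on the ray from `τ 0` through the point of the
  -- opposite face with coordinates `y`, as in the cone operator.
  have hp : affineSimplex τ (Fin.cons (s - ∑ i, (s • y) i) (s • y)) =
      τ 0 + s • (affineSimplex (fun i => τ i.succ) y - τ 0) := by
    rw [hd, affineSimplex, Fin.sum_univ_succ]
    simp only [Fin.cons_zero, Fin.cons_succ, Pi.smul_apply, smul_eq_mul, smul_sub, sub_smul,
      smul_add, Finset.smul_sum, Finset.sum_sub_distrib, Finset.sum_smul, smul_smul]
    abel
  have hv := alternating_cone_edges (ω (τ 0 + s • (affineSimplex (fun i => τ i.succ) y - τ 0)))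
    (fun i => τ i.succ - τ 0) y
  simp only [sub_sub_sub_cancel_right] at hv hd
  simp only [hp, ContinuousAlternatingMap.apply_apply, coneIntegrand,
    ContinuousAlternatingMap.smul_apply, curryLeft_apply_apply, smul_eq_mul]
  rw [hd] at hv ⊢
  rw [hv]

theorem simplexIntegral_zero (τ : Fin 1 → Euc d) (ω : Euc d → (Euc d) [⋀^Fin 0]→L[ℝ] ℝ) :
    simplexIntegral τ ω = ω (τ 0) fun i => i.elim0 := by
  have : stdSimplexCoords 0 = Set.univ := by
    ext x; simp [stdSimplexCoords]
  rw [simplexIntegral, this, Measure.restrict_univ, integral_unique]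
  simp only [affineSimplex, Finset.univ_eq_empty, Finset.sum_empty, add_zero]
  have h : (volume : Measure (Fin 0 → ℝ)).real Set.univ = 1 := by
    rw [measureReal_def, volume_pi, Measure.pi_of_empty, Measure.dirac_apply_of_mem (Set.mem_univ _)]
    simp
  rw [h, one_smul]
  congr 1
  exact Subsingleton.elim _ _

theorem simplexIntegral_sub (τ : Fin (l + 1) → Euc d) {ω η : Euc d → (Euc d) [⋀^Fin l]→L[ℝ] ℝ}
    (hω : Continuous ω) (hη : Continuous η) :
    simplexIntegral τ (fun x => ω x - η x) = simplexIntegral τ ω - simplexIntegral τ η := by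
  rw [simplexIntegral, simplexIntegral, simplexIntegral, ← integral_sub]
  · rfl
  · exact (continuous_pullback _ hω τ).continuousOn.integrableOn_compact
      (isCompact_stdSimplexCoords l)
  · exact (continuous_pullback _ hη τ).continuousOn.integrableOn_compact
      (isCompact_stdSimplexCoords l)

/-- **Stokes' theorem** for affine simplices. -/
theorem simplexIntegral_extDeriv (τ : Fin (l + 2) → Euc d)
    {ω : Euc d → (Euc d) [⋀^Fin l]→L[ℝ] ℝ} (hω : ContDiff ℝ (⊤ : ℕ∞) ω) :
    simplexIntegral τ (extDeriv ω) =
      ∑ i : Fin (l + 2), (-1) ^ (i : ℕ) * simplexIntegral (fun j => τ (i.succAbove j)) ω := by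
  -- The integral over `τ` is that of the cone of `extDeriv ω` over the face `0`. The homotopy
  -- formula replaces it by `ω`, which gives the term `i = 0`, minus an exact form; for that form
  -- the induction hypothesis gives integrals of `cone (τ 0) ω` over the faces of the face `0`, and
  -- these are integrals of `ω` over the remaining faces of `τ`.
  induction l with
  | zero =>
    rw [simplexIntegral_eq_cone τ (contDiff_extDeriv hω), simplexIntegral_zero,
      cone_extDeriv_zero hω, Fin.sum_univ_two]
    simp [simplexIntegral_zero, sub_eq_add_neg]
  | succ l ih =>
    rw [simplexIntegral_eq_cone τ (contDiff_extDeriv hω)]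
    have e : cone (τ 0) (extDeriv ω) = fun x => ω x - extDeriv (cone (τ 0) ω) x :=
      funext fun x => by rw [← extDeriv_cone (v := τ 0) hω x]; abel
    rw [e, simplexIntegral_sub _ hω.continuous
      (contDiff_extDeriv (contDiff_cone (v := τ 0) hω)).continuous,
      ih _ (contDiff_cone hω), Fin.sum_univ_succ (n := l + 2)]
    simp only [Fin.val_zero, pow_zero, one_mul, Fin.succAbove_zero, Fin.val_succ, pow_succ,
      mul_neg, mul_one, neg_mul, Finset.sum_neg_distrib, sub_eq_add_neg]
    refine congrArg₂ (fun a b : ℝ => a + -b) rfl ?_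
    refine Finset.sum_congr rfl fun i _ => ?_
    rw [simplexIntegral_eq_cone (fun j => τ (i.succ.succAbove j)) hω]
    simp only [Fin.succ_succAbove_zero, Fin.succ_succAbove_succ]

end Stokes

end PatternEquivariant

end

noncomputable section

namespace PatternEquivariant

open MeasureTheory Metric

namespace SimplicialTiling

/-! ### Geometry of the tiles -/

section Geometry

variable {d : ℕ} (P : SimplicialTiling d)

@[simp]
theorem mem_translate {x v : Euc d} {s : Finset (Euc d)} : v ∈ translate x s ↔ v - x ∈ s := by
  simp only [translate, Finset.mem_map, Equiv.coe_toEmbedding, Equiv.coe_addLeft]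
  constructor
  · rintro ⟨a, ha, rfl⟩
    simpa using ha
  · intro h
    exact ⟨_, h, by simp⟩

theorem add_mem_translate {x v : Euc d} {s : Finset (Euc d)} : x + v ∈ translate x s ↔ v ∈ s := by
  simp

@[simp]
theorem translate_neg_translate (x : Euc d) (s : Finset (Euc d)) :
    translate (-x) (translate x s) = s := by
  ext; simp

@[simp]
theorem translate_translate_neg (x : Euc d) (s : Finset (Euc d)) :
    translate x (translate (-x) s) = s := by
  ext; simp

@[simp]
theorem card_translate (x : Euc d) (s : Finset (Euc d)) : (translate x s).card = s.card := by
  simp [translate]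

theorem add_mem_supp_translate {x z : Euc d} {t : Finset (Euc d)} :
    x + z ∈ supp (translate x t) ↔ z ∈ supp t := by
  rw [supp_translate]
  simp

theorem exists_tile_mem (y : Euc d) : ∃ t ∈ P.tiles, y ∈ supp t := by
  have h : y ∈ P.toSimplicialComplex.space := by rw [P.covers]; trivial
  obtain ⟨s, hs, hy⟩ := Geometry.SimplicialComplex.mem_space_iff.1 h
  obtain ⟨t, ht, hc, hst⟩ := P.exists_tile s hs
  exact ⟨t, ⟨ht, hc⟩, convexHull_mono (by exact_mod_cast hst) hy⟩

theorem isCompact_supp (t : Finset (Euc d)) : IsCompact (supp t) :=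
  t.finite_toSet.isCompact_convexHull (𝕜 := ℝ)

theorem isClosed_supp (t : Finset (Euc d)) : IsClosed (supp t) := (isCompact_supp t).isClosed

theorem convex_supp (t : Finset (Euc d)) : Convex ℝ (supp t) := convex_convexHull _ _

theorem subset_supp {t : Finset (Euc d)} {v : Euc d} (hv : v ∈ t) : v ∈ supp t :=
  subset_convexHull _ _ (Finset.mem_coe.2 hv)

theorem card_eq_of_interior_nonempty {s : Finset (Euc d)} (hs : s ∈ P.faces) :
    (interior (supp s)).Nonempty ↔ s.card = d + 1 := by
  rw [supp, interior_convexHull_nonempty_iff_affineSpan_eq_top]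
  have h := (P.indep hs).affineSpan_eq_top_iff_card_eq_finrank_add_one
  rw [Subtype.range_coe_subtype, Finset.setOfPred_mem, Fintype.card_coe, finrank_euclideanSpace_fin] at h
  exact h

variable {P}

theorem interior_supp_nonempty {t : Finset (Euc d)} (ht : t ∈ P.tiles) :
    (interior (supp t)).Nonempty :=
  (P.card_eq_of_interior_nonempty ht.1).2 ht.2

theorem supp_subset_closure_interior {t : Finset (Euc d)} (ht : t ∈ P.tiles) :
    supp t ⊆ closure (interior (supp t)) := by
  rw [(convex_supp t).closure_interior_eq_closure_of_nonempty_interior (interior_supp_nonempty ht)]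
  exact subset_closure

theorem face_of_subset_tile {t s : Finset (Euc d)} (ht : t ∈ P.tiles) (hs : s ⊆ t)
    (hn : s.Nonempty) : s ∈ P.faces :=
  P.toSimplicialComplex.down_closed ht.1 hs hn

/-- Nonempty interior forces `d + 1` affinely independent vertices, which is already the number of
vertices of the tile. -/
theorem eq_of_subset_of_interior_nonempty {s t : Finset (Euc d)} (ht : t ∈ P.tiles) (hst : s ⊆ t)
    (h : (interior (supp s)).Nonempty) : s = t := by
  have hn : s.Nonempty := by
    rw [← Finset.coe_nonempty, ← convexHull_nonempty_iff (𝕜 := ℝ)]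
    exact h.mono interior_subset
  refine Finset.eq_of_subset_of_card_le hst ?_
  rw [(P.card_eq_of_interior_nonempty (face_of_subset_tile ht hst hn)).1 h, ht.2]

theorem supp_inter_supp [DecidableEq (Euc d)] {s t : Finset (Euc d)} (hs : s ∈ P.faces)
    (ht : t ∈ P.faces) {z : Euc d} (h1 : z ∈ supp s) (h2 : z ∈ supp t) : z ∈ supp (s ∩ t) := by
  have := P.inter_subset_convexHull hs ht ⟨h1, h2⟩
  rwa [← Finset.coe_inter] at this

theorem nonempty_of_mem_supp {s : Finset (Euc d)} {z : Euc d} (h : z ∈ supp s) : s.Nonempty := by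
  rw [← Finset.coe_nonempty, ← convexHull_nonempty_iff (𝕜 := ℝ)]
  exact ⟨z, h⟩

/-- A tile is the closure of its interior, so the two interiors meet in a nonempty open set. It lies
in the hull of the common vertices, which therefore are all the vertices of both tiles. -/
theorem eq_of_mem_interior {t t' : Finset (Euc d)} (ht : t ∈ P.tiles) (ht' : t' ∈ P.tiles)
    {z : Euc d} (hz : z ∈ interior (supp t)) (hz' : z ∈ supp t') : t = t' := by
  classical
  obtain ⟨w, hw, hw'⟩ := mem_closure_iff.1 (supp_subset_closure_interior ht' hz') _
    isOpen_interior hz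
  have hsub : interior (supp t) ∩ interior (supp t') ⊆ supp (t ∩ t') := fun y hy =>
    supp_inter_supp ht.1 ht'.1 (interior_subset hy.1) (interior_subset hy.2)
  have hI : (interior (supp (t ∩ t'))).Nonempty :=
    ⟨w, interior_maximal hsub (isOpen_interior.inter isOpen_interior) ⟨hw, hw'⟩⟩
  exact (eq_of_subset_of_interior_nonempty ht Finset.inter_subset_left hI).symm.trans
    (eq_of_subset_of_interior_nonempty ht' Finset.inter_subset_right hI)

/-- By Krein–Milman the extreme points span the same hull, whose interior is nonempty, so none of
the vertices can be missing. Consequently a tile is determined by the set it covers. -/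
theorem extremePoints_supp {t : Finset (Euc d)} (ht : t ∈ P.tiles) :
    (supp t).extremePoints ℝ = t := by
  have hsub : (supp t).extremePoints ℝ ⊆ t := extremePoints_convexHull_subset
  have hfin : ((supp t).extremePoints ℝ).Finite := t.finite_toSet.subset hsub
  have hKM := closure_convexHull_extremePoints (isCompact_supp t) (convex_supp t)
  rw [(hfin.isCompact_convexHull (𝕜 := ℝ)).isClosed.closure_eq] at hKM
  have hs : supp hfin.toFinset = supp t := by
    show convexHull ℝ (hfin.toFinset : Set (Euc d)) = supp t
    rw [hfin.coe_toFinset, hKM]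
  have := eq_of_subset_of_interior_nonempty (s := hfin.toFinset) ht
    (fun v hv => by exact_mod_cast hsub (hfin.mem_toFinset.1 hv))
    (by rw [hs]; exact interior_supp_nonempty ht)
  rw [← hfin.coe_toFinset, this]

theorem eq_of_supp_eq {t s : Finset (Euc d)} (ht : t ∈ P.tiles) (hs : s.card = d + 1)
    (h : supp t = supp s) : t = s := by
  refine Finset.eq_of_subset_of_card_le (fun v hv => ?_) (by rw [hs, ht.2])
  have : v ∈ (supp s).extremePoints ℝ := by
    rw [← h, extremePoints_supp ht]; exact Finset.mem_coe.2 hv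
  exact_mod_cast extremePoints_convexHull_subset this

/-- Every point lies in the relative interior of a unique face: that face is contained in all faces
which contain the point. -/
theorem exists_carrier (P : SimplicialTiling d) (x : Euc d) :
    ∃ s ∈ P.faces, x ∈ supp s ∧ ∀ t ∈ P.faces, x ∈ supp t → s ⊆ t := by
  classical
  have hne : ∃ n, ∃ s ∈ P.faces, x ∈ supp s ∧ s.card = n := by
    obtain ⟨t, ht, hx⟩ := P.exists_tile_mem x
    exact ⟨_, t, ht.1, hx, rfl⟩
  obtain ⟨s, hs, hx, hc⟩ := Nat.find_spec hne
  refine ⟨s, hs, hx, fun t ht hxt => ?_⟩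
  have hmem := supp_inter_supp hs ht hx hxt
  have hf : s ∩ t ∈ P.faces :=
    P.toSimplicialComplex.down_closed hs Finset.inter_subset_left (nonempty_of_mem_supp hmem)
  have hmin := Nat.find_min' hne ⟨s ∩ t, hf, hmem, rfl⟩
  rw [← hc] at hmin
  rw [← Finset.inter_eq_left]
  exact Finset.eq_of_subset_of_card_le Finset.inter_subset_left hmin

/-! ### Uniform constants from finiteness up to translation -/

theorem exists_pos_forall_of_finite {ι : Type} {F : Set ι} (hF : F.Finite) (Q : ι → ℝ → Prop)
    (hanti : ∀ i r r', r ≤ r' → Q i r' → Q i r) (h : ∀ i ∈ F, ∃ r > 0, Q i r) :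
    ∃ r > 0, ∀ i ∈ F, Q i r := by
  induction F, hF using Set.Finite.induction_on with
  | empty => exact ⟨1, one_pos, by simp⟩
  | @insert a s _ _ ih =>
    obtain ⟨r, hr, h1⟩ := ih fun i hi => h i (Set.mem_insert_of_mem _ hi)
    obtain ⟨r', hr', h2⟩ := h a (Set.mem_insert _ _)
    refine ⟨min r r', lt_min hr hr', ?_⟩
    rintro i (rfl | hi)
    · exact hanti _ _ _ (min_le_right _ _) h2
    · exact hanti _ _ _ (min_le_left _ _) (h1 i hi)

theorem exists_diam_bound (P : SimplicialTiling d) :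
    ∃ D > 0, ∀ t ∈ P.tiles, ∀ a ∈ supp t, ∀ b ∈ supp t, dist a b ≤ D := by
  obtain ⟨F, hF, h⟩ := P.finite_prototiles
  obtain ⟨C, hC⟩ := (hF.image fun t => diam (supp t)).bddAbove
  refine ⟨max C 1, by positivity, fun t ht a ha b hb => ?_⟩
  obtain ⟨t₀, h₀, x, rfl⟩ := h t ht.1 ht.2
  rw [supp_translate] at ha hb
  obtain ⟨a', ha', rfl⟩ := ha
  obtain ⟨b', hb', rfl⟩ := hb
  rw [dist_add_left]
  exact (dist_le_diam_of_mem (isCompact_supp t₀).isBounded ha' hb').trans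
    ((hC ⟨t₀, h₀, rfl⟩).trans (le_max_left _ _))

/-- An upper bound for the diameters of the tiles. -/
def diamBound (P : SimplicialTiling d) : ℝ := P.exists_diam_bound.choose

theorem diamBound_pos (P : SimplicialTiling d) : 0 < P.diamBound :=
  P.exists_diam_bound.choose_spec.1

theorem dist_le_diamBound {t : Finset (Euc d)} (ht : t ∈ P.tiles) {a b : Euc d} (ha : a ∈ supp t)
    (hb : b ∈ supp t) : dist a b ≤ P.diamBound :=
  P.exists_diam_bound.choose_spec.2 t ht a ha b hb

theorem exists_ball_subset_tile (P : SimplicialTiling d) :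
    ∃ r > 0, ∀ t ∈ P.tiles, ∃ c, ball c r ⊆ interior (supp t) := by
  obtain ⟨F, hF, h⟩ := P.finite_prototiles
  obtain ⟨r, hr, h'⟩ := exists_pos_forall_of_finite hF
    (fun t r => (interior (supp t)).Nonempty → ∃ c, ball c r ⊆ interior (supp t))
    (fun t r r' hr hq hn => (hq hn).imp fun c hc => (ball_subset_ball hr).trans hc)
    (fun t _ => by
      by_cases hn : (interior (supp t)).Nonempty
      · obtain ⟨c, hc⟩ := hn
        obtain ⟨r, hr, hb⟩ := Metric.isOpen_iff.1 isOpen_interior c hc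
        exact ⟨r, hr, fun _ => ⟨c, hb⟩⟩
      · exact ⟨1, one_pos, fun h => (hn h).elim⟩)
  refine ⟨r, hr, fun t ht => ?_⟩
  obtain ⟨t₀, h₀, x, rfl⟩ := h t ht.1 ht.2
  have e : interior (supp (translate x t₀)) = (fun z => x + z) '' interior (supp t₀) := by
    rw [supp_translate]
    exact ((Homeomorph.addLeft x).image_interior _).symm
  have hn := interior_supp_nonempty ht
  rw [e] at hn ⊢
  obtain ⟨c, hc⟩ := h' t₀ h₀ hn.of_image
  refine ⟨x + c, fun z hz => ⟨z - x, hc ?_, by simp⟩⟩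
  rw [mem_ball, dist_eq_norm] at hz ⊢
  rwa [show z - x - c = z - (x + c) by abel]

/-- The tiles which touch the closed ball of radius `R` around `a`. -/
def tilesNear (P : SimplicialTiling d) (a : Euc d) (R : ℝ) : Set (Finset (Euc d)) :=
  {t | t ∈ P.tiles ∧ (supp t ∩ closedBall a R).Nonempty}

/-- A volume comparison: every tile contains a ball of a fixed radius, these balls are disjoint, and
for tiles near `a` they all lie in the ball of radius `R + P.diamBound`. The bound does not depend
on `a`. -/
theorem exists_packing_bound (P : SimplicialTiling d) (R : ℝ) :
    ∃ N : ℕ, ∀ a, (P.tilesNear a R).Finite ∧ (P.tilesNear a R).ncard ≤ N := by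
  obtain ⟨r, hr, hball⟩ := P.exists_ball_subset_tile
  choose! c hc using hball
  set V := volume (closedBall (0 : Euc d) (R + P.diamBound)) with hV
  set w := volume (ball (0 : Euc d) r) with hw
  have hV' : V ≠ ⊤ := measure_closedBall_lt_top.ne
  have hw0 : w ≠ 0 := (measure_ball_pos _ _ hr).ne'
  have hwt : w ≠ ⊤ := measure_ball_lt_top.ne
  obtain ⟨N, hN⟩ := ENNReal.exists_nat_gt (ENNReal.div_lt_top hV' hw0).ne
  have key : ∀ a, ∀ T : Finset (Finset (Euc d)), (T : Set (Finset (Euc d))) ⊆ P.tilesNear a R →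
      T.card ≤ N := by
    intro a T hT
    have hsub : (⋃ t ∈ T, ball (c t) r) ⊆ closedBall a (R + P.diamBound) := by
      intro z hz
      obtain ⟨t, ht, hz⟩ := Set.mem_iUnion₂.1 hz
      obtain ⟨htt, y, hy, hya⟩ := hT ht
      have := dist_le_diamBound htt (interior_subset (hc t htt hz)) hy
      rw [mem_closedBall] at hya ⊢
      linarith [dist_triangle z y a]
    have hm := measure_mono (μ := volume) hsub
    rw [measure_biUnion_finset _ (fun _ _ => measurableSet_ball)] at hm
    · simp only [Measure.addHaar_ball_center, Finset.sum_const, nsmul_eq_mul] at hm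
      rw [Measure.addHaar_closedBall_center] at hm
      have h2 : (T.card : ENNReal) ≤ V / w := (ENNReal.le_div_iff_mul_le (Or.inl hw0)
        (Or.inl hwt)).2 hm
      exact_mod_cast (h2.trans_lt hN).le
    · intro t ht t' ht' hne
      refine Set.disjoint_left.2 fun z hz hz' => hne ?_
      exact eq_of_mem_interior (hT ht).1 (hT ht').1 (hc t (hT ht).1 hz)
        (interior_subset (hc t' (hT ht').1 hz'))
  refine ⟨N, fun a => ?_⟩
  have hfin : (P.tilesNear a R).Finite := by
    by_contra hinf
    obtain ⟨T, hT, hcard⟩ := Set.Infinite.exists_subset_card_eq hinf (N + 1)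
    have := key a T hT
    omega
  refine ⟨hfin, ?_⟩
  rw [Set.ncard_eq_toFinset_card _ hfin]
  exact key a _ (by simp)

theorem finite_tilesNear (P : SimplicialTiling d) (a : Euc d) (R : ℝ) :
    (P.tilesNear a R).Finite := by
  obtain ⟨N, hN⟩ := P.exists_packing_bound R
  exact (hN a).1

theorem nbhd_monotone (S : Set (Euc d)) : Monotone (P.nbhd S) :=
  monotone_nat_of_le_succ (P.nbhd_succ S)

theorem tiles_of_mem_nbhd {S : Set (Euc d)} {k : ℕ} {t : Finset (Euc d)} (h : t ∈ P.nbhd S k) :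
    t ∈ P.tiles := by
  cases k with
  | zero => exact h.elim
  | succ k => exact h.1

/-- Tiles near a point of `S` belong to a neighbourhood of `S` of bounded order. -/
theorem exists_tilesNear_subset_nbhd (P : SimplicialTiling d) (R : ℝ) :
    ∃ k > 0, ∀ (S : Set (Euc d)), ∀ a ∈ S, P.tilesNear a R ⊆ P.nbhd S k := by
  obtain ⟨N, hN⟩ := P.exists_packing_bound R
  refine ⟨N + 1, Nat.succ_pos N, fun S a ha t ht => ?_⟩
  by_contra hcon
  obtain ⟨htt, b, hbt, hba⟩ := ht
  set L := segment ℝ a b with hL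
  have hR : 0 ≤ R := dist_nonneg.trans hba
  have hLsub : L ⊆ closedBall a R :=
    (convex_closedBall a R).segment_subset (mem_closedBall_self hR) hba
  set T : Set (Finset (Euc d)) := {t | t ∈ P.tiles ∧ (supp t ∩ L).Nonempty} with hT
  have hTsub : T ⊆ P.tilesNear a R := fun s hs =>
    ⟨hs.1, hs.2.mono (Set.inter_subset_inter_right _ hLsub)⟩
  have hTfin : T.Finite := (hN a).1.subset hTsub
  have htT : t ∈ T := ⟨htt, b, hbt, right_mem_segment ℝ a b⟩
  -- As long as `t` is not reached, each step of the neighbourhood construction picks up a new tile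
  -- meeting the segment from `a` to `b`. At most `N` tiles meet it, so step `N + 1` is impossible.
  have key : ∀ j, j ≤ N + 1 → j ≤ (T ∩ P.nbhd S j).ncard := by
    intro j
    induction j with
    | zero => simp
    | succ j ih =>
      intro hj
      have ih' := ih (by omega)
      have hmono : T ∩ P.nbhd S j ⊆ T ∩ P.nbhd S (j + 1) :=
        Set.inter_subset_inter_right _ (P.nbhd_succ S j)
      obtain ⟨t₂, h2T, h2n, h2⟩ : ∃ t₂ ∈ T, t₂ ∉ P.nbhd S j ∧ t₂ ∈ P.nbhd S (j + 1) := by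
        obtain ⟨ta, hta, hata⟩ := P.exists_tile_mem a
        have haL : a ∈ L := left_mem_segment ℝ a b
        by_cases hj0 : ta ∈ P.nbhd S j
        · have hclosed : ∀ U : Set (Finset (Euc d)), IsClosed (⋃ s ∈ T ∩ U, supp s) := fun U =>
            (hTfin.subset Set.inter_subset_left).isClosed_biUnion fun s _ => isClosed_supp s
          have hpre : IsPreconnected L := (convex_segment a b).isPreconnected
          -- The tiles already reached and the others give two closed sets covering the segment and
          -- both meeting it. Connectedness yields a common point, hence an unreached tile touching
          -- a reached one.
          obtain ⟨z, hzL, hz1, hz2⟩ := isPreconnected_closed_iff.1 hpre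
            (⋃ s ∈ T ∩ P.nbhd S j, supp s) (⋃ s ∈ T ∩ (P.nbhd S j)ᶜ, supp s)
            (hclosed _) (hclosed _) (by
              intro z hz
              obtain ⟨s, hs, hzs⟩ := P.exists_tile_mem z
              by_cases hsn : s ∈ P.nbhd S j
              · exact Or.inl (Set.mem_iUnion₂.2 ⟨s, ⟨⟨hs, z, hzs, hz⟩, hsn⟩, hzs⟩)
              · exact Or.inr (Set.mem_iUnion₂.2 ⟨s, ⟨⟨hs, z, hzs, hz⟩, hsn⟩, hzs⟩))
            ⟨a, haL, Set.mem_iUnion₂.2 ⟨ta, ⟨⟨hta, a, hata, haL⟩, hj0⟩, hata⟩⟩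
            ⟨b, right_mem_segment ℝ a b, Set.mem_iUnion₂.2 ⟨t, ⟨htT, fun h =>
              hcon (nbhd_monotone S (by omega) h)⟩, hbt⟩⟩
          obtain ⟨s₁, ⟨_, hs₁⟩, hz1⟩ := Set.mem_iUnion₂.1 hz1
          obtain ⟨s₂, ⟨hs₂, hs₂'⟩, hz2⟩ := Set.mem_iUnion₂.1 hz2
          exact ⟨s₂, hs₂, hs₂', hs₂.1, z, hz2, Or.inr (Set.mem_iUnion₂.2 ⟨s₁, hs₁, hz1⟩)⟩
        · exact ⟨ta, ⟨hta, a, hata, haL⟩, hj0, hta, a, hata, Or.inl ha⟩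
      have hss : T ∩ P.nbhd S j ⊂ T ∩ P.nbhd S (j + 1) :=
        ⟨hmono, fun h => h2n (h ⟨h2T, h2⟩).2⟩
      have := Set.ncard_lt_ncard hss (hTfin.subset Set.inter_subset_left)
      omega
  have h1 := key (N + 1) le_rfl
  have h2 : (T ∩ P.nbhd S (N + 1)).ncard ≤ N :=
    (Set.ncard_le_ncard (Set.inter_subset_left.trans hTsub) (hN a).1).trans (hN a).2
  omega

end Geometry

end SimplicialTiling

end PatternEquivariant

end

noncomputable section

namespace PatternEquivariant

open MeasureTheory Metric

namespace SimplicialTiling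

/-! ### Finite local complexity and a Lebesgue number for the cover by stars -/

section FLC

variable {d : ℕ} {P : SimplicialTiling d}

theorem exists_common_vertex {t t' : Finset (Euc d)} (ht : t ∈ P.tiles) (ht' : t' ∈ P.tiles)
    {z : Euc d} (h : z ∈ supp t) (h' : z ∈ supp t') : ∃ w, w ∈ t ∧ w ∈ t' := by
  classical
  obtain ⟨w, hw⟩ := nonempty_of_mem_supp (supp_inter_supp ht.1 ht'.1 h h')
  exact ⟨w, Finset.mem_inter.1 hw⟩

theorem exists_finite_edges (P : SimplicialTiling d) :
    ∃ E : Set (Euc d), E.Finite ∧ ∀ t ∈ P.tiles, ∀ u ∈ t, ∀ w ∈ t, u - w ∈ E := by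
  obtain ⟨F, hF, h⟩ := P.finite_prototiles
  refine ⟨⋃ t ∈ F, (fun p : Euc d × Euc d => p.1 - p.2) '' ((t : Set (Euc d)) ×ˢ t),
    hF.biUnion fun t _ => (t.finite_toSet.prod t.finite_toSet).image _, ?_⟩
  intro t ht u hu w hw
  obtain ⟨t₀, h₀, x, rfl⟩ := h t ht.1 ht.2
  refine Set.mem_iUnion₂.2 ⟨t₀, h₀, (u - x, w - x), ⟨?_, ?_⟩, by simp⟩
  · exact_mod_cast mem_translate.1 hu
  · exact_mod_cast mem_translate.1 hw

/-- Touching tiles share a vertex, so vertices of a `k`-neighbourhood differ from those of the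
central tile by sums of boundedly many edge vectors, and there are only finitely many edge vectors.
-/
theorem exists_finite_nbhd_vertices (P : SimplicialTiling d) (k : ℕ) :
    ∃ V : Set (Euc d), V.Finite ∧ ∀ t ∈ P.tiles, ∀ t' ∈ P.nbhd (supp t) k, ∀ u ∈ t', ∀ b ∈ t,
      u - b ∈ V := by
  obtain ⟨E, hE, h⟩ := P.exists_finite_edges
  induction k with
  | zero => exact ⟨∅, Set.finite_empty, fun t _ t' ht' => ht'.elim⟩
  | succ k ih =>
    obtain ⟨V, hV, hV'⟩ := ih
    refine ⟨(fun p : Euc d × Euc d => p.1 + p.2) '' (E ×ˢ (V ∪ E)),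
      (hE.prod (hV.union hE)).image _, ?_⟩
    rintro t ht t' ⟨ht', z, hz, hz'⟩ u hu b hb
    rcases hz' with hz' | hz'
    · obtain ⟨w, hw, hw'⟩ := exists_common_vertex ht' ht hz hz'
      exact ⟨(u - w, w - b), ⟨h t' ht' u hu w hw, Or.inr (h t ht w hw' b hb)⟩, by simp⟩
    · obtain ⟨s, hs, hzs⟩ := Set.mem_iUnion₂.1 hz'
      obtain ⟨w, hw, hw'⟩ := exists_common_vertex ht' (tiles_of_mem_nbhd hs) hz hzs
      exact ⟨(u - w, w - b), ⟨h t' ht' u hu w hw, Or.inl (hV' t ht s hs w hw' b hb)⟩, by simp⟩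

/-- Finite local complexity for neighbourhoods of every order: moved so that a vertex of the tile
becomes the origin, the whole neighbourhood is a set of subsets of one finite set of points. -/
theorem finite_nbhd_classes (P : SimplicialTiling d) (k : ℕ) :
    {c : Finset (Euc d) × Set (Finset (Euc d)) | ∃ t ∈ P.tiles, ∃ b ∈ t,
      c = (translate (-b) t, translate (-b) '' P.nbhd (supp t) k)}.Finite := by
  obtain ⟨V, hV, hV'⟩ := P.exists_finite_nbhd_vertices k
  obtain ⟨E, hE, hE'⟩ := P.exists_finite_edges
  have hfin : ∀ V : Set (Euc d), V.Finite → {s : Finset (Euc d) | (s : Set (Euc d)) ⊆ V}.Finite := by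
    intro V hV
    refine (hV.toFinset.powerset.finite_toSet).subset fun s hs => ?_
    simpa using hs
  refine ((hfin E hE).prod (hfin V hV).powerset).subset ?_
  rintro _ ⟨t, ht, b, hb, rfl⟩
  refine ⟨fun v hv => ?_, ?_⟩
  · have hv' : v + b ∈ t := by simpa using hv
    simpa using hE' t ht _ hv' b hb
  · rintro _ ⟨t', ht', rfl⟩ v hv
    have hv' : v + b ∈ t' := by simpa using hv
    simpa using hV' t ht t' ht' _ hv' b hb

theorem finite_nbhd (t : Finset (Euc d)) (ht : t ∈ P.tiles) (k : ℕ) :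
    (P.nbhd (supp t) k).Finite := by
  obtain ⟨V, hV, hV'⟩ := P.exists_finite_nbhd_vertices k
  have hn : t.Nonempty := Finset.card_pos.1 (by rw [ht.2]; omega)
  obtain ⟨b, hb⟩ := hn
  refine ((hV.image (· + b)).toFinset.powerset.finite_toSet).subset fun s hs => ?_
  simp only [Finset.coe_powerset, Set.mem_preimage, Set.Finite.coe_toFinset, Set.mem_powerset_iff]
  intro v hv
  exact ⟨v - b, hV' t ht s hs v (by exact_mod_cast hv) b hb, by simp⟩

/-- Any vertex `v` of the smallest face containing `x` belongs to all tiles through `x`. Hence the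
complements of the unions of the nearby tiles missing `v` form an open cover of the compact tile,
and its Lebesgue number is what is wanted. -/
theorem exists_lebesgue_number_tile {t : Finset (Euc d)} (ht : t ∈ P.tiles) (k : ℕ) :
    ∃ ε > 0, ∀ x ∈ supp t, ∃ v, ∀ t' ∈ P.nbhd (supp t) k, (supp t' ∩ closedBall x ε).Nonempty →
      v ∈ t' := by
  have hfin := finite_nbhd t ht k
  obtain ⟨δ, hδ, h⟩ := lebesgue_number_lemma_of_metric (isCompact_supp t)
    (c := fun v : Euc d => (⋃ t' ∈ {t' | t' ∈ P.nbhd (supp t) k ∧ v ∉ t'}, supp t')ᶜ)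
    (fun v => ((hfin.subset fun _ h => h.1).isClosed_biUnion
      fun s _ => isClosed_supp s).isOpen_compl) (by
      intro x _
      obtain ⟨s, hs, _, hmin⟩ := P.exists_carrier x
      obtain ⟨v, hv⟩ := Geometry.SimplicialComplex.nonempty_of_mem_faces hs
      refine Set.mem_iUnion.2 ⟨v, fun hx => ?_⟩
      obtain ⟨t', ⟨ht', hvt⟩, hxt⟩ := Set.mem_iUnion₂.1 hx
      exact hvt (hmin t' (tiles_of_mem_nbhd ht').1 hxt hv))
  refine ⟨δ / 2, half_pos hδ, fun x hx => ?_⟩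
  obtain ⟨v, hv⟩ := h x hx
  refine ⟨v, fun t' ht' ⟨z, hz, hzx⟩ => ?_⟩
  by_contra hvt
  exact hv ((closedBall_subset_ball (half_lt_self hδ)) hzx)
    (Set.mem_iUnion₂.2 ⟨t', ⟨ht', hvt⟩, hz⟩)

/-- There is `ε > 0` such that all tiles which touch an `ε`-ball have a common vertex. -/
theorem exists_lebesgue_number (P : SimplicialTiling d) :
    ∃ ε > 0, ∀ x, ∃ v, ∀ t ∈ P.tilesNear x ε, v ∈ t := by
  obtain ⟨k, -, hk⟩ := P.exists_tilesNear_subset_nbhd 1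
  have hmem : ∀ (b z : Euc d) (s : Finset (Euc d)), z ∈ supp (translate (-b) s) ↔ b + z ∈ supp s := by
    intro b z s
    rw [← add_mem_supp_translate (x := -b) (z := b + z), neg_add_cancel_left]
  -- The property is invariant under translation and there are finitely many classes of tiles with
  -- their `k`-neighbourhoods, so one `ε` serves all. Keeping it at most `1` ensures that the
  -- `k`-neighbourhood contains every tile to be considered.
  obtain ⟨ε, hε, h⟩ := exists_pos_forall_of_finite (P.finite_nbhd_classes k)
    (fun c ε => ∀ x ∈ supp c.1, ∃ v, ∀ t' ∈ c.2, (supp t' ∩ closedBall x ε).Nonempty → v ∈ t')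
    (fun c r r' hr hq x hx => (hq x hx).imp fun v hv t' ht' hn => hv t' ht'
      (hn.mono (Set.inter_subset_inter_right _ (closedBall_subset_closedBall hr))))
    (by
      rintro _ ⟨t, ht, b, hb, rfl⟩
      obtain ⟨ε, hε, h⟩ := exists_lebesgue_number_tile ht k
      refine ⟨ε, hε, fun x hx => ?_⟩
      obtain ⟨v, hv⟩ := h (b + x) ((hmem _ _ _).1 hx)
      refine ⟨v - b, ?_⟩
      rintro _ ⟨t', ht', rfl⟩ ⟨z, hz, hzx⟩
      have := hv t' ht' ⟨b + z, (hmem _ _ _).1 hz, by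
        rwa [mem_closedBall, dist_add_left]⟩
      simpa using this)
  refine ⟨min ε 1, lt_min hε one_pos, fun x => ?_⟩
  obtain ⟨t, ht, hxt⟩ := P.exists_tile_mem x
  obtain ⟨b, hb⟩ : t.Nonempty := nonempty_of_mem_supp hxt
  obtain ⟨v, hv⟩ := h _ ⟨t, ht, b, hb, rfl⟩ (x - b) (by rw [hmem]; simpa using hxt)
  refine ⟨b + v, fun t' ⟨ht', z, hz, hzx⟩ => ?_⟩
  have hmem' : t' ∈ P.nbhd (supp t) k := hk (supp t) x hxt
    ⟨ht', z, hz, closedBall_subset_closedBall (min_le_right _ _) hzx⟩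
  have := hv (translate (-b) t') ⟨t', hmem', rfl⟩ ⟨z - b, by rw [hmem]; simpa using hz, by
    rw [mem_closedBall, dist_sub_right]
    exact closedBall_subset_closedBall (min_le_left _ _) hzx⟩
  simpa [add_comm] using this

end FLC

/-! ### Local equality of the tiling with a translate -/

section LocEq

variable {d : ℕ}

/-- Translation by `x` is a bijection from the tiles near `a` to the tiles near `x + a`. -/
def LocEq (P : SimplicialTiling d) (R : ℝ) (a x : Euc d) : Prop :=
  (∀ t ∈ P.tilesNear a R, translate x t ∈ P.tiles) ∧
    ∀ t ∈ P.tilesNear (x + a) R, translate (-x) t ∈ P.tiles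

variable {P : SimplicialTiling d}

theorem tilesNear_mono {a a' : Euc d} {R R' : ℝ} (h : dist a' a + R ≤ R') :
    P.tilesNear a' R ⊆ P.tilesNear a R' := by
  rintro t ⟨ht, z, hz, hza⟩
  refine ⟨ht, z, hz, ?_⟩
  rw [mem_closedBall] at hza ⊢
  linarith [dist_triangle z a' a]

theorem mem_tilesNear_of_mem {t : Finset (Euc d)} (ht : t ∈ P.tiles) {a : Euc d} (ha : a ∈ supp t)
    {R : ℝ} (hR : 0 ≤ R) : t ∈ P.tilesNear a R :=
  ⟨ht, a, ha, mem_closedBall_self hR⟩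

theorem LocEq.mono {a a' x : Euc d} {R R' : ℝ} (e : P.LocEq R' a x) (h : dist a' a + R ≤ R') :
    P.LocEq R a' x :=
  ⟨fun t ht => e.1 t (tilesNear_mono h ht),
    fun t ht => e.2 t (tilesNear_mono (by rwa [dist_add_left]) ht)⟩

theorem LocEq.symm {a x : Euc d} {R : ℝ} (e : P.LocEq R a x) : P.LocEq R (x + a) (-x) :=
  ⟨e.2, by simpa using e.1⟩

theorem LocEq.translate_mem_tilesNear {a x : Euc d} {R R' : ℝ} (e : P.LocEq R a x) (h : R' ≤ R)
    {t : Finset (Euc d)} (ht : t ∈ P.tilesNear a R') : translate x t ∈ P.tilesNear (x + a) R' := by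
  refine ⟨e.1 t (tilesNear_mono (by simpa using h) ht), ?_⟩
  obtain ⟨-, z, hz, hza⟩ := ht
  exact ⟨x + z, add_mem_supp_translate.2 hz, by rwa [mem_closedBall, dist_add_left]⟩

theorem LocEq.translate_neg_mem_tilesNear {a x : Euc d} {R R' : ℝ} (e : P.LocEq R a x)
    (h : R' ≤ R) {t : Finset (Euc d)} (ht : t ∈ P.tilesNear (x + a) R') :
    translate (-x) t ∈ P.tilesNear a R' := by
  simpa using e.symm.translate_mem_tilesNear h ht

theorem vlt_translate_iff {t : Finset (Euc d)} (ht : t ∈ P.tiles) {x : Euc d}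
    (hx : translate x t ∈ P.tiles) {u v : Euc d} (hu : u ∈ t) (hv : v ∈ t) :
    P.vlt (x + u) (x + v) ↔ P.vlt u v := by
  refine ⟨fun h => ?_, P.vlt_translate t ht.1 ht.2 x hx.1 u hu v hv⟩
  have := P.vlt_translate (translate x t) hx.1 hx.2 (-x) (by simpa using ht.1) (x + u) (by simpa)
    (x + v) (by simpa) h
  simpa using this

/-! ### Patches, translated tiles and combinatorial neighbourhoods -/

/-- A tile touching the `R`-ball lies strictly inside the larger ball, so its trace there is the
whole tile; the tile of the other patch with the same trace must then be its translate. -/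
theorem translate_mem_tiles_of_patch_eq {a b : Euc d} {R : ℝ}
    (e : P.patch a (R + P.diamBound + 1) = P.patch b (R + P.diamBound + 1))
    {t : Finset (Euc d)} (ht : t ∈ P.tilesNear a R) : translate (b - a) t ∈ P.tiles := by
  obtain ⟨htt, p, hp, hpa⟩ := ht
  set R' := R + P.diamBound + 1 with hR'
  have hin : ∀ z, z + a ∈ supp t → ‖z‖ < R' := by
    intro z hz
    have h1 := dist_le_diamBound htt hz hp
    have h2 := dist_triangle (z + a) p a
    rw [mem_closedBall] at hpa
    have h3 : dist (z + a) a = ‖z‖ := by rw [dist_eq_norm, add_sub_cancel_right]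
    linarith
  have hmem : {z | z + a ∈ supp t} ∩ closedBall 0 R' ∈ P.patch b R' := e ▸ ⟨t, htt, rfl⟩
  obtain ⟨t', ht', e'⟩ := hmem
  have hiff : ∀ z, ‖z‖ ≤ R' → (z + a ∈ supp t ↔ z + b ∈ supp t') := by
    intro z hz
    have := Set.ext_iff.1 e' z
    simpa [hz] using this
  have hsub : ∀ z, z + a ∈ supp t → z + b ∈ supp t' := fun z hz => (hiff z (hin z hz).le).1 hz
  -- The matching tile could a priori stick out of the ball. By convexity it would then have a point
  -- of norm exactly `R'`, which would correspond to a point of `t` at that distance, and `t` has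
  -- none.
  have hsup : ∀ z, z + b ∈ supp t' → z + a ∈ supp t := by
    intro z hz
    by_contra hcon
    have hzR : R' < ‖z‖ := by
      by_contra! h
      exact hcon ((hiff z h).2 hz)
    have hp' : p - a + a ∈ supp t := by simpa using hp
    obtain ⟨z₁, hz₁, hn⟩ := (convex_segment (p - a) z).isPreconnected.intermediate_value
      (left_mem_segment ℝ _ _) (right_mem_segment ℝ _ _) continuous_norm.continuousOn
      (show R' ∈ Set.Icc ‖p - a‖ ‖z‖ from ⟨(hin _ hp').le, hzR.le⟩)
    have hconv : Convex ℝ {z | z + b ∈ supp t'} := (convex_supp t').translate_preimage_left b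
    have h1 := hconv.segment_subset (hsub _ hp') hz hz₁
    exact absurd (hin z₁ ((hiff z₁ hn.le).2 h1)) (by simp [hn])
  have hs : supp t' = supp (translate (b - a) t) := by
    ext y
    have h1 := hsub (y - b)
    have h2 := hsup (y - b)
    rw [sub_add_cancel] at h1 h2
    have h3 : y = (b - a) + (y - b + a) := by abel
    nth_rw 2 [h3]
    rw [add_mem_supp_translate]
    exact ⟨h2, h1⟩
  rw [← eq_of_supp_eq ht' (by rw [card_translate, htt.2]) hs]
  exact ht'

theorem locEq_of_patch_eq {a x : Euc d} {R : ℝ}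
    (e : P.patch a (R + P.diamBound + 1) = P.patch (x + a) (R + P.diamBound + 1)) :
    P.LocEq R a x := by
  refine ⟨fun t ht => ?_, fun t ht => ?_⟩
  · simpa using translate_mem_tiles_of_patch_eq e ht
  · simpa using translate_mem_tiles_of_patch_eq e.symm ht

/-- Tiles far away contribute the empty trace to a patch. To compare patches, the empty trace has to
occur on the other side too, which needs a tile missing the ball. -/
theorem exists_tile_not_near [Nontrivial (Euc d)] (b : Euc d) (R : ℝ) :
    ∃ t ∈ P.tiles, ¬ (supp t ∩ closedBall b R).Nonempty := by
  obtain ⟨y, hy⟩ := NormedSpace.exists_lt_norm ℝ (Euc d) (R + P.diamBound)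
  obtain ⟨t, ht, hyt⟩ := P.exists_tile_mem (y + b)
  refine ⟨t, ht, fun ⟨z, hz, hzb⟩ => ?_⟩
  have h1 := dist_le_diamBound ht hyt hz
  have h2 := dist_triangle (y + b) z b
  rw [mem_closedBall] at hzb
  have h3 : dist (y + b) b = ‖y‖ := by rw [dist_eq_norm, add_sub_cancel_right]
  linarith

theorem patch_subset_of_translate {a x : Euc d} {R : ℝ} [Nontrivial (Euc d)]
    (e : ∀ t ∈ P.tilesNear a R, translate x t ∈ P.tiles) : P.patch a R ⊆ P.patch (x + a) R := by
  rintro _ ⟨t, ht, rfl⟩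
  by_cases hn : (supp t ∩ closedBall a R).Nonempty
  · refine ⟨_, e t ⟨ht, hn⟩, ?_⟩
    congr 1
    ext z
    simp only [Set.mem_ofPred_eq]
    rw [show z + (x + a) = x + (z + a) by abel, add_mem_supp_translate]
  · obtain ⟨t', ht', hn'⟩ := exists_tile_not_near (P := P) (x + a) R
    refine ⟨t', ht', ?_⟩
    have key : ∀ (s : Finset (Euc d)) (b : Euc d), ¬ (supp s ∩ closedBall b R).Nonempty →
        {z | z + b ∈ supp s} ∩ closedBall 0 R = ∅ := by
      intro s b h
      ext z
      simp only [Set.mem_inter_iff, Set.mem_ofPred_eq, Set.mem_empty_iff_false, iff_false, not_and]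
      intro hz hz'
      exact h ⟨z + b, hz, by simpa [dist_eq_norm] using hz'⟩
    rw [key _ _ hn, key _ _ hn']

theorem LocEq.patch_eq {a x : Euc d} {R : ℝ} (e : P.LocEq R a x) :
    P.patch a R = P.patch (x + a) R := by
  -- In dimension `0` no tile misses the ball, but there all points coincide.
  rcases subsingleton_or_nontrivial (Euc d) with h | h
  · rw [Subsingleton.elim (x + a) a]
  · refine (patch_subset_of_translate e.1).antisymm ?_
    have := patch_subset_of_translate e.2
    rwa [neg_add_cancel_left] at this

/-- Strong pattern equivariance of forms in terms of `LocEq`. -/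
theorem mem_sForms_iff {l : ℕ} (ω : smoothForms d l) :
    ω ∈ P.sForms l ↔ ∃ R, ∀ a x, P.LocEq R a x → ω.1 (x + a) = ω.1 a := by
  constructor
  · rintro ⟨R, -, h⟩
    exact ⟨R, fun a x e => h _ _ e.patch_eq.symm⟩
  · rintro ⟨R, h⟩
    have hD := P.diamBound_pos
    refine ⟨max R 0 + P.diamBound + 1, by positivity, fun x y e => ?_⟩
    have e' : P.LocEq (max R 0) y (x - y) := locEq_of_patch_eq (by rw [sub_add_cancel]; exact e.symm)
    simpa using h y (x - y) (e'.mono (by simp))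

theorem Simplex.exists_tile {n : ℕ} (σ : P.Simplex n) : ∃ t ∈ P.tiles, ∀ i, σ.vertex i ∈ t := by
  obtain ⟨s, hs, e⟩ := σ.isFace
  obtain ⟨t, ht, hc, hst⟩ := P.exists_tile s hs
  exact ⟨t, ⟨ht, hc⟩, fun i => hst (Finset.mem_coe.1 (e ▸ Set.mem_range_self i))⟩

theorem Simplex.vertex_mem_carrier {n : ℕ} (σ : P.Simplex n) (i : Fin (n + 1)) :
    σ.vertex i ∈ σ.carrier := subset_convexHull _ _ (Set.mem_range_self i)

theorem Simplex.carrier_subset_supp {n : ℕ} {σ : P.Simplex n} {t : Finset (Euc d)}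
    (h : ∀ i, σ.vertex i ∈ t) : σ.carrier ⊆ supp t :=
  convexHull_mono (by rintro _ ⟨i, rfl⟩; exact h i)

theorem mem_tilesNear_of_mem_nbhd {S : Set (Euc d)} {a : Euc d}
    (hS : S ⊆ closedBall a P.diamBound) {j : ℕ} {t : Finset (Euc d)} (ht : t ∈ P.nbhd S j) :
    t ∈ P.tilesNear a (j * P.diamBound) := by
  have hD := P.diamBound_pos
  induction j generalizing t with
  | zero => exact ht.elim
  | succ j ih =>
    obtain ⟨htt, z, hz, hz'⟩ := ht
    refine ⟨htt, z, hz, ?_⟩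
    push_cast
    rcases hz' with hz' | hz'
    · exact closedBall_subset_closedBall (by nlinarith [Nat.cast_nonneg (α := ℝ) j]) (hS hz')
    · obtain ⟨s, hs, hzs⟩ := Set.mem_iUnion₂.1 hz'
      obtain ⟨hst, w, hw, hwa⟩ := ih hs
      have := dist_le_diamBound hst hzs hw
      rw [mem_closedBall] at hwa ⊢
      linarith [dist_triangle z w a]

theorem image_nbhd_subset_of_tilesNear {S : Set (Euc d)} {a x : Euc d} {k : ℕ}
    (hS : S ⊆ closedBall a P.diamBound)
    (e : ∀ t ∈ P.tilesNear a (k * P.diamBound), translate x t ∈ P.tiles) :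
    translate x '' P.nbhd S k ⊆ P.nbhd ((fun z => x + z) '' S) k := by
  have hD := P.diamBound_pos
  suffices h : ∀ j ≤ k, ∀ t ∈ P.nbhd S j, translate x t ∈ P.nbhd ((fun z => x + z) '' S) j by
    rintro _ ⟨t, ht, rfl⟩
    exact h k le_rfl t ht
  intro j
  induction j with
  | zero => exact fun _ t ht => ht.elim
  | succ j ih =>
    intro hj t ht
    have hn : t ∈ P.tilesNear a (k * P.diamBound) := by
      refine tilesNear_mono (a' := a) ?_ (mem_tilesNear_of_mem_nbhd hS ht)
      rw [dist_self, zero_add]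
      have : ((j + 1 : ℕ) : ℝ) ≤ k := by exact_mod_cast hj
      exact mul_le_mul_of_nonneg_right this hD.le
    obtain ⟨-, z, hz, hz'⟩ := ht
    refine ⟨e t hn, x + z, add_mem_supp_translate.2 hz, ?_⟩
    rcases hz' with hz' | hz'
    · exact Or.inl ⟨z, hz', rfl⟩
    · obtain ⟨s, hs, hzs⟩ := Set.mem_iUnion₂.1 hz'
      exact Or.inr (Set.mem_iUnion₂.2
        ⟨translate x s, ih (by omega) s hs, add_mem_supp_translate.2 hzs⟩)

/-- Each step of a neighbourhood moves away by at most the diameter of a tile, so the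
`k`-neighbourhood of a simplex consists of tiles within `k * P.diamBound` of any of its vertices. -/
theorem nbhdTranslate_of_locEq {n k : ℕ} {x : Euc d} {σ σ' : P.Simplex n}
    (hv : ∀ i, σ'.vertex i = x + σ.vertex i) (i : Fin (n + 1))
    (e : P.LocEq (k * P.diamBound) (σ.vertex i) x) : P.NbhdTranslate k x σ σ' := by
  have hc := carrier_translate hv
  have hball : ∀ τ : P.Simplex n, τ.carrier ⊆ closedBall (τ.vertex i) P.diamBound := by
    intro τ y hy
    obtain ⟨t, ht, htv⟩ := τ.exists_tile
    exact dist_le_diamBound ht (Simplex.carrier_subset_supp htv hy) (subset_supp (htv i))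
  refine ⟨hv, Set.Subset.antisymm ?_ ?_⟩
  · have h := image_nbhd_subset_of_tilesNear (k := k) (hball σ') (by rw [hv i]; exact e.2)
    rw [hc, Set.image_image] at h
    simp only [neg_add_cancel_left, Set.image_id'] at h
    intro t ht
    exact ⟨translate (-x) t, h ⟨t, hc ▸ ht, rfl⟩, by simp⟩
  · rw [hc]
    exact image_nbhd_subset_of_tilesNear (hball σ) e.1

/-- Strong pattern equivariance of cochains in terms of `LocEq`. -/
theorem mem_sCochains_iff {n : ℕ} (c : P.Cochain n) :
    c ∈ P.sCochains n ↔ ∃ R, ∀ x (σ σ' : P.Simplex n), (∀ i, σ'.vertex i = x + σ.vertex i) →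
      ∀ i, P.LocEq R (σ.vertex i) x → c σ' = c σ := by
  constructor
  · rintro ⟨k, -, h⟩
    exact ⟨k * P.diamBound, fun x σ σ' hv i e => (h x σ σ' (nbhdTranslate_of_locEq hv i e)).symm⟩
  · rintro ⟨R, h⟩
    -- Conversely, a metric ball around a vertex is exhausted by a neighbourhood of bounded order,
    -- so equality of `k`-neighbourhoods up to translation implies `LocEq`.
    obtain ⟨k, hk, hn⟩ := P.exists_tilesNear_subset_nbhd R
    refine ⟨k, hk, fun x σ σ' e => (h x σ σ' e.1 0 ⟨fun t ht => ?_, fun t ht => ?_⟩).symm⟩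
    · have := hn σ.carrier _ (σ.vertex_mem_carrier 0) ht
      exact tiles_of_mem_nbhd (e.2.symm.subset ⟨t, this, rfl⟩)
    · rw [← e.1 0] at ht
      have := hn σ'.carrier _ (σ'.vertex_mem_carrier 0) ht
      exact tiles_of_mem_nbhd (e.symm.2.symm.subset ⟨t, this, rfl⟩)

end LocEq

end SimplicialTiling

end PatternEquivariant

end

noncomputable section

namespace PatternEquivariant

set_option maxSynthPendingDepth 3

open MeasureTheory Metric

namespace SimplicialTiling

/-! ### A pattern equivariant partition of unity subordinate to the stars of the vertices -/

section PartitionOfUnity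

variable {d : ℕ} {P : SimplicialTiling d}

/-- The common vertices of the tiles which touch the `ε`-ball around `x`. -/
def commonVertices (P : SimplicialTiling d) (ε : ℝ) (x : Euc d) : Set (Euc d) :=
  {v | ∀ t ∈ P.tilesNear x ε, v ∈ t}

/-- The points for which `v` is the smallest common vertex of the tiles nearby. -/
def vertexRegion (P : SimplicialTiling d) (ε : ℝ) (v : Euc d) : Set (Euc d) :=
  {x | v ∈ P.commonVertices ε x ∧ ∀ w ∈ P.commonVertices ε x, w = v ∨ P.vlt v w}

theorem exists_vlt_min {t : Finset (Euc d)} (ht : t ∈ P.tiles) (s : Finset (Euc d)) (hs : s ⊆ t)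
    (hn : s.Nonempty) : ∃ v ∈ s, ∀ w ∈ s, w = v ∨ P.vlt v w := by
  classical
  induction hn using Finset.Nonempty.cons_induction with
  | singleton a => exact ⟨a, by simp, by simp⟩
  | cons a s ha hn ih =>
    rw [Finset.cons_subset] at hs
    obtain ⟨v, hv, h⟩ := ih hs.2
    by_cases hav : a = v
    · exact (ha (hav ▸ hv)).elim
    rcases P.vlt_total t ht.1 ht.2 a hs.1 v (hs.2 hv) hav with h1 | h1
    · refine ⟨a, by simp, fun w hw => ?_⟩
      rcases Finset.mem_cons.1 hw with rfl | hw
      · exact Or.inl rfl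
      · rcases h w hw with rfl | h2
        · exact Or.inr h1
        · exact Or.inr (P.vlt_trans t ht.1 ht.2 a hs.1 v (hs.2 hv) w (hs.2 hw) h1 h2)
    · refine ⟨v, by simp [hv], fun w hw => ?_⟩
      rcases Finset.mem_cons.1 hw with rfl | hw
      · exact Or.inr h1
      · exact h w hw

theorem vlt_asymm {t : Finset (Euc d)} (ht : t ∈ P.tiles) {u v : Euc d} (hu : u ∈ t) (hv : v ∈ t)
    (h : P.vlt u v) : ¬ P.vlt v u := fun h' =>
  P.vlt_irrefl t ht.1 ht.2 u hu (P.vlt_trans t ht.1 ht.2 u hu v hv u hu h h')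

variable {ε : ℝ}

/-- The common vertices are vertices of one tile; only because of this is `vlt` a total order on
them. -/
theorem commonVertices_subset (hε : 0 < ε) {x : Euc d} {t : Finset (Euc d)} (ht : t ∈ P.tiles)
    (hx : x ∈ supp t) : P.commonVertices ε x ⊆ t := fun _ hv =>
  hv t (mem_tilesNear_of_mem ht hx hε.le)

theorem exists_mem_vertexRegion (hε : 0 < ε) (h : ∀ x, (P.commonVertices ε x).Nonempty)
    (x : Euc d) : ∃ v, x ∈ P.vertexRegion ε v := by
  obtain ⟨t, ht, hx⟩ := P.exists_tile_mem x
  have hsub := commonVertices_subset hε ht hx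
  have hfin : (P.commonVertices ε x).Finite := t.finite_toSet.subset hsub
  obtain ⟨v, hv, hmin⟩ := exists_vlt_min ht hfin.toFinset
    (fun w hw => by exact_mod_cast hsub (hfin.mem_toFinset.1 hw))
    (hfin.toFinset_nonempty.2 (h x))
  exact ⟨v, hfin.mem_toFinset.1 hv, fun w hw => hmin w (hfin.mem_toFinset.2 hw)⟩

theorem vertexRegion_disjoint (hε : 0 < ε) {v w : Euc d} (hvw : v ≠ w) :
    Disjoint (P.vertexRegion ε v) (P.vertexRegion ε w) := by
  refine Set.disjoint_left.2 fun x hv hw => ?_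
  obtain ⟨t, ht, hx⟩ := P.exists_tile_mem x
  have hsub := commonVertices_subset hε ht hx
  exact vlt_asymm ht (hsub hv.1) (hsub hw.1) ((hv.2 w hw.1).resolve_left hvw.symm)
    ((hw.2 v hv.1).resolve_left hvw)

theorem vertexRegion_subset_closedBall (hε : 0 < ε) (v : Euc d) :
    P.vertexRegion ε v ⊆ closedBall v P.diamBound := by
  intro x hx
  obtain ⟨t, ht, hxt⟩ := P.exists_tile_mem x
  exact dist_le_diamBound ht hxt (subset_supp (commonVertices_subset hε ht hxt hx.1))

theorem countable_tiles (P : SimplicialTiling d) : P.tiles.Countable := by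
  have : P.tiles ⊆ ⋃ n : ℕ, P.tilesNear 0 n := by
    intro t ht
    obtain ⟨z, hz⟩ := (interior_supp_nonempty ht).mono interior_subset
    obtain ⟨n, hn⟩ := exists_nat_ge (dist z 0)
    exact Set.mem_iUnion.2 ⟨n, ht, z, hz, hn⟩
  exact (Set.countable_iUnion fun n : ℕ => (P.finite_tilesNear 0 n).countable).mono this

/-- The point `v` fails to be a common vertex exactly on the union of the closed `ε`-thickenings of
the countably many tiles which miss `v`. -/
theorem measurableSet_commonVertices (hε : 0 < ε) (v : Euc d) :
    MeasurableSet {x | v ∈ P.commonVertices ε x} := by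
  have e : {x | v ∈ P.commonVertices ε x} =
      (⋃ t ∈ {t | t ∈ P.tiles ∧ v ∉ t}, cthickening ε (supp t))ᶜ := by
    ext x
    simp only [Set.mem_ofPred_eq, Set.mem_compl_iff, Set.mem_iUnion, not_exists, commonVertices,
      tilesNear, (isCompact_supp _).cthickening_eq_biUnion_closedBall hε.le]
    constructor
    · rintro h t ⟨ht, hv⟩ z hz hxz
      exact hv (h t ⟨ht, z, hz, by rwa [mem_closedBall, dist_comm]⟩)
    · rintro h t ⟨ht, z, hz, hxz⟩
      by_contra hv
      exact h t ⟨ht, hv⟩ z hz (by rwa [mem_closedBall, dist_comm])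
  rw [e]
  refine (MeasurableSet.biUnion (P.countable_tiles.mono fun t h => h.1) fun t _ => ?_).compl
  exact isClosed_cthickening.measurableSet

theorem measurableSet_vertexRegion (hε : 0 < ε) (v : Euc d) :
    MeasurableSet (P.vertexRegion ε v) := by
  have e : P.vertexRegion ε v = {x | v ∈ P.commonVertices ε x} \
      ⋃ w ∈ {w | (∃ t ∈ P.tiles, w ∈ t) ∧ ¬ (w = v ∨ P.vlt v w)},
        {x | w ∈ P.commonVertices ε x} := by
    ext x
    simp only [vertexRegion, Set.mem_sdiff, Set.mem_ofPred_eq, Set.mem_iUnion, not_exists]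
    refine and_congr_right fun _ => ⟨fun h w hw hx => hw.2 (h w hx), fun h w hw => ?_⟩
    by_contra hcon
    obtain ⟨t, ht, hxt⟩ := P.exists_tile_mem x
    exact h w ⟨⟨t, ht, commonVertices_subset hε ht hxt hw⟩, hcon⟩ hw
  rw [e]
  refine (measurableSet_commonVertices hε v).diff (MeasurableSet.biUnion ?_
    fun w _ => measurableSet_commonVertices hε w)
  have : (⋃ t ∈ P.tiles, (t : Set (Euc d))).Countable :=
    P.countable_tiles.biUnion fun t _ => t.finite_toSet.countable
  refine this.mono ?_
  rintro w ⟨⟨t, ht, hw⟩, -⟩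
  exact Set.mem_iUnion₂.2 ⟨t, ht, hw⟩

theorem LocEq.mem_commonVertices_iff {x u v : Euc d} (e : P.LocEq ε u x) :
    x + v ∈ P.commonVertices ε (x + u) ↔ v ∈ P.commonVertices ε u := by
  constructor
  · intro h t ht
    simpa using h _ (e.translate_mem_tilesNear le_rfl ht)
  · intro h t ht
    have := h _ (e.translate_neg_mem_tilesNear le_rfl ht)
    simpa [add_comm] using this

/-- The region depends only on the tiles touching the `ε`-ball and on their vertex order, and that
order is invariant under translation between tiles. -/
theorem LocEq.mem_vertexRegion_iff (hε : 0 < ε) {x u v : Euc d} (e : P.LocEq ε u x) :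
    x + u ∈ P.vertexRegion ε (x + v) ↔ u ∈ P.vertexRegion ε v := by
  obtain ⟨t, ht, hut⟩ := P.exists_tile_mem u
  have hsub := commonVertices_subset hε ht hut
  have htx := e.1 t (mem_tilesNear_of_mem ht hut hε.le)
  simp only [vertexRegion, Set.mem_ofPred_eq, e.mem_commonVertices_iff]
  refine and_congr_right fun hv => ⟨fun h w hw => ?_, fun h w hw => ?_⟩
  · have := h (x + w) (e.mem_commonVertices_iff.2 hw)
    rwa [add_right_inj, vlt_translate_iff ht htx (hsub hv) (hsub hw)] at this
  · obtain ⟨w, rfl⟩ : ∃ w', w = x + w' := ⟨w - x, by simp⟩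
    have hw' := e.mem_commonVertices_iff.1 hw
    rw [add_right_inj, vlt_translate_iff ht htx (hsub hv) (hsub hw')]
    exact h w hw'

/-- A smooth partition of unity `φ v` indexed by the vertices `v`, with uniformly bounded
derivatives, strongly pattern equivariant, and such that all tiles which touch the `ε`-ball around a
point of the support of `φ v` have `v` as a vertex. -/
structure PartitionOfUnity (P : SimplicialTiling d) where
  toFun : Euc d → Euc d → ℝ
  ε : ℝ
  ε_pos : 0 < ε
  contDiff : ∀ v, ContDiff ℝ (⊤ : ℕ∞) (toFun v)
  bounded : ∀ j : ℕ, ∃ C : ℝ, ∀ v y, ‖iteratedFDeriv ℝ j (toFun v) y‖ ≤ C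
  mem_tile : ∀ v y, toFun v y ≠ 0 → ∀ t ∈ P.tilesNear y ε, v ∈ t
  sum_eq_one : ∀ y, ∀ t ∈ P.tiles, y ∈ supp t → ∑ v ∈ t, toFun v y = 1
  equivariant : ∃ R, ∀ x v y, P.LocEq R y x → toFun (x + v) (x + y) = toFun v y

/-! ### Mollification of the vertex regions -/

/-- The mollified indicator function of the region of the vertex `v`. -/
def mollified (P : SimplicialTiling d) (ε : ℝ) (ρ : Euc d → ℝ) (v y : Euc d) : ℝ :=
  ∫ u in P.vertexRegion ε v, ρ (y - u)

variable {ρ : Euc d → ℝ}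

theorem isFiniteMeasure_vertexRegion (hε : 0 < ε) (v : Euc d) :
    IsFiniteMeasure (volume.restrict (P.vertexRegion ε v)) :=
  ⟨by
    rw [Measure.restrict_apply_univ]
    exact (measure_mono (vertexRegion_subset_closedBall hε v)).trans_lt measure_closedBall_lt_top⟩

theorem ae_mem_closedBall_vertexRegion (hε : 0 < ε) (v : Euc d) :
    ∀ᵐ u ∂(volume.restrict (P.vertexRegion ε v)), u ∈ closedBall v P.diamBound :=
  (ae_restrict_mem (measurableSet_vertexRegion hε v)).mono
    fun _ hu => vertexRegion_subset_closedBall hε v hu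

theorem contDiff_sub_comp (hρ : ContDiff ℝ (⊤ : ℕ∞) ρ) :
    ContDiff ℝ (⊤ : ℕ∞) (fun p : Euc d × Euc d => ρ (p.2 - p.1)) :=
  hρ.comp (contDiff_snd.sub contDiff_fst)

theorem contDiff_mollified (hε : 0 < ε) (hρ : ContDiff ℝ (⊤ : ℕ∞) ρ) (v : Euc d) :
    ContDiff ℝ (⊤ : ℕ∞) (P.mollified ε ρ v) := by
  have := isFiniteMeasure_vertexRegion (P := P) hε v
  exact contDiff_integral (isCompact_closedBall v P.diamBound)
    (ae_mem_closedBall_vertexRegion hε v) (contDiff_sub_comp hρ)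

/-- Every region lies in a ball of radius `P.diamBound`, so its volume, and with it the bound, is
independent of `v`. -/
theorem bounded_mollified (hε : 0 < ε) (hρ : ContDiff ℝ (⊤ : ℕ∞) ρ) (hc : HasCompactSupport ρ)
    (j : ℕ) : ∃ C : ℝ, ∀ v y, ‖iteratedFDeriv ℝ j (P.mollified ε ρ v) y‖ ≤ C := by
  have hcont : Continuous (iteratedFDeriv ℝ j ρ) :=
    hρ.continuous_iteratedFDeriv (by exact_mod_cast le_top)
  obtain ⟨C, hC⟩ := hcont.bounded_above_of_compact_support (hc.iteratedFDeriv j)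
  have hC0 : 0 ≤ C := (norm_nonneg _).trans (hC 0)
  refine ⟨C * (volume (closedBall (0 : Euc d) P.diamBound)).toReal, fun v y => ?_⟩
  have := isFiniteMeasure_vertexRegion (P := P) hε v
  refine (norm_iteratedFDeriv_integral_le (isCompact_closedBall v P.diamBound)
    (ae_mem_closedBall_vertexRegion hε v) (contDiff_sub_comp hρ) j y C fun u _ => ?_).trans ?_
  · rw [iteratedFDeriv_comp_sub]
    exact hC _
  · refine mul_le_mul_of_nonneg_left ?_ hC0
    rw [measureReal_restrict_apply_univ, measureReal_def]
    refine ENNReal.toReal_mono measure_closedBall_lt_top.ne ?_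
    rw [← Measure.addHaar_closedBall_center volume v]
    exact measure_mono (vertexRegion_subset_closedBall hε v)

/-- A nonzero value at `y` comes from a point `u` of the region within `ε / 2` of `y`, and every
tile touching the `ε / 2`-ball around `y` touches the `ε`-ball around `u`. -/
theorem mollified_mem_tile (hs : Function.support ρ ⊆ ball 0 (ε / 2)) {v y : Euc d}
    (h : P.mollified ε ρ v y ≠ 0) {t : Finset (Euc d)} (ht : t ∈ P.tilesNear y (ε / 2)) :
    v ∈ t := by
  have : ∃ u ∈ P.vertexRegion ε v, ρ (y - u) ≠ 0 := by
    by_contra! hcon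
    exact h (setIntegral_eq_zero_of_forall_eq_zero hcon)
  obtain ⟨u, hu, hρu⟩ := this
  have hd : dist y u < ε / 2 := by
    have := hs hρu
    rwa [mem_ball_zero_iff, ← dist_eq_norm] at this
  exact hu.1 t (tilesNear_mono (by linarith) ht)

/-- Points within `ε / 2` of `y` have `t` among the tiles touching their `ε`-balls, so their chosen
vertex belongs to `t`. The disjoint regions of the vertices of `t` thus cover the support of `ρ (y -
·)`, and the integrals add up to that of `ρ`. -/
theorem sum_mollified (hε : 0 < ε) (hn : ∀ x, (P.commonVertices ε x).Nonempty)
    (hρ : Continuous ρ) (hc : HasCompactSupport ρ)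
    (hs : Function.support ρ ⊆ ball 0 (ε / 2)) (h1 : ∫ u, ρ u = 1) {y : Euc d}
    {t : Finset (Euc d)} (ht : t ∈ P.tiles) (hy : y ∈ supp t) :
    ∑ v ∈ t, P.mollified ε ρ v y = 1 := by
  have hint : Integrable (fun u => ρ (y - u)) :=
    (hρ.integrable_of_hasCompactSupport hc).comp_sub_left y
  have e : ∑ v ∈ t, P.mollified ε ρ v y = ∫ u in ⋃ v ∈ t, P.vertexRegion ε v, ρ (y - u) :=
    (integral_biUnion_finset t (fun v _ => measurableSet_vertexRegion hε v)
      (fun v _ w _ hvw => vertexRegion_disjoint hε hvw) fun v _ => hint.integrableOn).symm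
  rw [e, setIntegral_eq_integral_of_forall_compl_eq_zero, integral_sub_left_eq_self ρ volume y, h1]
  intro u hu
  by_contra hρu
  have hd : dist y u < ε / 2 := by
    have := hs hρu
    rwa [mem_ball_zero_iff, ← dist_eq_norm] at this
  obtain ⟨v, hv⟩ := exists_mem_vertexRegion hε hn u
  refine hu (Set.mem_iUnion₂.2 ⟨v, hv.1 t ⟨ht, y, hy, ?_⟩, hv⟩)
  rw [mem_closedBall]
  linarith

theorem mollified_equivariant (hε : 0 < ε) (hs : Function.support ρ ⊆ ball 0 (ε / 2))
    {x v y : Euc d} (e : P.LocEq (2 * ε) y x) :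
    P.mollified ε ρ (x + v) (x + y) = P.mollified ε ρ v y := by
  rw [mollified, mollified, ← integral_indicator (measurableSet_vertexRegion hε _),
    ← integral_indicator (measurableSet_vertexRegion hε _)]
  have key : ∀ u, (P.vertexRegion ε (x + v)).indicator (fun u => ρ (x + y - u)) (x + u) =
      (P.vertexRegion ε v).indicator (fun u => ρ (y - u)) u := by
    intro u
    have hsub : x + y - (x + u) = y - u := by abel
    by_cases hρu : ρ (y - u) = 0
    · by_cases h1 : x + u ∈ P.vertexRegion ε (x + v) <;> by_cases h2 : u ∈ P.vertexRegion ε v <;>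
        simp [h1, h2, hρu]
    · have hd : dist y u < ε / 2 := by
        have := hs hρu
        rwa [mem_ball_zero_iff, ← dist_eq_norm] at this
      have e' : P.LocEq ε u x := e.mono (by rw [dist_comm]; linarith)
      by_cases h2 : u ∈ P.vertexRegion ε v
      · rw [Set.indicator_of_mem h2, Set.indicator_of_mem ((e'.mem_vertexRegion_iff hε).2 h2), hsub]
      · rw [Set.indicator_of_notMem h2,
          Set.indicator_of_notMem fun h => h2 ((e'.mem_vertexRegion_iff hε).1 h)]
  rw [← integral_add_left_eq_self _ x]
  exact integral_congr_ae (Filter.Eventually.of_forall key)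

theorem nonempty_partitionOfUnity (P : SimplicialTiling d) : Nonempty P.PartitionOfUnity := by
  obtain ⟨ε, hε, h⟩ := P.exists_lebesgue_number
  let f : ContDiffBump (0 : Euc d) := ⟨ε / 4, ε / 2, by positivity, by linarith⟩
  have hsm : ContDiff ℝ (⊤ : ℕ∞) (f.normed volume) := f.contDiff_normed
  have hs : Function.support (f.normed volume) ⊆ ball 0 (ε / 2) :=
    (f.support_normed_eq (μ := volume)).subset
  have hc : HasCompactSupport (f.normed volume) := f.hasCompactSupport_normed
  exact ⟨{
    toFun := P.mollified ε (f.normed volume)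
    ε := ε / 2
    ε_pos := half_pos hε
    contDiff := contDiff_mollified hε hsm
    bounded := bounded_mollified hε hsm hc
    mem_tile := fun v y hv t ht => mollified_mem_tile hs hv ht
    sum_eq_one := fun y t ht hy => sum_mollified hε h hsm.continuous hc hs f.integral_normed ht hy
    equivariant := ⟨2 * ε, fun x v y e => mollified_equivariant hε hs e⟩ }⟩

end PartitionOfUnity

end SimplicialTiling

end PatternEquivariant

end

noncomputable section

namespace PatternEquivariant

/-! ### Spaces with a strong subspace and a scale of bounds -/

/-- A real vector space with a subspace `S` of strongly pattern equivariant elements and a relation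
`Bd j M x` which bounds `x` by `M` with respect to the `j`th seminorm. -/
structure PESpace (X : Type) [AddCommGroup X] [Module ℝ X] where
  S : Submodule ℝ X
  Bd : ℕ → ℝ → X → Prop
  bd_zero : ∀ j, Bd j 0 0
  bd_add : ∀ {j M M' x y}, Bd j M x → Bd j M' y → Bd j (M + M') (x + y)
  bd_smul : ∀ {j M x} (c : ℝ), Bd j M x → Bd j (|c| * M) (c • x)
  bd_mono : ∀ {j M M' x}, M ≤ M' → Bd j M x → Bd j M' x

namespace PESpace

variable {X Y Z : Type} [AddCommGroup X] [Module ℝ X] [AddCommGroup Y] [Module ℝ Y]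
  [AddCommGroup Z] [Module ℝ Z] (𝒳 : PESpace X) {𝒴 : PESpace Y} {𝒵 : PESpace Z}

/-- The weakly pattern equivariant elements: the bounded elements in the closure of `S`. -/
def W : Submodule ℝ X where
  carrier := {x | (∀ j, ∃ M, 𝒳.Bd j M x) ∧ ∀ j, ∀ ε > 0, ∃ s ∈ 𝒳.S, 𝒳.Bd j ε (x - s)}
  add_mem' := by
    rintro x y ⟨hx, hx'⟩ ⟨hy, hy'⟩
    refine ⟨fun j => ?_, fun j ε hε => ?_⟩
    · obtain ⟨M, hM⟩ := hx j
      obtain ⟨M', hM'⟩ := hy j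
      exact ⟨_, 𝒳.bd_add hM hM'⟩
    · obtain ⟨s, hs, h⟩ := hx' j (ε / 2) (half_pos hε)
      obtain ⟨s', hs', h'⟩ := hy' j (ε / 2) (half_pos hε)
      refine ⟨s + s', add_mem hs hs', ?_⟩
      rw [add_sub_add_comm, ← add_halves ε]
      exact 𝒳.bd_add h h'
  zero_mem' := ⟨fun j => ⟨0, 𝒳.bd_zero j⟩, fun j ε hε => ⟨0, zero_mem _, by
    rw [sub_zero]; exact 𝒳.bd_mono hε.le (𝒳.bd_zero j)⟩⟩
  smul_mem' := by
    rintro c x ⟨hx, hx'⟩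
    refine ⟨fun j => ?_, fun j ε hε => ?_⟩
    · obtain ⟨M, hM⟩ := hx j
      exact ⟨_, 𝒳.bd_smul c hM⟩
    · obtain ⟨s, hs, h⟩ := hx' j (ε / (|c| + 1)) (by positivity)
      refine ⟨c • s, Submodule.smul_mem _ c hs, ?_⟩
      rw [← smul_sub]
      refine 𝒳.bd_mono ?_ (𝒳.bd_smul c h)
      calc |c| * (ε / (|c| + 1)) ≤ (|c| + 1) * (ε / (|c| + 1)) := by gcongr; linarith
        _ = ε := by field_simp

/-- The strongly (for `b = false`) or weakly (for `b = true`) pattern equivariant elements. -/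
def V (b : Bool) : Submodule ℝ X := if b then 𝒳.W else 𝒳.S

/-- The null elements. -/
def N : Submodule ℝ X where
  carrier := {x | ∀ j, 𝒳.Bd j 0 x}
  add_mem' hx hy j := by simpa using 𝒳.bd_add (hx j) (hy j)
  zero_mem' := 𝒳.bd_zero
  smul_mem' c x hx j := by simpa using 𝒳.bd_smul c (hx j)

theorem mem_W {x : X} : x ∈ 𝒳.W ↔
    (∀ j, ∃ M, 𝒳.Bd j M x) ∧ ∀ j, ∀ ε > 0, ∃ s ∈ 𝒳.S, 𝒳.Bd j ε (x - s) := Iff.rfl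

variable {𝒳}

/-- A linear map which is bounded and maps strongly pattern equivariant elements to strongly pattern
equivariant ones. -/
structure IsPEOp (𝒳 : PESpace X) (𝒴 : PESpace Y) (T : X →ₗ[ℝ] Y) : Prop where
  map_S : ∀ x ∈ 𝒳.S, T x ∈ 𝒴.S
  bound : ∀ j, ∃ j' C, ∀ M x, 0 ≤ M → 𝒳.Bd j' M x → 𝒴.Bd j (C * M) (T x)

theorem IsPEOp.map_N {T : X →ₗ[ℝ] Y} (hT : IsPEOp 𝒳 𝒴 T) {x : X} (hx : x ∈ 𝒳.N) :
    T x ∈ 𝒴.N := by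
  intro j
  obtain ⟨j', C, h⟩ := hT.bound j
  simpa using h 0 x le_rfl (hx j')

theorem IsPEOp.map_W {T : X →ₗ[ℝ] Y} (hT : IsPEOp 𝒳 𝒴 T) {x : X} (hx : x ∈ 𝒳.W) :
    T x ∈ 𝒴.W := by
  refine ⟨fun j => ?_, fun j ε hε => ?_⟩
  · obtain ⟨j', C, h⟩ := hT.bound j
    obtain ⟨M, hM⟩ := hx.1 j'
    exact ⟨_, h (max M 0) x (le_max_right _ _) (𝒳.bd_mono (le_max_left _ _) hM)⟩
  · obtain ⟨j', C, h⟩ := hT.bound j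
    -- The constant `C` may be zero or negative, hence the denominator `|C| + 1`.
    obtain ⟨s, hs, hb⟩ := hx.2 j' (ε / (|C| + 1)) (by positivity)
    refine ⟨T s, hT.map_S s hs, ?_⟩
    rw [← map_sub]
    refine 𝒴.bd_mono ?_ (h _ _ (by positivity) hb)
    calc C * (ε / (|C| + 1)) ≤ (|C| + 1) * (ε / (|C| + 1)) := by
          gcongr; linarith [le_abs_self C]
      _ = ε := by field_simp

theorem IsPEOp.map_V {T : X →ₗ[ℝ] Y} (hT : IsPEOp 𝒳 𝒴 T) {b : Bool} {x : X} (hx : x ∈ 𝒳.V b) :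
    T x ∈ 𝒴.V b := by
  cases b with
  | false => exact hT.map_S x hx
  | true => exact hT.map_W hx

end PESpace

/-! ### Double complexes with exact rows and columns -/

section DoubleComplex

variable {K : ℕ → ℕ → Type} [∀ p q, AddCommGroup (K p q)] [∀ p q, Module ℝ (K p q)]

/-- A double complex, up to null elements, on subspaces `V p q` of `K p q`, with exact rows, and
with exact columns in positive degrees. -/
structure ExactDoubleComplex (V N : ∀ p q, Submodule ℝ (K p q))
    (D : ∀ p q, K p q →ₗ[ℝ] K p (q + 1)) (δ : ∀ p q, K p q →ₗ[ℝ] K (p + 1) q) : Prop where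
  D_V : ∀ {p q z}, z ∈ V p q → D p q z ∈ V p (q + 1)
  D_N : ∀ {p q z}, z ∈ N p q → D p q z ∈ N p (q + 1)
  δ_V : ∀ {p q z}, z ∈ V p q → δ p q z ∈ V (p + 1) q
  δ_N : ∀ {p q z}, z ∈ N p q → δ p q z ∈ N (p + 1) q
  D_D : ∀ {p q} (z : K p q), D p (q + 1) (D p q z) ∈ N p (q + 2)
  δ_δ : ∀ {p q} (z : K p q), δ (p + 1) q (δ p q z) = 0
  comm : ∀ {p q} (z : K p q), D (p + 1) q (δ p q z) = δ p (q + 1) (D p q z)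
  col_zero : ∀ {p z}, z ∈ V (p + 1) 0 → D (p + 1) 0 z ∈ N (p + 1) 1 → z ∈ N (p + 1) 0
  col_succ : ∀ {p q z}, z ∈ V (p + 1) (q + 1) → D (p + 1) (q + 1) z ∈ N (p + 1) (q + 2) →
    ∃ y ∈ V (p + 1) q, z - D (p + 1) q y ∈ N (p + 1) (q + 1)
  row_zero : ∀ {q z}, z ∈ V 0 q → δ 0 q z ∈ N 1 q → z ∈ N 0 q
  row_succ : ∀ {p q z}, z ∈ V (p + 1) q → δ (p + 1) q z ∈ N (p + 2) q →
    ∃ u ∈ V p q, z - δ p q u ∈ N (p + 1) q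

namespace ExactDoubleComplex

variable {V N : ∀ p q, Submodule ℝ (K p q)} {D : ∀ p q, K p q →ₗ[ℝ] K p (q + 1)}
  {δ : ∀ p q, K p q →ₗ[ℝ] K (p + 1) q}

/-- Row exactness writes `w` as `δ u` up to null elements, and subtracting `D u` from `y` then
removes `δ y`, which agrees with `D w = D (δ u)`, because `D` and `δ` commute. -/
theorem exists_correction (h : ExactDoubleComplex V N D δ) {p q : ℕ} {y : K p (q + 1)}
    {w : K (p + 1) q} (hw : w ∈ V (p + 1) q)
    (hδw : δ (p + 1) q w ∈ N (p + 2) q) (hyw : δ p (q + 1) y - D (p + 1) q w ∈ N (p + 1) (q + 1)) :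
    ∃ u ∈ V p q, δ p (q + 1) (y - D p q u) ∈ N (p + 1) (q + 1) := by
  obtain ⟨u, hu, hwu⟩ := h.row_succ hw hδw
  refine ⟨u, hu, ?_⟩
  have := add_mem hyw (h.D_N hwu)
  rwa [map_sub, sub_add_sub_cancel, h.comm, ← map_sub] at this

/-- Column exactness alone gives a primitive `y`, but not one with `δ y` null. Since `δ y` is again
closed for both differentials, now in column `p + 2` and one degree lower, induction on the degree
supplies its primitive and `exists_correction` repairs `y`. In degree zero `δ y` is null by
`col_zero`. -/
theorem exists_primitive (h : ExactDoubleComplex V N D δ) (q : ℕ) :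
    ∀ {p} {z : K (p + 1) (q + 1)}, z ∈ V (p + 1) (q + 1) → D _ _ z ∈ N (p + 1) (q + 2) →
      δ _ _ z ∈ N (p + 2) (q + 1) →
      ∃ y ∈ V (p + 1) q, δ _ _ y ∈ N (p + 2) q ∧ z - D _ _ y ∈ N (p + 1) (q + 1) := by
  induction q with
  | zero =>
    intro p z hz hD hδ
    obtain ⟨y, hy, hzy⟩ := h.col_succ hz hD
    refine ⟨y, hy, h.col_zero (h.δ_V hy) ?_, hzy⟩
    have := sub_mem hδ (h.δ_N hzy)
    rwa [map_sub, sub_sub_cancel, ← h.comm] at this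
  | succ q ih =>
    intro p z hz hD hδ
    obtain ⟨y, hy, hzy⟩ := h.col_succ hz hD
    have hDδ : D _ _ (δ _ _ y) ∈ N (p + 2) (q + 2) := by
      have := sub_mem hδ (h.δ_N hzy)
      rwa [map_sub, sub_sub_cancel, ← h.comm] at this
    obtain ⟨w, hw, hδw, hyw⟩ := ih (h.δ_V hy) hDδ (by rw [h.δ_δ]; exact zero_mem _)
    obtain ⟨u, hu, huy⟩ := h.exists_correction hw hδw hyw
    refine ⟨_, sub_mem hy (h.D_V hu), huy, ?_⟩
    rw [map_sub, ← sub_add]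
    exact add_mem hzy (h.D_D u)

theorem exact_zero (h : ExactDoubleComplex V N D δ) {z : K 0 0} (hz : z ∈ V 0 0)
    (hD : D _ _ z ∈ N 0 1) : z ∈ N 0 0 := by
  refine h.row_zero hz (h.col_zero (h.δ_V hz) ?_)
  rw [h.comm]
  exact h.δ_N hD

/-- The element `δ z` lies in an exact column and is closed for both differentials. A `δ`-closed
primitive of it comes from column `0` by row exactness, and this yields a primitive of `z` by
injectivity of `δ` on column `0`. -/
theorem exact_succ (h : ExactDoubleComplex V N D δ) {q : ℕ} {z : K 0 (q + 1)}
    (hz : z ∈ V 0 (q + 1)) (hD : D _ _ z ∈ N 0 (q + 2)) :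
    ∃ y ∈ V 0 q, z - D _ _ y ∈ N 0 (q + 1) := by
  have hDδ : D _ _ (δ _ _ z) ∈ N 1 (q + 2) := by
    rw [h.comm]
    exact h.δ_N hD
  obtain ⟨w, hw, hδw, hzw⟩ := h.exists_primitive q (h.δ_V hz) hDδ
    (by rw [h.δ_δ]; exact zero_mem _)
  obtain ⟨u, hu, huz⟩ := h.exists_correction hw hδw hzw
  exact ⟨u, hu, h.row_zero (sub_mem hz (h.D_V hu)) huz⟩

end ExactDoubleComplex

end DoubleComplex

/-! ### The Čech differential -/

section Cech

variable {E X Y : Type} [AddCommGroup X] [Module ℝ X] [AddCommGroup Y] [Module ℝ Y]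

/-- The Čech differential on functions of tuples. -/
def cechD (E X : Type) [AddCommGroup X] [Module ℝ X] (p : ℕ) :
    ((Fin p → E) → X) →ₗ[ℝ] ((Fin (p + 1) → E) → X) where
  toFun c σ := ∑ i : Fin (p + 1), ((-1 : ℝ) ^ (i : ℕ)) • c fun j => σ (i.succAbove j)
  map_add' c c' := by
    funext σ
    simp [Finset.sum_add_distrib]
  map_smul' a c := by
    funext σ
    simp [Finset.smul_sum, smul_comm a]

theorem cechD_apply {p : ℕ} (c : (Fin p → E) → X) (σ : Fin (p + 1) → E) :
    cechD E X p c σ = ∑ i : Fin (p + 1), ((-1 : ℝ) ^ (i : ℕ)) • c fun j => σ (i.succAbove j) := rfl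

theorem cechD_cechD {p : ℕ} (c : (Fin p → E) → X) : cechD E X (p + 1) (cechD E X p c) = 0 := by
  funext τ
  simp only [cechD_apply, Finset.smul_sum, Pi.zero_apply, smul_smul]
  rw [← Finset.sum_product', Finset.univ_product_univ]
  -- The two orders of omitting the same pair of indices carry opposite signs.
  refine Finset.sum_involution
    (fun x _ => if h : (x.2 : ℕ) < x.1 then
        (⟨x.2, by omega⟩, ⟨x.1 - 1, by omega⟩)
      else (⟨x.2 + 1, by omega⟩, ⟨x.1, by omega⟩)) ?_ ?_ (fun _ _ => Finset.mem_univ _) ?_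
  · rintro ⟨i, j⟩ -
    have hf : ∀ (i i' : Fin (p + 2)) (j j' : Fin (p + 1)),
        (∀ k, i.succAbove (j.succAbove k) = i'.succAbove (j'.succAbove k)) →
        (c fun k => τ (i.succAbove (j.succAbove k))) =
          c fun k => τ (i'.succAbove (j'.succAbove k)) := by
      intro i i' j j' h
      simp only [h]
    split_ifs with h
    · rw [hf ⟨j, by omega⟩ i ⟨i - 1, by omega⟩ j]
      · obtain ⟨i', hi'⟩ : ∃ i', (i : ℕ) = i' + 1 := ⟨i - 1, by simp at h; omega⟩
        simp only [hi', ← add_smul]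
        convert zero_smul ℝ _
        simp [pow_succ]; ring
      · intro k
        ext
        simp only [Fin.succAbove, Fin.lt_def] at h ⊢
        grind
    · rw [hf ⟨j + 1, by omega⟩ i ⟨i, by simp at h; omega⟩ j]
      · simp only [← add_smul]
        convert zero_smul ℝ _
        simp [pow_succ]; ring
      · intro k
        ext
        simp only [Fin.succAbove, Fin.lt_def] at h ⊢
        grind
  · rintro ⟨i, j⟩ - -
    split_ifs with h <;> (simp [Fin.ext_iff] at h ⊢; omega)
  · rintro ⟨i, j⟩ -
    by_cases h : (j : ℕ) < i <;> simp [h] <;> grind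

theorem cechD_comp {p : ℕ} (T : X →ₗ[ℝ] Y) (c : (Fin p → E) → X) :
    cechD E Y p (fun σ => T (c σ)) = fun σ => T (cechD E X p c σ) := by
  funext σ
  simp [cechD_apply]

theorem cechD_cons_zero (c : (Fin 0 → E) → X) (v : E) (σ : Fin 0 → E) :
    cechD E X 0 c (Fin.cons v σ) = c σ := by
  rw [cechD_apply, Fin.sum_univ_succ, Fin.sum_univ_zero, add_zero]
  simp only [Fin.val_zero, pow_zero, one_smul]
  congr 1

/-- The identity behind both row contractions: putting a fixed point in front of the tuple is a
contracting homotopy of the Čech complex, and gluing averages over the choice of that point. -/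
theorem cechD_cons_succ {p : ℕ} (c : (Fin (p + 1) → E) → X) (v : E) (σ : Fin (p + 1) → E) :
    cechD E X (p + 1) c (Fin.cons v σ) =
      c σ - ∑ i : Fin (p + 1), ((-1 : ℝ) ^ (i : ℕ)) •
        c (Fin.cons v fun j => σ (i.succAbove j)) := by
  have h : ∀ i : Fin (p + 1), (fun j => (Fin.cons v σ : Fin (p + 2) → E) (i.succ.succAbove j)) =
      Fin.cons v fun j => σ (i.succAbove j) := by
    intro i
    funext j
    refine Fin.cases ?_ (fun j => ?_) j <;> simp
  rw [cechD_apply, Fin.sum_univ_succ]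
  simp only [h, Fin.val_zero, pow_zero, one_smul, Fin.succAbove_zero, Fin.cons_succ, Fin.val_succ,
    pow_succ, mul_neg, mul_one, neg_smul, Finset.sum_neg_distrib, sub_eq_add_neg]

end Cech

end PatternEquivariant

end

noncomputable section

namespace PatternEquivariant

set_option maxSynthPendingDepth 3

open Metric Filter Topology

variable {d : ℕ}

/-- The value of a smooth form at a point. -/
def evalAt (q : ℕ) (y : Euc d) : smoothForms d q →ₗ[ℝ] (Euc d) [⋀^Fin q]→L[ℝ] ℝ :=
  LinearMap.proj y ∘ₗ (smoothForms d q).subtype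

theorem evalAt_apply {q : ℕ} (y : Euc d) (ω : smoothForms d q) : evalAt q y ω = ω.1 y := rfl

/-- The derivative of order `i` of a smooth form at a point. -/
def jetAt (q i : ℕ) (y : Euc d) :
    smoothForms d q →ₗ[ℝ] (Euc d) [×i]→L[ℝ] ((Euc d) [⋀^Fin q]→L[ℝ] ℝ) where
  toFun ω := iteratedFDeriv ℝ i ω.1 y
  map_add' ω η := iteratedFDeriv_add_apply (contDiffAt_form ω i y) (contDiffAt_form η i y)
  map_smul' _ ω := iteratedFDeriv_const_smul_apply (contDiffAt_form ω i y)

theorem jetAt_apply {q i : ℕ} (y : Euc d) (ω : smoothForms d q) :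
    jetAt q i y ω = iteratedFDeriv ℝ i ω.1 y := rfl

/-- Families of smooth forms indexed by tuples of points. -/
abbrev FormFamily (d p q : ℕ) : Type := (Fin p → Euc d) → smoothForms d q

namespace SimplicialTiling

variable (P : SimplicialTiling d)

/-- The star of a tuple of points: the union of the tiles of which they are vertices. -/
def star {p : ℕ} (σ : Fin p → Euc d) : Set (Euc d) :=
  {y | ∃ t ∈ P.tiles, (∀ i, σ i ∈ t) ∧ y ∈ supp t}

/-- The pattern equivariant structure of form families, which are only considered on stars. -/
def formSpace (p q : ℕ) : PESpace (FormFamily d p q) where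
  S :=
    { carrier := {ω | ∃ R, ∀ x σ, ∀ y ∈ P.star σ, P.LocEq R y x →
        (ω fun i => x + σ i).1 (x + y) = (ω σ).1 y}
      add_mem' := by
        rintro ω η ⟨R, h⟩ ⟨R', h'⟩
        exact ⟨max R R', fun x σ y hy e => congrArg₂ (· + ·)
          (h x σ y hy (e.mono (by simp))) (h' x σ y hy (e.mono (by simp)))⟩
      zero_mem' := ⟨0, fun _ _ _ _ _ => rfl⟩
      smul_mem' := by
        rintro c ω ⟨R, h⟩
        exact ⟨R, fun x σ y hy e => congrArg (c • ·) (h x σ y hy e)⟩ }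
  Bd j M ω := ∀ i ≤ j, ∀ σ, ∀ y ∈ P.star σ, ‖jetAt q i y (ω σ)‖ ≤ M
  bd_zero j i _ σ y _ := by simp
  bd_add h h' i hi σ y hy := by
    rw [Pi.add_apply, map_add]
    exact norm_add_le_of_le (h i hi σ y hy) (h' i hi σ y hy)
  bd_smul c h i hi σ y hy := by
    rw [Pi.smul_apply, map_smul, norm_smul, Real.norm_eq_abs]
    exact mul_le_mul_of_nonneg_left (h i hi σ y hy) (abs_nonneg c)
  bd_mono hM h i hi σ y hy := (h i hi σ y hy).trans hM

variable {P} {p q : ℕ}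

theorem mem_formSpace_S {ω : FormFamily d p q} : ω ∈ (P.formSpace p q).S ↔
    ∃ R, ∀ x σ, ∀ y ∈ P.star σ, P.LocEq R y x → (ω fun i => x + σ i).1 (x + y) = (ω σ).1 y := Iff.rfl

theorem formSpace_Bd {j : ℕ} {M : ℝ} {ω : FormFamily d p q} : (P.formSpace p q).Bd j M ω ↔
    ∀ i ≤ j, ∀ σ, ∀ y ∈ P.star σ, ‖jetAt q i y (ω σ)‖ ≤ M := Iff.rfl

theorem star_subset_star_succAbove (σ : Fin (p + 1) → Euc d) (i : Fin (p + 1)) :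
    P.star σ ⊆ P.star fun j => σ (i.succAbove j) := by
  rintro y ⟨t, ht, hσ, hy⟩
  exact ⟨t, ht, fun j => hσ _, hy⟩

theorem eq_of_eqOn_interior_supp {F : Type} [TopologicalSpace F] [T2Space F]
    {t : Finset (Euc d)} (ht : t ∈ P.tiles)
    {U : Set (Euc d)} (hU : IsOpen U) {f g : Euc d → F} (hf : Continuous f) (hg : Continuous g)
    (h : ∀ z ∈ interior (supp t) ∩ U, f z = g z) {y : Euc d} (hy : y ∈ supp t) (hyU : y ∈ U) :
    f y = g y := by
  have hy' : y ∈ closure (interior (supp t) ∩ U) := by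
    rw [_root_.mem_closure_iff]
    intro O hO hyO
    obtain ⟨z, hz, hz'⟩ := _root_.mem_closure_iff.1 (supp_subset_closure_interior ht hy) (O ∩ U)
      (hO.inter hU) ⟨hyO, hyU⟩
    exact ⟨z, hz.1, hz', hz.2⟩
  exact closure_minimal (fun z hz => h z hz) (isClosed_eq hf hg) hy'

/-- Tiles are closures of their interiors, so the jets of a smooth function on a tile, including the
boundary, are determined by its values on the tile. This allows globally defined forms to be treated
as forms on closed stars. -/
theorem iteratedFDeriv_eq_of_eqOn_supp {F : Type} [NormedAddCommGroup F] [NormedSpace ℝ F]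
    {t : Finset (Euc d)} (ht : t ∈ P.tiles) {U : Set (Euc d)} (hU : IsOpen U) {f g : Euc d → F}
    (hf : ContDiff ℝ (⊤ : ℕ∞) f) (hg : ContDiff ℝ (⊤ : ℕ∞) g)
    (h : ∀ z ∈ supp t ∩ U, f z = g z) {y : Euc d} (hy : y ∈ supp t) (hyU : y ∈ U) (i : ℕ) :
    iteratedFDeriv ℝ i f y = iteratedFDeriv ℝ i g y := by
  refine eq_of_eqOn_interior_supp ht hU (hf.continuous_iteratedFDeriv (by exact_mod_cast le_top))
    (hg.continuous_iteratedFDeriv (by exact_mod_cast le_top)) (fun z hz => ?_) hy hyU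
  refine (EventuallyEq.iteratedFDeriv ℝ ?_ i).eq_of_nhds
  filter_upwards [(isOpen_interior.inter hU).mem_nhds hz] with w hw
  exact h w ⟨interior_subset hw.1, hw.2⟩

theorem fderiv_eq_of_eqOn_supp {F : Type} [NormedAddCommGroup F] [NormedSpace ℝ F]
    {t : Finset (Euc d)} (ht : t ∈ P.tiles) {U : Set (Euc d)} (hU : IsOpen U) {f g : Euc d → F}
    (hf : ContDiff ℝ (⊤ : ℕ∞) f) (hg : ContDiff ℝ (⊤ : ℕ∞) g)
    (h : ∀ z ∈ supp t ∩ U, f z = g z) {y : Euc d} (hy : y ∈ supp t) (hyU : y ∈ U) :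
    fderiv ℝ f y = fderiv ℝ g y := by
  refine eq_of_eqOn_interior_supp ht hU (hf.continuous_fderiv (by simp))
    (hg.continuous_fderiv (by simp)) (fun z hz => ?_) hy hyU
  refine EventuallyEq.fderiv_eq ?_
  filter_upwards [(isOpen_interior.inter hU).mem_nhds hz] with w hw
  exact h w ⟨interior_subset hw.1, hw.2⟩

theorem mem_formSpace_N {ω : FormFamily d p q} :
    ω ∈ (P.formSpace p q).N ↔ ∀ σ, ∀ y ∈ P.star σ, (ω σ).1 y = 0 := by
  refine ⟨fun h σ y hy => ?_, fun h j i _ σ y hy => ?_⟩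
  · have := h 0 0 le_rfl σ y hy
    rw [jetAt_apply, norm_iteratedFDeriv_zero] at this
    exact norm_le_zero_iff.1 this
  · obtain ⟨t, ht, hσ, hyt⟩ := hy
    rw [jetAt_apply, iteratedFDeriv_eq_of_eqOn_supp ht isOpen_univ (contDiff_form (ω σ))
      (contDiff_const (c := 0)) (fun z hz => h σ z ⟨t, ht, hσ, hz.1⟩) hyt trivial i]
    simp [iteratedFDeriv_fun_zero]

/-! ### The exterior derivative and the Čech differential of form families -/

theorem isPEOp_extD (P : SimplicialTiling d) (p q : ℕ) :
    PESpace.IsPEOp (P.formSpace p q) (P.formSpace p (q + 1)) ((extD d q).compLeft _) where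
  map_S := by
    rintro ω ⟨R, h⟩
    -- A derivative at `y` needs agreement on the part of the tile within distance `1` of `y`, hence
    -- the increase of the range.
    refine ⟨R + 1, fun x σ y hy e => ?_⟩
    obtain ⟨t, ht, hσ, hyt⟩ := hy
    have h1 : fderiv ℝ (fun z => (ω fun i => x + σ i).1 (x + z)) y = fderiv ℝ (ω σ).1 y := by
      refine fderiv_eq_of_eqOn_supp ht isOpen_ball
        ((contDiff_form _).comp (contDiff_const.add contDiff_id)) (contDiff_form _)
        (fun z hz => h x σ z ⟨t, ht, hσ, hz.1⟩ (e.mono ?_)) hyt (mem_ball_self one_pos)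
      have := mem_ball.1 hz.2
      linarith
    rw [fderiv_comp_add_left] at h1
    exact congrArg ContinuousAlternatingMap.alternatizeUncurryFin h1
  bound j := by
    refine ⟨j + 1, q + 1, fun M ω _ h i hi σ y hy => ?_⟩
    refine (norm_iteratedFDeriv_extDeriv _ (contDiff_form (ω σ)) i y).trans ?_
    exact mul_le_mul_of_nonneg_left (h (i + 1) (by omega) σ y hy) (by positivity)

theorem isPEOp_cechD_form (P : SimplicialTiling d) (p q : ℕ) :
    PESpace.IsPEOp (P.formSpace p q) (P.formSpace (p + 1) q) (cechD (Euc d) (smoothForms d q) p) where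
  map_S := by
    rintro ω ⟨R, h⟩
    refine ⟨R, fun x σ y hy e => ?_⟩
    simp only [← evalAt_apply, cechD_apply, map_sum, map_smul]
    refine Finset.sum_congr rfl fun i _ => ?_
    simp only [evalAt_apply]
    rw [h x _ y (star_subset_star_succAbove σ i hy) e]
  bound j := by
    refine ⟨j, p + 1, fun M ω _ h i hi σ y hy => ?_⟩
    rw [cechD_apply, map_sum]
    refine (norm_sum_le_of_le _ (fun k _ => ?_ : ∀ k ∈ Finset.univ, _ ≤ M)).trans (by simp)
    rw [map_smul, norm_smul, norm_pow, norm_neg, norm_one, one_pow, one_mul]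
    exact h i hi _ y (star_subset_star_succAbove σ k hy)

/-! ### The Poincaré operator of form families -/

/-- The Poincaré operator of form families, with apex the first point of the tuple. -/
def formCone (d p q : ℕ) : FormFamily d (p + 1) (q + 1) →ₗ[ℝ] FormFamily d (p + 1) q where
  toFun ω σ := ⟨cone (σ 0) (ω σ).1, contDiff_cone (contDiff_form _)⟩
  map_add' _ _ := funext fun _ => Subtype.ext (cone_add (contDiff_form _) (contDiff_form _))
  map_smul' c _ := funext fun _ => Subtype.ext (cone_smul c)

theorem formCone_apply (ω : FormFamily d (p + 1) (q + 1)) (σ : Fin (p + 1) → Euc d) :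
    (formCone d p q ω σ).1 = cone (σ 0) (ω σ).1 := rfl

theorem segment_subset_supp {t : Finset (Euc d)} {v y : Euc d} (hv : v ∈ t) (hy : y ∈ supp t) :
    segment ℝ v y ⊆ supp t :=
  (convex_supp t).segment_subset (subset_supp hv) hy

theorem isPEOp_formCone (P : SimplicialTiling d) (p q : ℕ) :
    PESpace.IsPEOp (P.formSpace (p + 1) (q + 1)) (P.formSpace (p + 1) q) (formCone d p q) where
  map_S := by
    rintro ω ⟨R, h⟩
    refine ⟨R + P.diamBound, fun x σ y hy e => ?_⟩
    obtain ⟨t, ht, hσ, hyt⟩ := hy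
    simp only [formCone_apply]
    refine cone_congr_add x y fun z hz => ?_
    have hzt := segment_subset_supp (hσ 0) hyt hz
    refine h x σ z ⟨t, ht, hσ, hzt⟩ (e.mono ?_)
    linarith [dist_le_diamBound ht hzt hyt]
  bound j := by
    refine ⟨j, 2 ^ j * (P.diamBound + 1), fun M ω hM h i hi σ y hy => ?_⟩
    obtain ⟨t, ht, hσ, hyt⟩ := hy
    have hD := dist_le_diamBound ht hyt (subset_supp (hσ 0))
    rw [dist_eq_norm] at hD
    refine (norm_iteratedFDeriv_cone_le (contDiff_form (ω σ)) i y (M := M)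
      fun k hk z hz => h k (hk.trans hi) σ z
        ⟨t, ht, hσ, segment_subset_supp (hσ 0) hyt hz⟩).trans ?_
    gcongr
    norm_num

theorem extD_formCone_add (ω : FormFamily d (p + 1) (q + 1)) :
    (extD d q).compLeft _ (formCone d p q ω) + formCone d p (q + 1) ((extD d (q + 1)).compLeft _ ω) =
      ω := by
  funext σ
  exact Subtype.ext (funext fun y => extDeriv_cone (contDiff_form (ω σ)) y)

theorem formCone_extD_zero (ω : FormFamily d (p + 1) 0) (σ : Fin (p + 1) → Euc d) (y : Euc d) :
    (formCone d p 0 ((extD d 0).compLeft _ ω) σ).1 y = (ω σ).1 y - (ω σ).1 (σ 0) :=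
  cone_extDeriv_zero (contDiff_form (ω σ)) y

/-! ### The contraction of the Čech complex of form families by a partition of unity -/

namespace PartitionOfUnity

variable (φ : P.PartitionOfUnity)

theorem finsum_eq_sum {X : Type} [AddCommGroup X] [Module ℝ X] {y : Euc d} {t : Finset (Euc d)}
    (ht : t ∈ P.tilesNear y φ.ε) (f : Euc d → X) :
    ∑ᶠ v, φ.toFun v y • f v = ∑ v ∈ t, φ.toFun v y • f v := by
  refine finsum_eq_sum_of_support_subset _ fun v hv => ?_
  refine Finset.mem_coe.2 (φ.mem_tile v y (fun h0 => hv ?_) t ht)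
  simp [h0]

theorem mem_tilesNear_of_mem_ball {y y₀ : Euc d} {t : Finset (Euc d)} (ht : t ∈ P.tiles)
    (hy₀ : y₀ ∈ supp t) (hy : y ∈ ball y₀ φ.ε) : t ∈ P.tilesNear y φ.ε :=
  ⟨ht, y₀, hy₀, by rw [mem_closedBall']; exact (mem_ball.1 hy).le⟩

/-- Near a point of `t` only vertices of `t` contribute, because `t` still touches the `ε`-ball
around the moving point. This gives smoothness, and it ensures that gluing on the star of `σ` uses
the members of the family only on the smaller stars of the tuples `Fin.cons v σ`. -/
theorem eventuallyEq_sum {t : Finset (Euc d)} (ht : t ∈ P.tiles) {y₀ : Euc d} (hy₀ : y₀ ∈ supp t)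
    (ω : Euc d → smoothForms d q) :
    (fun y => ∑ᶠ v, φ.toFun v y • (ω v).1 y) =ᶠ[𝓝 y₀] fun y => ∑ v ∈ t, φ.toFun v y • (ω v).1 y := by
  filter_upwards [ball_mem_nhds y₀ φ.ε_pos] with y hy
  exact φ.finsum_eq_sum (φ.mem_tilesNear_of_mem_ball ht hy₀ hy) fun v => (ω v).1 y

theorem contDiff_sum_smul (ω : Euc d → smoothForms d q) :
    ContDiff ℝ (⊤ : ℕ∞) fun y => ∑ᶠ v, φ.toFun v y • (ω v).1 y := by
  rw [contDiff_iff_contDiffAt]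
  intro y₀
  obtain ⟨t, ht, hy₀⟩ := P.exists_tile_mem y₀
  refine ContDiffAt.congr_of_eventuallyEq ?_ (φ.eventuallyEq_sum ht hy₀ ω)
  exact (ContDiff.sum fun v _ => (φ.contDiff v).smul (contDiff_form (ω v))).contDiffAt

/-- Gluing of form families by a partition of unity. -/
def glue (p q : ℕ) : FormFamily d (p + 1) q →ₗ[ℝ] FormFamily d p q where
  toFun ω σ := ⟨fun y => ∑ᶠ v, φ.toFun v y • (ω (Fin.cons v σ)).1 y,
    φ.contDiff_sum_smul fun v => ω (Fin.cons v σ)⟩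
  map_add' ω η := by
    funext σ
    refine Subtype.ext (funext fun y => ?_)
    obtain ⟨t, ht, hy⟩ := P.exists_tile_mem y
    have h := fun f : Euc d → (Euc d) [⋀^Fin q]→L[ℝ] ℝ =>
      φ.finsum_eq_sum (mem_tilesNear_of_mem ht hy φ.ε_pos.le) f
    simp only [Pi.add_apply, Submodule.coe_add, h]
    simp only [smul_add, Finset.sum_add_distrib]
  map_smul' c ω := by
    funext σ
    refine Subtype.ext (funext fun y => ?_)
    obtain ⟨t, ht, hy⟩ := P.exists_tile_mem y
    have h := fun f : Euc d → (Euc d) [⋀^Fin q]→L[ℝ] ℝ =>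
      φ.finsum_eq_sum (mem_tilesNear_of_mem ht hy φ.ε_pos.le) f
    simp only [Pi.smul_apply, Submodule.coe_smul, h, Finset.smul_sum, smul_comm c,
      RingHom.id_apply]

theorem glue_apply (ω : FormFamily d (p + 1) q) (σ : Fin p → Euc d) {t : Finset (Euc d)}
    (ht : t ∈ P.tiles) {y : Euc d} (hy : y ∈ supp t) :
    (φ.glue p q ω σ).1 y = ∑ v ∈ t, φ.toFun v y • (ω (Fin.cons v σ)).1 y :=
  φ.finsum_eq_sum (mem_tilesNear_of_mem ht hy φ.ε_pos.le) fun v => (ω (Fin.cons v σ)).1 y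

theorem mem_star_cons {t : Finset (Euc d)} (ht : t ∈ P.tiles) {σ : Fin p → Euc d}
    (hσ : ∀ i, σ i ∈ t) {y : Euc d} (hy : y ∈ supp t) {v : Euc d} (hv : v ∈ t) :
    y ∈ P.star (Fin.cons v σ : Fin (p + 1) → Euc d) :=
  ⟨t, ht, fun i => Fin.cases hv hσ i, hy⟩

theorem isPEOp_glue (p q : ℕ) :
    PESpace.IsPEOp (P.formSpace (p + 1) q) (P.formSpace p q) (φ.glue p q) where
  map_S := by
    rintro ω ⟨R, h⟩
    obtain ⟨R', h'⟩ := φ.equivariant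
    refine ⟨max R (max R' 0), fun x σ y hy e => ?_⟩
    obtain ⟨t, ht, hσ, hyt⟩ := hy
    have hx : translate x t ∈ P.tiles := e.1 t (mem_tilesNear_of_mem ht hyt (by simp))
    rw [φ.glue_apply ω σ ht hyt, φ.glue_apply ω _ hx (add_mem_supp_translate.2 hyt), translate,
      Finset.sum_map]
    refine Finset.sum_congr rfl fun v hv => ?_
    simp only [Equiv.coe_toEmbedding, Equiv.coe_addLeft]
    rw [h' x v y (e.mono (by simp)),
      ← h x _ y (mem_star_cons ht hσ hyt hv) (e.mono (by simp))]
    have hc : (Fin.cons (x + v) fun i => x + σ i : Fin (p + 1) → Euc d) =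
        fun i => x + (Fin.cons v σ : Fin (p + 1) → Euc d) i := by
      funext i
      refine Fin.cases ?_ (fun i => ?_) i <;> simp
    rw [hc]
  bound j := by
    choose C hC using φ.bounded
    set C' := ∑ i ∈ Finset.range (j + 1), |C i| with hC'
    have hle : ∀ i ≤ j, ∀ v y, ‖iteratedFDeriv ℝ i (φ.toFun v) y‖ ≤ C' := fun i hi v y =>
      ((hC i v y).trans (le_abs_self _)).trans
        (Finset.single_le_sum (f := fun i => |C i|) (fun i _ => abs_nonneg _)
          (Finset.mem_range.2 (by omega)))
    -- A tile has `d + 1` vertices, the Leibniz rule contributes at most `2 ^ j`, and `C'` bounds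
    -- all derivatives of order at most `j` of the partition functions.
    refine ⟨j, (d + 1) * (2 ^ j * C'), fun M ω hM h i hi σ y hy => ?_⟩
    obtain ⟨t, ht, hσ, hyt⟩ := hy
    have hev := (φ.eventuallyEq_sum ht hyt fun v => ω (Fin.cons v σ)).iteratedFDeriv ℝ i
    have e1 : jetAt q i y (φ.glue p q ω σ) =
        ∑ v ∈ t, iteratedFDeriv ℝ i (fun y => φ.toFun v y • (ω (Fin.cons v σ)).1 y) y := by
      refine hev.eq_of_nhds.trans (iteratedFDeriv_fun_sum_apply fun v _ => ?_)
      exact ((φ.contDiff v).smul (contDiff_form (ω (Fin.cons v σ)))).contDiffAt.of_le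
        (by exact_mod_cast le_top)
    have hC0 : 0 ≤ C' := Finset.sum_nonneg fun i _ => abs_nonneg _
    have hv : ∀ v ∈ t, ‖iteratedFDeriv ℝ i (fun y => φ.toFun v y • (ω (Fin.cons v σ)).1 y) y‖ ≤
        2 ^ j * C' * M := by
      intro v hv
      refine (norm_iteratedFDeriv_smul_le (φ.contDiff v) (contDiff_form (ω (Fin.cons v σ))) y
        (n := i) (by exact_mod_cast le_top)).trans ?_
      calc _ ≤ ∑ k ∈ Finset.range (i + 1), (i.choose k : ℝ) * C' * M := by
            refine Finset.sum_le_sum fun k hk => ?_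
            have hk' := Finset.mem_range.1 hk
            have h2 := h (i - k) (by omega) _ y (mem_star_cons ht hσ hyt hv)
            rw [jetAt_apply] at h2
            gcongr
            exact hle k (by omega) v y
        _ = 2 ^ i * C' * M := by
            rw [← Finset.sum_mul, ← Finset.sum_mul]
            congr 2
            exact_mod_cast Nat.sum_range_choose i
        _ ≤ 2 ^ j * C' * M := by gcongr; norm_num
    rw [e1]
    refine (norm_sum_le_of_le _ hv).trans_eq ?_
    rw [Finset.sum_const, ht.2, nsmul_eq_mul]
    push_cast
    ring

theorem glue_cechD_zero (ω : FormFamily d 0 q) (σ : Fin 0 → Euc d) (y : Euc d) :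
    (φ.glue 0 q (cechD _ _ 0 ω) σ).1 y = (ω σ).1 y := by
  obtain ⟨t, ht, hy⟩ := P.exists_tile_mem y
  simp only [φ.glue_apply _ σ ht hy, cechD_cons_zero, ← Finset.sum_smul,
    φ.sum_eq_one y t ht hy, one_smul]

/-- The identity of `cechD_cons_succ` averaged with the weights `φ.toFun v y`: the term without
inserted point returns `ω` since the weights sum to one, and the others form the Čech differential
of the glued family. -/
theorem cechD_glue_add (ω : FormFamily d (p + 1) q) (σ : Fin (p + 1) → Euc d) (y : Euc d) :
    (cechD _ _ p (φ.glue p q ω) σ).1 y + (φ.glue (p + 1) q (cechD _ _ (p + 1) ω) σ).1 y =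
      (ω σ).1 y := by
  obtain ⟨t, ht, hy⟩ := P.exists_tile_mem y
  rw [φ.glue_apply _ σ ht hy]
  simp only [cechD_cons_succ]
  simp only [← evalAt_apply, cechD_apply, map_sum, map_smul, map_sub, smul_sub,
    Finset.sum_sub_distrib, ← Finset.sum_smul, φ.sum_eq_one y t ht hy, one_smul]
  simp only [evalAt_apply, φ.glue_apply ω _ ht hy, Finset.smul_sum]
  rw [Finset.sum_comm, add_comm, sub_add_eq_add_sub, sub_eq_iff_eq_add]
  congr 1
  exact Finset.sum_congr rfl fun v _ => Finset.sum_congr rfl fun i _ => smul_comm _ _ _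

end PartitionOfUnity

end SimplicialTiling

end PatternEquivariant

end

noncomputable section

namespace PatternEquivariant

namespace SimplicialTiling

/-! ### Signed insertion of a vertex -/

section Insertion

open scoped Classical

variable {d : ℕ} (P : SimplicialTiling d)

/-- The sign `(-1) ^ r` where `r` is the number of elements of `s` below `u`. -/
def rankSign (u : Euc d) (s : Finset (Euc d)) : ℝ := (-1) ^ (s.filter (P.vlt · u)).card

/-- The coboundary of a function of finite sets of vertices. -/
def setCoboundary (F : Finset (Euc d) → ℝ) (s : Finset (Euc d)) : ℝ :=
  ∑ u ∈ s, P.rankSign u s * F (s.erase u)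

/-- The signed insertion of the vertex `v`. -/
def insertion (v : Euc d) (F : Finset (Euc d) → ℝ) (s : Finset (Euc d)) : ℝ :=
  if v ∈ s then 0 else P.rankSign v s * F (insert v s)

variable {P}

theorem rankSign_mul_self (u : Euc d) (s : Finset (Euc d)) :
    P.rankSign u s * P.rankSign u s = 1 := by
  rw [rankSign, ← pow_add, Even.neg_one_pow ⟨_, rfl⟩]

theorem rankSign_insert {u v : Euc d} {s : Finset (Euc d)} (hv : v ∉ s) :
    P.rankSign u (insert v s) = if P.vlt v u then -P.rankSign u s else P.rankSign u s := by
  unfold rankSign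
  rw [Finset.filter_insert]
  split_ifs with h
  · rw [Finset.card_insert_of_notMem (fun h' => hv (Finset.mem_filter.1 h').1), pow_succ]
    ring
  · rfl

theorem rankSign_of_mem {u v : Euc d} {s : Finset (Euc d)} (hv : v ∈ s) :
    P.rankSign u s =
      if P.vlt v u then -P.rankSign u (s.erase v) else P.rankSign u (s.erase v) := by
  rw [← rankSign_insert (Finset.notMem_erase v s), Finset.insert_erase hv]

/-- The contraction of a full simplex onto its vertex `v`. If `v ∈ s`, only the removal of `v`
survives, with sign squared. Otherwise the removal and reinsertion of `v` gives `F s`, and the terms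
for `u ≠ v` cancel in pairs, because exactly one of `u`, `v` precedes the other and so changes one
sign. -/
theorem setCoboundary_insertion_add {t s : Finset (Euc d)} (ht : t ∈ P.tiles) (hs : s ⊆ t)
    {v : Euc d} (hv : v ∈ t) (F : Finset (Euc d) → ℝ) :
    P.setCoboundary (P.insertion v F) s + P.insertion v (P.setCoboundary F) s = F s := by
  by_cases hvs : v ∈ s
  · have h1 : P.insertion v (P.setCoboundary F) s = 0 := if_pos hvs
    rw [h1, add_zero, setCoboundary, Finset.sum_eq_single v]
    · rw [insertion, if_neg (Finset.notMem_erase v s), Finset.insert_erase hvs,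
        rankSign_of_mem hvs, if_neg (P.vlt_irrefl t ht.1 ht.2 v hv), ← mul_assoc,
        rankSign_mul_self, one_mul]
    · intro u _ huv
      rw [insertion, if_pos (Finset.mem_erase.2 ⟨huv.symm, hvs⟩), mul_zero]
    · exact fun h => absurd hvs h
  · rw [insertion, if_neg hvs, setCoboundary, setCoboundary, Finset.sum_insert hvs,
      Finset.erase_insert hvs, rankSign_insert hvs, if_neg (P.vlt_irrefl t ht.1 ht.2 v hv), mul_add,
      ← mul_assoc, rankSign_mul_self, one_mul, add_left_comm, add_eq_left, Finset.mul_sum,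
      ← Finset.sum_add_distrib]
    refine Finset.sum_eq_zero fun u hu => ?_
    have huv : u ≠ v := fun h => hvs (h ▸ hu)
    rw [insertion, if_neg (fun h => hvs (Finset.mem_of_mem_erase h)), rankSign_insert hvs,
      rankSign_of_mem (u := v) hu, Finset.erase_insert_of_ne huv.symm]
    rcases P.vlt_total t ht.1 ht.2 u (hs hu) v hv huv with h | h
    · rw [if_pos h, if_neg (vlt_asymm ht (hs hu) hv h)]
      ring
    · rw [if_pos h, if_neg (vlt_asymm ht hv (hs hu) h)]
      ring

/-! ### Simplices and their vertex sets -/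

/-- The set of vertices of a simplex. -/
def Simplex.vset {n : ℕ} (τ : P.Simplex n) : Finset (Euc d) := Finset.univ.image τ.vertex

theorem Simplex.mem_vset {n : ℕ} {τ : P.Simplex n} {u : Euc d} :
    u ∈ τ.vset ↔ ∃ i, τ.vertex i = u := by
  simp [Simplex.vset]

theorem Simplex.vset_subset {n : ℕ} {τ : P.Simplex n} {t : Finset (Euc d)}
    (h : ∀ i, τ.vertex i ∈ t) : τ.vset ⊆ t := by
  intro u hu
  obtain ⟨i, rfl⟩ := mem_vset.1 hu
  exact h i

theorem Simplex.vlt_vertex_iff {n : ℕ} (τ : P.Simplex n) {i j : Fin (n + 1)} :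
    P.vlt (τ.vertex i) (τ.vertex j) ↔ i < j := by
  obtain ⟨t, ht, hτ⟩ := τ.exists_tile
  refine ⟨fun h => ?_, τ.ordered i j⟩
  by_contra hij
  rcases (not_lt.1 hij).lt_or_eq with h' | rfl
  · exact vlt_asymm ht (hτ i) (hτ j) h (τ.ordered j i h')
  · exact P.vlt_irrefl t ht.1 ht.2 _ (hτ _) h

theorem Simplex.vertex_injective {n : ℕ} (τ : P.Simplex n) : Function.Injective τ.vertex := by
  intro i j h
  rcases lt_trichotomy i j with h' | h' | h'
  · exact absurd ((τ.vlt_vertex_iff (i := i) (j := i)).1 (by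
      conv_rhs => rw [h]
      exact τ.ordered i j h')) (lt_irrefl _)
  · exact h'
  · exact absurd ((τ.vlt_vertex_iff (i := j) (j := j)).1 (by
      conv_rhs => rw [← h]
      exact τ.ordered j i h')) (lt_irrefl _)

theorem Simplex.card_filter_vlt {n : ℕ} (τ : P.Simplex n) (i : Fin (n + 1)) :
    (τ.vset.filter (P.vlt · (τ.vertex i))).card = i := by
  rw [Simplex.vset, Finset.filter_image, Finset.card_image_of_injective _ τ.vertex_injective]
  have h : Finset.univ.filter (fun j => P.vlt (τ.vertex j) (τ.vertex i)) = Finset.Iio i := by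
    ext j
    simp [τ.vlt_vertex_iff]
  rw [h, Fin.card_Iio]

theorem Simplex.rankSign_vertex {n : ℕ} (τ : P.Simplex n) (i : Fin (n + 1)) :
    P.rankSign (τ.vertex i) τ.vset = (-1) ^ (i : ℕ) := by
  rw [rankSign, τ.card_filter_vlt]

/-- The index of a vertex is the number of smaller vertices, so the set of vertices determines the
enumeration. -/
theorem Simplex.vset_injective {n : ℕ} {τ τ' : P.Simplex n} (h : τ.vset = τ'.vset) : τ = τ' := by
  ext1
  funext i
  obtain ⟨j, hj⟩ := Simplex.mem_vset.1 (h ▸ Simplex.mem_vset.2 ⟨i, rfl⟩ : τ.vertex i ∈ τ'.vset)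
  have h1 := τ.card_filter_vlt i
  rw [h, ← hj, τ'.card_filter_vlt] at h1
  rw [← hj, Fin.ext h1]

theorem Simplex.vset_face {n : ℕ} (τ : P.Simplex (n + 1)) (i : Fin (n + 2)) :
    (τ.face i).vset = τ.vset.erase (τ.vertex i) := by
  ext u
  simp only [Simplex.mem_vset, Finset.mem_erase, Simplex.face]
  constructor
  · rintro ⟨j, rfl⟩
    exact ⟨fun h => Fin.succAbove_ne i j (τ.vertex_injective h), _, rfl⟩
  · rintro ⟨hne, k, rfl⟩
    obtain ⟨j, hj⟩ := Fin.exists_succAbove_eq (fun h : k = i => hne (by rw [h]))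
    exact ⟨j, by rw [hj]⟩

theorem exists_increasing_enumeration {t : Finset (Euc d)} (ht : t ∈ P.tiles) (n : ℕ) :
    ∀ s ⊆ t, s.card = n → ∃ f : Fin n → Euc d, (∀ i j, i < j → P.vlt (f i) (f j)) ∧
      Set.range f = s := by
  induction n with
  | zero =>
    intro s _ hc
    exact ⟨Fin.elim0, fun i => i.elim0, by simp [Finset.card_eq_zero.1 hc]⟩
  | succ n ih =>
    intro s hs hc
    obtain ⟨v, hv, hmin⟩ := exists_vlt_min ht s hs (Finset.card_pos.1 (by omega))
    obtain ⟨f, hf, hr⟩ := ih (s.erase v) ((Finset.erase_subset _ _).trans hs)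
      (by rw [Finset.card_erase_of_mem hv, hc]; rfl)
    have hfm : ∀ i, f i ∈ s.erase v := fun i => Finset.mem_coe.1 (hr ▸ Set.mem_range_self i)
    refine ⟨Fin.cons v f, fun i j hij => ?_, ?_⟩
    · induction j using Fin.cases with
      | zero => exact absurd hij (Fin.not_lt_zero i)
      | succ j =>
        induction i using Fin.cases with
        | zero =>
          have := Finset.mem_erase.1 (hfm j)
          exact (hmin _ this.2).resolve_left this.1
        | succ i => exact hf i j (Fin.succ_lt_succ_iff.1 hij)
    · rw [Fin.range_cons, hr, ← Finset.coe_insert, Finset.insert_erase hv]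

theorem exists_simplex_vset_eq {t s : Finset (Euc d)} (ht : t ∈ P.tiles) (hs : s ⊆ t) {n : ℕ}
    (hc : s.card = n + 1) : ∃ τ : P.Simplex n, τ.vset = s := by
  obtain ⟨f, hf, hr⟩ := exists_increasing_enumeration ht (n + 1) s hs hc
  refine ⟨⟨f, ⟨s, face_of_subset_tile ht hs (Finset.card_pos.1 (by omega)), hr.symm⟩, hf⟩, ?_⟩
  ext u
  rw [Simplex.mem_vset, ← Finset.mem_coe]
  exact Set.ext_iff.1 hr u

/-- The translate of a simplex of a tile whose translate is a tile. -/
theorem Simplex.exists_translate {n : ℕ} (τ : P.Simplex n) {t : Finset (Euc d)} (ht : t ∈ P.tiles)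
    (hτ : ∀ i, τ.vertex i ∈ t) {x : Euc d} (hx : translate x t ∈ P.tiles) :
    ∃ τ' : P.Simplex n, ∀ i, τ'.vertex i = x + τ.vertex i := by
  refine ⟨⟨fun i => x + τ.vertex i, ⟨Finset.univ.image fun i => x + τ.vertex i,
    face_of_subset_tile hx ?_ (Finset.univ_nonempty.image _), by simp⟩,
    fun i j hij => (vlt_translate_iff ht hx (hτ i) (hτ j)).2 (τ.ordered i j hij)⟩, fun i => rfl⟩
  intro u hu
  obtain ⟨i, -, rfl⟩ := Finset.mem_image.1 hu
  exact add_mem_translate.2 (hτ i)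

theorem Simplex.vset_eq_translate {n : ℕ} {τ τ' : P.Simplex n} {x : Euc d}
    (h : ∀ i, τ'.vertex i = x + τ.vertex i) : τ'.vset = translate x τ.vset := by
  ext u
  simp only [Simplex.mem_vset, mem_translate, h]
  exact exists_congr fun i => ⟨fun h => by rw [← h]; abel, fun h => by rw [h]; abel⟩

theorem Simplex.card_vset {n : ℕ} (τ : P.Simplex n) : τ.vset.card = n + 1 := by
  rw [Simplex.vset, Finset.card_image_of_injective _ τ.vertex_injective]
  simp

theorem rankSign_translate {t s : Finset (Euc d)} (ht : t ∈ P.tiles) (hs : s ⊆ t) {x u : Euc d}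
    (hx : translate x t ∈ P.tiles) (hu : u ∈ t) :
    P.rankSign (x + u) (translate x s) = P.rankSign u s := by
  rw [rankSign, rankSign, translate, Finset.filter_map, Finset.card_map]
  congr 2
  refine Finset.filter_congr fun w hw => ?_
  exact vlt_translate_iff ht hx (hs hw) hu

/-! ### Cochains as functions of finite sets of vertices -/

/-- The extension by zero of a cochain to finite sets of points. -/
def onSets (P : SimplicialTiling d) (n : ℕ) : P.Cochain n →ₗ[ℝ] (Finset (Euc d) → ℝ) where
  toFun c s := if h : ∃ τ : P.Simplex n, τ.vset = s then c h.choose else 0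
  map_add' c c' := by
    funext s
    simp only [Pi.add_apply]
    split_ifs <;> simp
  map_smul' a c := by
    funext s
    simp only [Pi.smul_apply, RingHom.id_apply]
    split_ifs <;> simp

theorem onSets_vset {n : ℕ} (c : P.Cochain n) (τ : P.Simplex n) : P.onSets n c τ.vset = c τ := by
  have h : ∃ τ' : P.Simplex n, τ'.vset = τ.vset := ⟨τ, rfl⟩
  simp only [onSets, LinearMap.coe_mk, AddHom.coe_mk]
  rw [dif_pos h, Simplex.vset_injective h.choose_spec]

theorem dS_eq_setCoboundary {n : ℕ} (c : P.Cochain n) (τ : P.Simplex (n + 1)) :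
    P.dS n c τ = P.setCoboundary (P.onSets n c) τ.vset := by
  have h : P.setCoboundary (P.onSets n c) τ.vset = ∑ i, P.rankSign (τ.vertex i) τ.vset *
      P.onSets n c (τ.vset.erase (τ.vertex i)) :=
    Finset.sum_image fun i _ j _ h => τ.vertex_injective h
  rw [h]
  change ∑ i : Fin (n + 2), (-1) ^ (i : ℕ) * c (τ.face i) = _
  refine Finset.sum_congr rfl fun i _ => ?_
  rw [τ.rankSign_vertex, ← Simplex.vset_face, onSets_vset]

theorem onSets_dS {n : ℕ} (c : P.Cochain n) {t s : Finset (Euc d)} (ht : t ∈ P.tiles) (hs : s ⊆ t)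
    (hc : s.card = n + 2) : P.onSets (n + 1) (P.dS n c) s = P.setCoboundary (P.onSets n c) s := by
  obtain ⟨τ, rfl⟩ := exists_simplex_vset_eq ht hs hc
  rw [onSets_vset, dS_eq_setCoboundary]

/-- Signed insertion of a vertex into the simplices, as an operator on cochains. -/
def insertionCochain (P : SimplicialTiling d) (n : ℕ) (v : Euc d) :
    P.Cochain (n + 1) →ₗ[ℝ] P.Cochain n where
  toFun c τ := P.insertion v (P.onSets (n + 1) c) τ.vset
  map_add' c c' := by
    funext τ
    simp only [insertion, map_add, Pi.add_apply]
    split_ifs <;> ring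
  map_smul' a c := by
    funext τ
    simp only [insertion, map_smul, Pi.smul_apply, smul_eq_mul, RingHom.id_apply]
    split_ifs <;> ring

theorem insertionCochain_apply {n : ℕ} (v : Euc d) (c : P.Cochain (n + 1)) (τ : P.Simplex n) :
    P.insertionCochain n v c τ = P.insertion v (P.onSets (n + 1) c) τ.vset := rfl

theorem insertion_onSets_dS {n : ℕ} (c : P.Cochain n) {t : Finset (Euc d)} (ht : t ∈ P.tiles)
    {v : Euc d} (hv : v ∈ t) (τ : P.Simplex n) (hτ : ∀ i, τ.vertex i ∈ t) :
    P.insertionCochain n v (P.dS n c) τ =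
      P.insertion v (P.setCoboundary (P.onSets n c)) τ.vset := by
  rw [insertionCochain_apply, insertion, insertion]
  split_ifs with h
  · rfl
  · rw [onSets_dS c ht (Finset.insert_subset hv (Simplex.vset_subset hτ))
      (by rw [Finset.card_insert_of_notMem h, τ.card_vset])]

theorem dS_insertionCochain_add {n : ℕ} (c : P.Cochain (n + 1)) {t : Finset (Euc d)}
    (ht : t ∈ P.tiles) {v : Euc d} (hv : v ∈ t) (τ : P.Simplex (n + 1))
    (hτ : ∀ i, τ.vertex i ∈ t) :
    P.dS n (P.insertionCochain n v c) τ + P.insertionCochain (n + 1) v (P.dS (n + 1) c) τ =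
      c τ := by
  rw [insertion_onSets_dS c ht hv τ hτ, ← onSets_vset c τ,
    ← setCoboundary_insertion_add ht (Simplex.vset_subset hτ) hv (P.onSets _ c)]
  congr 1
  rw [dS_eq_setCoboundary, setCoboundary, setCoboundary]
  refine Finset.sum_congr rfl fun u hu => ?_
  obtain ⟨i, rfl⟩ := Simplex.mem_vset.1 hu
  rw [← Simplex.vset_face, onSets_vset, insertionCochain_apply]

/-- In degree zero, removing the only vertex leaves the empty set, into which `v` is then inserted.
This is the augmentation term, the value of the cochain at `v`. -/
theorem insertionCochain_dS_zero (c : P.Cochain 0) {t : Finset (Euc d)}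
    (ht : t ∈ P.tiles) {v : Euc d} (hv : v ∈ t) (τ : P.Simplex 0) (hτ : ∀ i, τ.vertex i ∈ t) :
    P.insertionCochain 0 v (P.dS 0 c) τ = c τ - P.onSets 0 c {v} := by
  rw [insertion_onSets_dS c ht hv τ hτ, ← onSets_vset c τ, eq_sub_iff_add_eq',
    ← setCoboundary_insertion_add ht (Simplex.vset_subset hτ) hv (P.onSets _ c)]
  congr 1
  have h : τ.vset = {τ.vertex 0} := by simp [Simplex.vset]
  rw [h, setCoboundary, Finset.sum_singleton]
  have h1 := τ.rankSign_vertex 0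
  rw [h] at h1
  rw [h1]
  simp [insertion, rankSign]

end Insertion

end SimplicialTiling

end PatternEquivariant

end

noncomputable section

namespace PatternEquivariant

set_option maxSynthPendingDepth 3

open MeasureTheory

variable {d : ℕ}

namespace SimplicialTiling

/-! ### Families of cochains -/

/-- Families of cochains indexed by tuples of points. -/
abbrev CochainFamily (P : SimplicialTiling d) (p n : ℕ) : Type := (Fin p → Euc d) → P.Cochain n

variable (P : SimplicialTiling d)

/-- The points of the tuple and the vertices of the simplex are vertices of a common tile. -/
def Joined {p n : ℕ} (σ : Fin p → Euc d) (τ : P.Simplex n) : Prop :=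
  ∃ t ∈ P.tiles, (∀ i, σ i ∈ t) ∧ ∀ i, τ.vertex i ∈ t

/-- The pattern equivariant structure of cochain families, which are only considered on simplices
joined to the points of the tuple. -/
def cochainSpace (p n : ℕ) : PESpace (P.CochainFamily p n) where
  S :=
    { carrier := {c | ∃ R, ∀ x σ (τ τ' : P.Simplex n), P.Joined σ τ →
        (∀ i, τ'.vertex i = x + τ.vertex i) → P.LocEq R (τ.vertex 0) x →
          c (fun i => x + σ i) τ' = c σ τ}
      add_mem' := by
        rintro c c' ⟨R, h⟩ ⟨R', h'⟩
        exact ⟨max R R', fun x σ τ τ' hj hx e => congrArg₂ (· + ·)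
          (h x σ τ τ' hj hx (e.mono (by simp))) (h' x σ τ τ' hj hx (e.mono (by simp)))⟩
      zero_mem' := ⟨0, fun _ _ _ _ _ _ _ => rfl⟩
      smul_mem' := by
        rintro a c ⟨R, h⟩
        exact ⟨R, fun x σ τ τ' hj hx e => congrArg (a * ·) (h x σ τ τ' hj hx e)⟩ }
  Bd _ M c := ∀ σ τ, P.Joined σ τ → |c σ τ| ≤ M
  bd_zero _ σ τ _ := by simp
  bd_add h h' σ τ hj := (abs_add_le _ _).trans (add_le_add (h σ τ hj) (h' σ τ hj))
  bd_smul a h σ τ hj := by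
    rw [Pi.smul_apply, Pi.smul_apply, smul_eq_mul, abs_mul]
    exact mul_le_mul_of_nonneg_left (h σ τ hj) (abs_nonneg a)
  bd_mono hM h σ τ hj := (h σ τ hj).trans hM

variable {P} {p n : ℕ}

theorem mem_cochainSpace_N {c : P.CochainFamily p n} :
    c ∈ (P.cochainSpace p n).N ↔ ∀ σ τ, P.Joined σ τ → c σ τ = 0 :=
  ⟨fun h σ τ hj => abs_nonpos_iff.1 (h 0 σ τ hj), fun h _ σ τ hj => by simp [h σ τ hj]⟩

theorem Joined.succAbove {σ : Fin (p + 1) → Euc d} {τ : P.Simplex n} (h : P.Joined σ τ)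
    (i : Fin (p + 1)) : P.Joined (fun j => σ (i.succAbove j)) τ := by
  obtain ⟨t, ht, hσ, hτ⟩ := h
  exact ⟨t, ht, fun j => hσ _, hτ⟩

theorem Joined.face {σ : Fin p → Euc d} {τ : P.Simplex (n + 1)} (h : P.Joined σ τ)
    (i : Fin (n + 2)) : P.Joined σ (τ.face i) := by
  obtain ⟨t, ht, hσ, hτ⟩ := h
  exact ⟨t, ht, hσ, fun j => hτ _⟩

theorem LocEq.of_mem_tile {t : Finset (Euc d)} (ht : t ∈ P.tiles) {a b x : Euc d} {R : ℝ}
    (e : P.LocEq (R + P.diamBound) a x) (ha : a ∈ supp t) (hb : b ∈ supp t) : P.LocEq R b x :=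
  e.mono (by linarith [dist_le_diamBound ht hb ha])

theorem isPEOp_dS (P : SimplicialTiling d) (p n : ℕ) :
    PESpace.IsPEOp (P.cochainSpace p n) (P.cochainSpace p (n + 1)) ((P.dS n).compLeft _) where
  map_S := by
    rintro c ⟨R, h⟩
    refine ⟨R + P.diamBound, fun x σ τ τ' hj hx e => ?_⟩
    change ∑ i : Fin (n + 2), (-1) ^ (i : ℕ) * c _ (τ'.face i) =
      ∑ i : Fin (n + 2), (-1) ^ (i : ℕ) * c σ (τ.face i)
    refine Finset.sum_congr rfl fun i _ => ?_
    have hji := hj.face i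
    obtain ⟨t, ht, -, hτ⟩ := hj
    rw [h x σ (τ.face i) (τ'.face i) hji (fun j => hx _)
      (e.of_mem_tile ht (subset_supp (hτ 0)) (subset_supp (hτ _)))]
  bound j := by
    refine ⟨j, n + 2, fun M c _ h σ τ hj => ?_⟩
    change |∑ i : Fin (n + 2), (-1) ^ (i : ℕ) * c σ (τ.face i)| ≤ _
    refine (Finset.abs_sum_le_sum_abs _ _).trans ?_
    refine (Finset.sum_le_sum (g := fun _ => M) fun i _ => ?_).trans (by simp)
    rw [abs_mul, abs_pow, abs_neg, abs_one, one_pow, one_mul]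
    exact h σ _ (hj.face i)

theorem isPEOp_cechD_cochain (P : SimplicialTiling d) (p n : ℕ) :
    PESpace.IsPEOp (P.cochainSpace p n) (P.cochainSpace (p + 1) n)
      (cechD (Euc d) (P.Cochain n) p) where
  map_S := by
    rintro c ⟨R, h⟩
    refine ⟨R, fun x σ τ τ' hj hx e => ?_⟩
    simp only [cechD_apply, Finset.sum_apply, Pi.smul_apply]
    exact Finset.sum_congr rfl fun i _ => by rw [h x _ τ τ' (hj.succAbove i) hx e]
  bound j := by
    refine ⟨j, p + 1, fun M c _ h σ τ hj => ?_⟩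
    simp only [cechD_apply, Finset.sum_apply, Pi.smul_apply, smul_eq_mul]
    refine (Finset.abs_sum_le_sum_abs _ _).trans ?_
    refine (Finset.sum_le_sum (g := fun _ => M) fun i _ => ?_).trans (by simp)
    rw [abs_mul, abs_pow, abs_neg, abs_one, one_pow, one_mul]
    exact h _ τ (hj.succAbove i)

/-! ### The contraction of the Čech complex of cochain families -/

/-- Gluing of cochain families: a simplex is assigned to its first vertex. -/
def cochainGlue (P : SimplicialTiling d) (p n : ℕ) :
    P.CochainFamily (p + 1) n →ₗ[ℝ] P.CochainFamily p n where
  toFun c σ τ := c (Fin.cons (τ.vertex 0) σ) τ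
  map_add' _ _ := rfl
  map_smul' _ _ := rfl

theorem isPEOp_cochainGlue (P : SimplicialTiling d) (p n : ℕ) :
    PESpace.IsPEOp (P.cochainSpace (p + 1) n) (P.cochainSpace p n) (P.cochainGlue p n) where
  map_S := by
    rintro c ⟨R, h⟩
    refine ⟨R, fun x σ τ τ' hj hx e => ?_⟩
    obtain ⟨t, ht, hσ, hτ⟩ := hj
    change c (Fin.cons (τ'.vertex 0) _) τ' = c (Fin.cons (τ.vertex 0) σ) τ
    rw [← h x _ τ τ' ⟨t, ht, fun i => Fin.cases (hτ 0) hσ i, hτ⟩ hx e]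
    congr 1
    funext i
    refine Fin.cases ?_ (fun i => ?_) i <;> simp [hx]
  bound j := by
    refine ⟨j, 1, fun M c _ h σ τ hj => ?_⟩
    obtain ⟨t, ht, hσ, hτ⟩ := hj
    rw [one_mul]
    exact h _ τ ⟨t, ht, fun i => Fin.cases (hτ 0) hσ i, hτ⟩

theorem cochainGlue_cechD_zero (c : P.CochainFamily 0 n) :
    P.cochainGlue 0 n (cechD _ _ 0 c) = c := by
  funext σ τ
  exact congrFun (cechD_cons_zero c (τ.vertex 0) σ) τ

/-- No averaging is needed for cochains: the first vertex of a simplex is an equivariant choice, and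
a tuple joined to the simplex stays joined after this vertex is added. The identity is
`cechD_cons_succ` for that vertex. -/
theorem cechD_cochainGlue_add (c : P.CochainFamily (p + 1) n) :
    cechD _ _ p (P.cochainGlue p n c) + P.cochainGlue (p + 1) n (cechD _ _ (p + 1) c) = c := by
  funext σ τ
  have h := congrFun (cechD_cons_succ c (τ.vertex 0) σ) τ
  change cechD _ _ p (P.cochainGlue p n c) σ τ +
    cechD (Euc d) (P.Cochain n) (p + 1) c (Fin.cons (τ.vertex 0) σ) τ = c σ τ
  rw [h]
  simp only [cechD_apply, Finset.sum_apply, Pi.smul_apply, Pi.sub_apply]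
  exact add_sub_cancel _ _

/-! ### The contraction of the columns of cochain families -/

/-- Signed insertion of the first point of the tuple. -/
def cochainCone (P : SimplicialTiling d) (p n : ℕ) :
    P.CochainFamily (p + 1) (n + 1) →ₗ[ℝ] P.CochainFamily (p + 1) n where
  toFun c σ := P.insertionCochain n (σ 0) (c σ)
  map_add' _ _ := funext fun _ => map_add _ _ _
  map_smul' a c := funext fun σ => (P.insertionCochain n (σ 0)).map_smul a (c σ)

theorem onSets_translate {R : ℝ} {c : P.CochainFamily p n}
    (h : ∀ x σ (τ τ' : P.Simplex n), P.Joined σ τ →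
      (∀ i, τ'.vertex i = x + τ.vertex i) → P.LocEq R (τ.vertex 0) x →
        c (fun i => x + σ i) τ' = c σ τ) {t s : Finset (Euc d)} (ht : t ∈ P.tiles) (hs : s ⊆ t)
    (hc : s.card = n + 1) {σ : Fin p → Euc d} (hσ : ∀ i, σ i ∈ t) {x a : Euc d} (ha : a ∈ supp t)
    (hx : translate x t ∈ P.tiles) (e : P.LocEq (R + P.diamBound) a x) :
    P.onSets n (c fun i => x + σ i) (translate x s) = P.onSets n (c σ) s := by
  obtain ⟨τ, rfl⟩ := exists_simplex_vset_eq ht hs hc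
  have hτ : ∀ i, τ.vertex i ∈ t := fun i => hs (Simplex.mem_vset.2 ⟨i, rfl⟩)
  obtain ⟨τ', hτ'⟩ := τ.exists_translate ht hτ hx
  rw [← Simplex.vset_eq_translate hτ', onSets_vset, onSets_vset]
  exact h x σ τ τ' ⟨t, ht, hσ, hτ⟩ hτ' (e.of_mem_tile ht ha (subset_supp (hτ 0)))

theorem abs_onSets_le {M : ℝ} {c : P.CochainFamily p n} (h : ∀ σ τ, P.Joined σ τ → |c σ τ| ≤ M)
    {t s : Finset (Euc d)} (ht : t ∈ P.tiles) (hs : s ⊆ t) (hc : s.card = n + 1)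
    {σ : Fin p → Euc d} (hσ : ∀ i, σ i ∈ t) : |P.onSets n (c σ) s| ≤ M := by
  obtain ⟨τ, rfl⟩ := exists_simplex_vset_eq ht hs hc
  rw [onSets_vset]
  exact h σ τ ⟨t, ht, hσ, fun i => hs (Simplex.mem_vset.2 ⟨i, rfl⟩)⟩

theorem translate_insert [DecidableEq (Euc d)] (x v : Euc d) (s : Finset (Euc d)) :
    translate x (insert v s) = insert (x + v) (translate x s) := by
  ext u
  simp only [mem_translate, Finset.mem_insert, sub_eq_iff_eq_add']

theorem isPEOp_cochainCone (P : SimplicialTiling d) (p n : ℕ) :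
    PESpace.IsPEOp (P.cochainSpace (p + 1) (n + 1)) (P.cochainSpace (p + 1) n)
      (P.cochainCone p n) where
  map_S := by
    rintro c ⟨R, h⟩
    refine ⟨max R 0 + P.diamBound, fun x σ τ τ' hj hx e => ?_⟩
    obtain ⟨t, ht, hσ, hτ⟩ := hj
    have h0 := subset_supp (hτ 0)
    have hxt : translate x t ∈ P.tiles := e.1 t (mem_tilesNear_of_mem ht h0 (by
      linarith [P.diamBound_pos, le_max_right R 0]))
    have e' : P.LocEq (R + P.diamBound) (τ.vertex 0) x := e.mono (by simp)
    change P.insertionCochain n _ _ τ' = P.insertionCochain n _ _ τ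
    rw [insertionCochain_apply, insertionCochain_apply, insertion, insertion,
      Simplex.vset_eq_translate hx]
    by_cases hm : σ 0 ∈ τ.vset
    · rw [if_pos (add_mem_translate.2 hm), if_pos hm]
    · rw [if_neg (fun h => hm (add_mem_translate.1 h)), if_neg hm,
        rankSign_translate ht (Simplex.vset_subset hτ) hxt (hσ 0), ← translate_insert,
        onSets_translate h ht (Finset.insert_subset (hσ 0) (Simplex.vset_subset hτ))
          (by rw [Finset.card_insert_of_notMem hm, τ.card_vset]) hσ h0 hxt e']
  bound j := by
    refine ⟨j, 1, fun M c hM h σ τ hj => ?_⟩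
    obtain ⟨t, ht, hσ, hτ⟩ := hj
    change |P.insertionCochain n _ _ τ| ≤ _
    rw [insertionCochain_apply, insertion, one_mul]
    split_ifs with hm
    · simpa using hM
    · rw [abs_mul, rankSign, abs_pow, abs_neg, abs_one, one_pow, one_mul]
      exact abs_onSets_le h ht (Finset.insert_subset (hσ 0) (Simplex.vset_subset hτ))
        (by rw [Finset.card_insert_of_notMem hm, τ.card_vset]) hσ

theorem dS_cochainCone_add (c : P.CochainFamily (p + 1) (n + 1)) {σ : Fin (p + 1) → Euc d}
    {τ : P.Simplex (n + 1)} (hj : P.Joined σ τ) :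
    (P.dS n).compLeft _ (P.cochainCone p n c) σ τ +
      P.cochainCone p (n + 1) ((P.dS (n + 1)).compLeft _ c) σ τ = c σ τ := by
  obtain ⟨t, ht, hσ, hτ⟩ := hj
  exact dS_insertionCochain_add (c σ) ht (hσ 0) τ hτ

theorem cochainCone_dS_zero (c : P.CochainFamily (p + 1) 0) {σ : Fin (p + 1) → Euc d}
    {τ : P.Simplex 0} (hj : P.Joined σ τ) :
    P.cochainCone p 0 ((P.dS 0).compLeft _ c) σ τ = c σ τ - P.onSets 0 (c σ) {σ 0} := by
  obtain ⟨t, ht, hσ, hτ⟩ := hj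
  exact insertionCochain_dS_zero (c σ) ht (hσ 0) τ hτ

/-! ### Constant forms -/

/-- The constant `0`-forms with the values of a family of `0`-cochains at the first point. -/
def constForm (P : SimplicialTiling d) (p : ℕ) :
    P.CochainFamily (p + 1) 0 →ₗ[ℝ] FormFamily d (p + 1) 0 where
  toFun c σ := ⟨fun _ => ContinuousAlternatingMap.constOfIsEmpty ℝ (Euc d) (Fin 0)
    (P.onSets 0 (c σ) {σ 0}),
    contDiff_const (𝕜 := ℝ) (n := (⊤ : ℕ∞))⟩
  map_add' c c' := by
    funext σ
    refine Subtype.ext (funext fun y => ?_)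
    ext u
    simp
  map_smul' a c := by
    funext σ
    refine Subtype.ext (funext fun y => ?_)
    ext u
    simp

theorem constForm_apply (c : P.CochainFamily (p + 1) 0) (σ : Fin (p + 1) → Euc d) (y : Euc d) :
    (P.constForm p c σ).1 y = ContinuousAlternatingMap.constOfIsEmpty ℝ (Euc d) (Fin 0)
      (P.onSets 0 (c σ) {σ 0}) := rfl

theorem isPEOp_constForm (P : SimplicialTiling d) (p : ℕ) :
    PESpace.IsPEOp (P.cochainSpace (p + 1) 0) (P.formSpace (p + 1) 0) (P.constForm p) where
  map_S := by
    rintro c ⟨R, h⟩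
    refine ⟨max R 0 + P.diamBound, fun x σ y hy e => ?_⟩
    obtain ⟨t, ht, hσ, hyt⟩ := hy
    have hxt : translate x t ∈ P.tiles := e.1 t (mem_tilesNear_of_mem ht hyt (by
      linarith [P.diamBound_pos, le_max_right R 0]))
    have e' : P.LocEq (R + P.diamBound) y x := e.mono (by simp)
    have hs : translate x {σ 0} = {x + σ 0} := Finset.map_singleton _ _
    rw [constForm_apply, constForm_apply, ← hs,
      onSets_translate h ht (Finset.singleton_subset_iff.2 (hσ 0)) rfl hσ hyt hxt e']
  bound j := by
    refine ⟨j, 1, fun M c hM h i hi σ y hy => ?_⟩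
    obtain ⟨t, ht, hσ, hyt⟩ := hy
    have hb := abs_onSets_le h ht (Finset.singleton_subset_iff.2 (hσ 0)) rfl hσ
    rw [one_mul, jetAt_apply]
    cases i with
    | zero =>
      rw [norm_iteratedFDeriv_zero, constForm_apply, ContinuousAlternatingMap.norm_constOfIsEmpty]
      exact hb
    | succ i =>
      have : iteratedFDeriv ℝ (i + 1) (P.constForm p c σ).1 = 0 := iteratedFDeriv_succ_const i _
      rw [this]
      simpa using hM

theorem extD_constForm (c : P.CochainFamily (p + 1) 0) :
    (extD d 0).compLeft _ (P.constForm p c) = 0 := by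
  funext σ
  refine Subtype.ext (funext fun y => ?_)
  change ContinuousAlternatingMap.alternatizeUncurryFin (fderiv ℝ (P.constForm p c σ).1 y) = 0
  have h : fderiv ℝ (P.constForm p c σ).1 y = 0 := fderiv_const_apply _
  rw [h]
  exact map_zero (ContinuousAlternatingMap.alternatizeUncurryFinCLM ℝ (Euc d) ℝ)

/-! ### Integration of form families -/

theorem J_extD (P : SimplicialTiling d) (q : ℕ) (ω : smoothForms d q) :
    P.J (q + 1) (extD d q ω) = P.dS q (P.J q ω) :=
  funext fun τ => simplexIntegral_extDeriv τ.vertex (contDiff_form ω)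

theorem J_zero_apply (ω : smoothForms d 0) (τ : P.Simplex 0) :
    P.J 0 ω τ = ω.1 (τ.vertex 0) fun i => i.elim0 :=
  simplexIntegral_zero τ.vertex ω.1

theorem J_constForm (c : P.CochainFamily (p + 1) 0) (σ : Fin (p + 1) → Euc d) (τ : P.Simplex 0) :
    (P.J 0).compLeft _ (P.constForm p c) σ τ = P.onSets 0 (c σ) {σ 0} :=
  J_zero_apply _ τ

theorem Simplex.charMap_mem_carrier {q : ℕ} (τ : P.Simplex q) {x : Fin q → ℝ}
    (hx : x ∈ stdSimplexCoords q) : τ.charMap x ∈ τ.carrier := by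
  have h : τ.charMap x = ∑ i : Fin (q + 1),
      (Fin.cons (1 - ∑ i, x i) x : Fin (q + 1) → ℝ) i • τ.vertex i := by
    rw [Simplex.charMap, Fin.sum_univ_succ]
    simp only [Fin.cons_zero, Fin.cons_succ, smul_sub, Finset.sum_sub_distrib, sub_smul, one_smul,
      Finset.sum_smul]
    abel
  rw [h]
  refine (convex_convexHull ℝ _).sum_mem (fun i _ => ?_) ?_ fun i _ => τ.vertex_mem_carrier i
  · induction i using Fin.cases with
    | zero => simpa using hx.2
    | succ i => simpa using hx.1 i
  · simp [Fin.sum_univ_succ]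

theorem isPEOp_J (P : SimplicialTiling d) (p q : ℕ) :
    PESpace.IsPEOp (P.formSpace p q) (P.cochainSpace p q) ((P.J q).compLeft _) where
  map_S := by
    rintro ω ⟨R, h⟩
    refine ⟨R + P.diamBound, fun x σ τ τ' hj hx e => ?_⟩
    obtain ⟨t, ht, hσ, hτ⟩ := hj
    refine setIntegral_congr_fun (measurableSet_stdSimplexCoords q) fun z hz => ?_
    have hz' := Simplex.carrier_subset_supp hτ (τ.charMap_mem_carrier hz)
    have h1 : τ'.charMap z = x + τ.charMap z := by
      simp only [Simplex.charMap, hx, add_sub_add_left_eq_sub, add_assoc]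
    simp only [h1, hx, add_sub_add_left_eq_sub]
    rw [h x σ _ ⟨t, ht, hσ, hz'⟩ (e.of_mem_tile ht (subset_supp (hτ 0)) hz')]
  bound j := by
    -- Only the values of the form matter, so seminorm `0` suffices; the `q` edge vectors have
    -- length at most `P.diamBound`.
    refine ⟨0, P.diamBound ^ q * volume.real (stdSimplexCoords q), fun M ω hM h σ τ hj => ?_⟩
    obtain ⟨t, ht, hσ, hτ⟩ := hj
    have hb : ∀ z ∈ stdSimplexCoords q,
        ‖(ω σ).1 (τ.charMap z) fun i : Fin q => τ.vertex i.succ - τ.vertex 0‖ ≤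
          M * P.diamBound ^ q := by
      intro z hz
      have hz' := Simplex.carrier_subset_supp hτ (τ.charMap_mem_carrier hz)
      have h1 := h 0 le_rfl σ _ ⟨t, ht, hσ, hz'⟩
      rw [jetAt_apply, norm_iteratedFDeriv_zero] at h1
      refine (ContinuousAlternatingMap.le_opNorm _ _).trans ?_
      have h2 : ∏ i : Fin q, ‖τ.vertex i.succ - τ.vertex 0‖ ≤ P.diamBound ^ q := by
        refine (Finset.prod_le_prod (fun _ _ => norm_nonneg _) fun i _ => ?_).trans_eq
          (by rw [Finset.prod_const, Finset.card_univ, Fintype.card_fin])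
        rw [← dist_eq_norm]
        exact dist_le_diamBound ht (subset_supp (hτ _)) (subset_supp (hτ 0))
      exact mul_le_mul h1 h2 (Finset.prod_nonneg fun _ _ => norm_nonneg _) hM
    refine (norm_setIntegral_le_of_norm_le_const
      (isCompact_stdSimplexCoords q).measure_lt_top hb).trans_eq ?_
    ring

end SimplicialTiling

end PatternEquivariant

end

noncomputable section

namespace PatternEquivariant

set_option maxSynthPendingDepth 3

section Cohomology

variable {X Y : ℕ → Type} [∀ l, AddCommGroup (X l)] [∀ l, Module ℝ (X l)]
  [∀ l, AddCommGroup (Y l)] [∀ l, Module ℝ (Y l)]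

/-- A morphism of complexes with exact mapping cone induces isomorphisms on cohomology. -/
theorem inducesIsoOnCohomology_of_exact {D : ∀ l, X l →ₗ[ℝ] X (l + 1)} {A : ∀ l, Submodule ℝ (X l)}
    {D' : ∀ l, Y l →ₗ[ℝ] Y (l + 1)} {C : ∀ l, Submodule ℝ (Y l)} (f : ∀ l, X l →ₗ[ℝ] Y l)
    (hf : ∀ l, ∀ ω ∈ A l, f l ω ∈ C l) (hcomm : ∀ l ω, f (l + 1) (D l ω) = D' l (f l ω))
    (hzero : ∀ ω ∈ A 0, D 0 ω = 0 → f 0 ω = 0 → ω = 0)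
    (hsucc : ∀ l, ∀ ω ∈ A (l + 1), ∀ c ∈ C l, D (l + 1) ω = 0 → f (l + 1) ω = D' l c →
      ∃ η ∈ A l, ω = D l η ∧ c - f l η ∈ coboundaries D' C l) (l : ℕ) :
    InducesIsoOnCohomology D A D' C l (f l) := by
  have hcoc : ∀ ω ∈ cocycles D A l, f l ω ∈ cocycles D' C l := by
    rintro ω ⟨hω, hD⟩
    refine ⟨hf l ω hω, LinearMap.mem_ker.2 ?_⟩
    rw [← hcomm, LinearMap.mem_ker.1 hD, map_zero]
  let F : cocycles D A l →ₗ[ℝ] cocycles D' C l := (f l).restrict hcoc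
  have hcob : ∀ ω ∈ coboundaries D A l, f l ω ∈ coboundaries D' C l := by
    cases l with
    | zero =>
      rintro ω hω
      rw [(Submodule.mem_bot ℝ).1 hω, map_zero]
      exact zero_mem _
    | succ l =>
      rintro _ ⟨η, hη, rfl⟩
      exact ⟨f l η, hf l η hη, (hcomm l η).symm⟩
  have hF : (coboundaries D A l).submoduleOf (cocycles D A l) ≤
      ((coboundaries D' C l).submoduleOf (cocycles D' C l)).comap F :=
    fun ω hω => hcob _ hω
  have hinj : ∀ ω ∈ cocycles D A l, f l ω ∈ coboundaries D' C l → ω ∈ coboundaries D A l := by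
    cases l with
    | zero =>
      rintro ω ⟨hω, hD⟩ h
      exact (Submodule.mem_bot ℝ).2 (hzero ω hω hD ((Submodule.mem_bot ℝ).1 h))
    | succ l =>
      rintro ω ⟨hω, hD⟩ ⟨c, hc, hcω⟩
      obtain ⟨η, hη, h, -⟩ := hsucc l ω hω c hc hD hcω.symm
      exact ⟨η, hη, h.symm⟩
  have hbij : Function.Bijective (Submodule.mapQ _ _ F hF) := by
    constructor
    · rw [← LinearMap.ker_eq_bot, LinearMap.ker_eq_bot']
      intro x hx
      obtain ⟨ω, rfl⟩ := Submodule.Quotient.mk_surjective _ x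
      rw [Submodule.mapQ_apply, Submodule.Quotient.mk_eq_zero] at hx
      exact (Submodule.Quotient.mk_eq_zero _).2 (hinj ω.1 ω.2 hx)
    · intro x
      obtain ⟨⟨c, hc, hD⟩, rfl⟩ := Submodule.Quotient.mk_surjective _ x
      -- Surjectivity is exactness of the cone at the pair `(0, c)`, as injectivity was exactness at
      -- `(ω, c)` with `f ω = D' c`.
      obtain ⟨η, hη, h, hcη⟩ := hsucc l 0 (zero_mem _) c hc (map_zero _)
        (by rw [LinearMap.mem_ker.1 hD, map_zero])
      refine ⟨Submodule.Quotient.mk ⟨η, hη, h.symm⟩, ?_⟩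
      rw [Submodule.mapQ_apply]
      refine ((Submodule.Quotient.eq _).2 ?_).symm
      exact hcη
  exact ⟨LinearEquiv.ofBijective _ hbij, fun ω => ⟨hcoc ω.1 ω.2, rfl⟩⟩

end Cohomology

namespace SimplicialTiling

variable {d : ℕ} (P : SimplicialTiling d)

/-! ### The Čech double complex of the mapping cone of integration -/

/-- Families of elements of the mapping cone of the integration map. -/
abbrev ConeFamily (p q : ℕ) : Type := FormFamily d p q × P.CochainFamily p (q - 1)

/-- The coboundary of cochain families with degrees shifted by one, zero in degree zero. -/
def prevD (p : ℕ) : ∀ q, P.CochainFamily p (q - 1) →ₗ[ℝ] P.CochainFamily p q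
  -- For `q = 0` truncated subtraction leaves a spurious component of `0`-cochains. The zero map
  -- here, and the factor `⊤` in `coneN`, make it irrelevant.
  | 0 => 0
  | n + 1 => (P.dS n).compLeft _

/-- The differential of the mapping cone of the integration map. -/
def coneD (p q : ℕ) : P.ConeFamily p q →ₗ[ℝ] P.ConeFamily p (q + 1) :=
  LinearMap.prod ((extD d q).compLeft _ ∘ₗ LinearMap.fst ℝ _ _)
    (((P.J q).compLeft _ ∘ₗ LinearMap.fst ℝ _ _ - P.prevD p q ∘ₗ LinearMap.snd ℝ _ _ :
      P.ConeFamily p q →ₗ[ℝ] P.CochainFamily p q))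

/-- The Čech differential of the mapping cone of the integration map. -/
def coneCechD (p q : ℕ) : P.ConeFamily p q →ₗ[ℝ] P.ConeFamily (p + 1) q :=
  (cechD (Euc d) (smoothForms d q) p).prodMap (cechD (Euc d) (P.Cochain (q - 1)) p)

/-- The pattern equivariant elements of the double complex. -/
def coneV (b : Bool) (p q : ℕ) : Submodule ℝ (P.ConeFamily p q) :=
  ((P.formSpace p q).V b).prod ((P.cochainSpace p (q - 1)).V b)

/-- The null elements of the double complex. In degree zero there is no cochain component. -/
def coneN (p : ℕ) : ∀ q, Submodule ℝ (P.ConeFamily p q)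
  | 0 => (P.formSpace p 0).N.prod ⊤
  | n + 1 => (P.formSpace p (n + 1)).N.prod (P.cochainSpace p n).N

variable {P}

theorem fst_mem_of_coneN {p q : ℕ} {z : P.ConeFamily p q} (h : z ∈ P.coneN p q) :
    z.1 ∈ (P.formSpace p q).N := by
  cases q with
  | zero => exact h.1
  | succ q => exact h.1

theorem prevD_V {b : Bool} {p q : ℕ} {c : P.CochainFamily p (q - 1)}
    (h : c ∈ (P.cochainSpace p (q - 1)).V b) : P.prevD p q c ∈ (P.cochainSpace p q).V b := by
  cases q with
  | zero => exact zero_mem _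
  | succ q => exact (P.isPEOp_dS p q).map_V h

theorem dS_prevD {p q : ℕ} (c : P.CochainFamily p (q - 1)) :
    (P.dS q).compLeft _ (P.prevD p q c) = 0 := by
  cases q with
  | zero => exact map_zero _
  | succ q => exact funext fun σ => P.dS_dS q (c σ)

theorem J_compLeft_extD {p q : ℕ} (ω : FormFamily d p q) :
    (P.J (q + 1)).compLeft _ ((extD d q).compLeft _ ω) = (P.dS q).compLeft _ ((P.J q).compLeft _ ω) :=
  funext fun σ => P.J_extD q (ω σ)

theorem coneD_coneN {p q : ℕ} {z : P.ConeFamily p q} (h : z ∈ P.coneN p q) :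
    P.coneD p q z ∈ P.coneN p (q + 1) := by
  refine ⟨(P.isPEOp_extD p q).map_N (fst_mem_of_coneN h),
    sub_mem ((P.isPEOp_J p q).map_N (fst_mem_of_coneN h)) ?_⟩
  cases q with
  | zero => exact zero_mem _
  | succ q => exact (P.isPEOp_dS p q).map_N h.2

theorem coneD_coneD {p q : ℕ} (z : P.ConeFamily p q) : P.coneD p (q + 1) (P.coneD p q z) = 0 := by
  refine Prod.ext (funext fun σ => extD_extD q (z.1 σ)) ?_
  change (P.J (q + 1)).compLeft _ ((extD d q).compLeft _ z.1) -
    (P.dS q).compLeft _ ((P.J q).compLeft _ z.1 - P.prevD p q z.2) = 0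
  rw [J_compLeft_extD, map_sub, dS_prevD, sub_zero, sub_self]

theorem cechD_compLeft {E X Y : Type} [AddCommGroup X] [Module ℝ X] [AddCommGroup Y] [Module ℝ Y]
    {p : ℕ} (T : X →ₗ[ℝ] Y) (c : (Fin p → E) → X) :
    cechD E Y p (T.compLeft _ c) = T.compLeft _ (cechD E X p c) :=
  cechD_comp T c

theorem prevD_cechD {p q : ℕ} (c : P.CochainFamily p (q - 1)) :
    P.prevD (p + 1) q (cechD _ _ p c) = cechD _ _ p (P.prevD p q c) := by
  cases q with
  | zero => exact (map_zero _).symm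
  | succ q => exact (cechD_compLeft _ _).symm

theorem coneD_coneCechD {p q : ℕ} (z : P.ConeFamily p q) :
    P.coneD (p + 1) q (P.coneCechD p q z) = P.coneCechD p (q + 1) (P.coneD p q z) := by
  refine Prod.ext (cechD_compLeft (extD d q) z.1).symm ?_
  change (P.J q).compLeft _ (cechD _ _ p z.1) - P.prevD (p + 1) q (cechD _ _ p z.2) =
    cechD _ _ p ((P.J q).compLeft _ z.1 - P.prevD p q z.2)
  rw [prevD_cechD, map_sub]
  exact congrArg (· - _) (cechD_compLeft (P.J q) z.1).symm

/-- A closed `0`-form is constant along the segments from `σ 0` to the points of the star, and its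
integral over the `0`-simplex `σ 0` is its value there. -/
theorem form_eq_zero_of_coneD {p : ℕ} {ω : FormFamily d (p + 1) 0}
    (hd : (extD d 0).compLeft _ ω ∈ (P.formSpace (p + 1) 1).N)
    (hJ : (P.J 0).compLeft _ ω ∈ (P.cochainSpace (p + 1) 0).N) :
    ω ∈ (P.formSpace (p + 1) 0).N := by
  rw [mem_formSpace_N]
  intro σ y hy
  have h1 := mem_formSpace_N.1 ((P.isPEOp_formCone p 0).map_N hd) σ y hy
  rw [formCone_extD_zero, sub_eq_zero] at h1
  obtain ⟨t, ht, hσ, -⟩ := hy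
  obtain ⟨τ, hτ⟩ := exists_simplex_vset_eq (n := 0) ht (Finset.singleton_subset_iff.2 (hσ 0)) rfl
  have hτ0 : τ.vertex 0 = σ 0 := by
    have : τ.vertex 0 ∈ τ.vset := Simplex.mem_vset.2 ⟨0, rfl⟩
    rw [hτ] at this
    exact Finset.mem_singleton.1 this
  have h2 := mem_cochainSpace_N.1 hJ σ τ ⟨t, ht, hσ, fun i => by
    rw [Fin.fin_one_eq_zero i, hτ0]; exact hσ 0⟩
  have h3 := (J_zero_apply (ω σ) τ).symm.trans h2
  rw [hτ0] at h3
  rw [h1]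
  ext u
  rw [Subsingleton.elim u fun i => i.elim0, h3]
  rfl

/-- Exactness of the mapping cone over a star. The Poincaré operator gives a primitive `η` of `ω`,
and `r = c - J η` is then a closed cochain, which has to be absorbed without changing the exterior
derivative of `η`. -/
theorem exists_coneD_primitive {b : Bool} {p q : ℕ} {ω : FormFamily d (p + 1) (q + 1)}
    {c : P.CochainFamily (p + 1) q} (hω : ω ∈ (P.formSpace (p + 1) (q + 1)).V b)
    (hc : c ∈ (P.cochainSpace (p + 1) q).V b)
    (hd : (extD d (q + 1)).compLeft _ ω ∈ (P.formSpace (p + 1) (q + 2)).N)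
    (hJ : (P.J (q + 1)).compLeft _ ω - (P.dS q).compLeft _ c ∈
      (P.cochainSpace (p + 1) (q + 1)).N) :
    ∃ y ∈ P.coneV b (p + 1) q, ω - (extD d q).compLeft _ y.1 ∈ (P.formSpace (p + 1) (q + 1)).N ∧
      c - ((P.J q).compLeft _ y.1 - P.prevD (p + 1) q y.2) ∈ (P.cochainSpace (p + 1) q).N := by
  have hη := (P.isPEOp_formCone p q).map_V hω
  have hhd := (P.isPEOp_formCone p (q + 1)).map_N hd
  have hωη := extD_formCone_add ω
  set η := formCone d p q ω with hηdef
  have h1 : ω - (extD d q).compLeft _ η ∈ (P.formSpace (p + 1) (q + 1)).N := by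
    rwa [sub_eq_of_eq_add' hωη.symm]
  set r : P.CochainFamily (p + 1) q := c - (P.J q).compLeft _ η with hr
  have hrV : r ∈ (P.cochainSpace (p + 1) q).V b := sub_mem hc ((P.isPEOp_J (p + 1) q).map_V hη)
  have hdr : (P.dS q).compLeft _ r ∈ (P.cochainSpace (p + 1) (q + 1)).N := by
    have := sub_mem ((P.isPEOp_J (p + 1) (q + 1)).map_N h1) hJ
    rwa [map_sub, J_compLeft_extD, sub_sub_sub_cancel_left, ← map_sub] at this
  have hhr := (P.isPEOp_cochainCone p q).map_N hdr
  rw [mem_cochainSpace_N] at hhr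
  cases q with
  | zero =>
    -- A closed `0`-cochain is constant on the star, so it is the integral of the constant form with
    -- its value at `σ 0`.
    refine ⟨(η + P.constForm p r, 0), ⟨add_mem hη ((P.isPEOp_constForm p).map_V hrV), zero_mem _⟩,
      ?_, ?_⟩
    · change ω - (extD d 0).compLeft _ (η + P.constForm p r) ∈ _
      rwa [map_add, extD_constForm, add_zero]
    · change c - ((P.J 0).compLeft _ (η + P.constForm p r) - 0) ∈ (P.cochainSpace (p + 1) 0).N
      rw [mem_cochainSpace_N]
      intro σ τ hj
      have h2 := hhr σ τ hj
      rw [cochainCone_dS_zero r hj, ← J_constForm r σ τ] at h2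
      rw [← h2, hr, map_add, sub_zero, ← sub_sub]
      rfl
  | succ q =>
    -- In positive degree `r` is the coboundary of its signed insertion; the minus sign is that of
    -- the cochain part of `coneD`.
    refine ⟨(η, -P.cochainCone p q r), ⟨hη, neg_mem ((P.isPEOp_cochainCone p q).map_V hrV)⟩, h1, ?_⟩
    change c - ((P.J (q + 1)).compLeft _ η - (P.dS q).compLeft _ (-P.cochainCone p q r)) ∈
      (P.cochainSpace (p + 1) (q + 1)).N
    rw [mem_cochainSpace_N]
    intro σ τ hj
    have h2 := dS_cochainCone_add r hj
    rw [hhr σ τ hj, add_zero] at h2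
    rw [map_neg, sub_neg_eq_add, ← sub_sub, ← hr]
    exact sub_eq_zero.2 h2.symm

theorem exactDoubleComplex (P : SimplicialTiling d) (b : Bool) :
    ExactDoubleComplex (K := P.ConeFamily) (P.coneV b) P.coneN P.coneD P.coneCechD where
  D_V {p q z} h := ⟨(P.isPEOp_extD p q).map_V h.1,
    sub_mem ((P.isPEOp_J p q).map_V h.1) (prevD_V h.2)⟩
  D_N := coneD_coneN
  δ_V {p q z} h := ⟨(P.isPEOp_cechD_form p q).map_V h.1,
    (P.isPEOp_cechD_cochain p (q - 1)).map_V h.2⟩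
  δ_N {p q z} h := by
    cases q with
    | zero => exact ⟨(P.isPEOp_cechD_form p 0).map_N h.1, trivial⟩
    | succ q =>
      exact ⟨(P.isPEOp_cechD_form p _).map_N h.1, (P.isPEOp_cechD_cochain p _).map_N h.2⟩
  D_D z := by
    rw [coneD_coneD]
    exact zero_mem _
  δ_δ z := Prod.ext (cechD_cechD _) (cechD_cechD _)
  comm := coneD_coneCechD
  col_zero {p z} _ hD := by
    refine ⟨form_eq_zero_of_coneD hD.1 ?_, trivial⟩
    have h : (P.J 0).compLeft _ z.1 - 0 ∈ (P.cochainSpace (p + 1) 0).N := hD.2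
    rwa [sub_zero] at h
  col_succ hz hD := exists_coneD_primitive hz.1 hz.2 hD.1 hD.2
  row_zero {q z} _ hδ := by
    obtain ⟨φ⟩ := nonempty_partitionOfUnity P
    have h1 : z.1 ∈ (P.formSpace 0 q).N := by
      rw [mem_formSpace_N]
      intro σ y hy
      rw [← φ.glue_cechD_zero]
      exact mem_formSpace_N.1 ((φ.isPEOp_glue 0 q).map_N (fst_mem_of_coneN hδ)) σ y hy
    cases q with
    | zero => exact ⟨h1, trivial⟩
    | succ q =>
      refine ⟨h1, ?_⟩
      have := (P.isPEOp_cochainGlue 0 q).map_N hδ.2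
      exact (cochainGlue_cechD_zero (P := P) (n := q) z.2) ▸ this
  row_succ {p q z} hz hδ := by
    obtain ⟨φ⟩ := nonempty_partitionOfUnity P
    refine ⟨(φ.glue p q z.1, P.cochainGlue p (q - 1) z.2),
      ⟨(φ.isPEOp_glue p q).map_V hz.1, (P.isPEOp_cochainGlue p (q - 1)).map_V hz.2⟩, ?_⟩
    have h1 : z.1 - cechD _ _ p (φ.glue p q z.1) ∈ (P.formSpace (p + 1) q).N := by
      rw [mem_formSpace_N]
      intro σ y hy
      have h := mem_formSpace_N.1 ((φ.isPEOp_glue (p + 1) q).map_N (fst_mem_of_coneN hδ)) σ y hy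
      have h' := φ.cechD_glue_add z.1 σ y
      have h'' : (φ.glue (p + 1) q (cechD _ _ (p + 1) z.1) σ).1 y = 0 := h
      rw [h'', add_zero] at h'
      exact sub_eq_zero.2 h'.symm
    cases q with
    | zero => exact ⟨h1, trivial⟩
    | succ q =>
      refine ⟨h1, ?_⟩
      have h2 : ∀ c : P.CochainFamily (p + 1) q,
          cechD _ _ (p + 1) c ∈ (P.cochainSpace (p + 2) q).N →
            c - cechD _ _ p (P.cochainGlue p q c) ∈ (P.cochainSpace (p + 1) q).N := by
        intro c hc
        rw [sub_eq_of_eq_add' (cechD_cochainGlue_add c).symm]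
        exact (P.isPEOp_cochainGlue (p + 1) q).map_N hc
      exact h2 z.2 hδ.2

/-! ### Families indexed by the empty tuple -/

/-- The strongly (for `b = false`) or weakly (for `b = true`) pattern equivariant forms. -/
def peForms (P : SimplicialTiling d) (b : Bool) (l : ℕ) : Submodule ℝ (smoothForms d l) :=
  if b then P.wForms l else P.sForms l

/-- The strongly (for `b = false`) or weakly (for `b = true`) pattern equivariant cochains. -/
def peCochains (P : SimplicialTiling d) (b : Bool) (l : ℕ) : Submodule ℝ (P.Cochain l) :=
  if b then P.wCochains l else P.sCochains l

theorem mem_star_of_isEmpty (σ : Fin 0 → Euc d) (y : Euc d) : y ∈ P.star σ := by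
  obtain ⟨t, ht, hy⟩ := P.exists_tile_mem y
  exact ⟨t, ht, fun i => i.elim0, hy⟩

theorem joined_of_isEmpty {n : ℕ} (σ : Fin 0 → Euc d) (τ : P.Simplex n) : P.Joined σ τ := by
  obtain ⟨t, ht, hτ⟩ := τ.exists_tile
  exact ⟨t, ht, fun i => i.elim0, hτ⟩

theorem mem_formSpace_S_zero {q : ℕ} {ω : FormFamily d 0 q} :
    ω ∈ (P.formSpace 0 q).S ↔ ω Fin.elim0 ∈ P.sForms q := by
  rw [mem_sForms_iff, mem_formSpace_S]
  refine exists_congr fun R => ⟨fun h a x e => ?_, fun h x σ y _ e => ?_⟩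
  · have := h x Fin.elim0 a (mem_star_of_isEmpty _ _) e
    rwa [Subsingleton.elim (fun i => x + _) Fin.elim0] at this
  · rw [Subsingleton.elim (fun i => x + σ i) Fin.elim0, Subsingleton.elim σ Fin.elim0]
    exact h y x e

theorem formSpace_Bd_zero {q j : ℕ} {M : ℝ} {ω : FormFamily d 0 q} :
    (P.formSpace 0 q).Bd j M ω ↔ ∀ i ≤ j, ∀ y, ‖iteratedFDeriv ℝ i (ω Fin.elim0).1 y‖ ≤ M := by
  rw [formSpace_Bd]
  refine forall₂_congr fun i _ => ⟨fun h y => h _ y (mem_star_of_isEmpty _ _), fun h σ y _ => ?_⟩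
  rw [Subsingleton.elim σ Fin.elim0]
  exact h y

theorem formSpace_Bd_sub_zero {q j : ℕ} {M : ℝ} {ω η : FormFamily d 0 q} :
    (P.formSpace 0 q).Bd j M (ω - η) ↔
      ∀ i ≤ j, ∀ y, ‖iteratedFDeriv ℝ i ((ω Fin.elim0).1 - (η Fin.elim0).1) y‖ ≤ M := by
  rw [formSpace_Bd_zero, Pi.sub_apply, AddSubgroupClass.coe_sub]

theorem mem_formSpace_V_zero {b : Bool} {q : ℕ} {ω : FormFamily d 0 q} :
    ω ∈ (P.formSpace 0 q).V b ↔ ω Fin.elim0 ∈ P.peForms b q := by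
  cases b with
  | false => exact mem_formSpace_S_zero
  | true =>
    change ω ∈ (P.formSpace 0 q).W ↔ ω Fin.elim0 ∈ P.wForms q
    rw [PESpace.mem_W]
    refine and_congr ⟨fun h j => ?_, fun h j => ?_⟩
      (forall_congr' fun j => forall₂_congr fun ε _ => ⟨?_, ?_⟩)
    · obtain ⟨M, hM⟩ := h j
      exact ⟨M, formSpace_Bd_zero.1 hM j le_rfl⟩
    · choose C hC using h
      -- The relation `Bd j` bounds all orders up to `j` at once, whereas bounded forms come with
      -- one bound for each order.
      refine ⟨∑ i ∈ Finset.range (j + 1), |C i|, formSpace_Bd_zero.2 fun i hi y => ?_⟩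
      exact ((hC i y).trans (le_abs_self _)).trans
        (Finset.single_le_sum (f := fun i => |C i|) (fun i _ => abs_nonneg _)
          (Finset.mem_range.2 (by omega)))
    · rintro ⟨s, hs, h⟩
      exact ⟨s Fin.elim0, mem_formSpace_S_zero.1 hs, formSpace_Bd_sub_zero.1 h⟩
    · rintro ⟨η, hη, h⟩
      exact ⟨fun _ => η, mem_formSpace_S_zero.2 hη, formSpace_Bd_sub_zero.2 h⟩

theorem mem_cochainSpace_S_zero {n : ℕ} {c : P.CochainFamily 0 n} :
    c ∈ (P.cochainSpace 0 n).S ↔ c Fin.elim0 ∈ P.sCochains n := by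
  rw [mem_sCochains_iff]
  constructor
  · rintro ⟨R, h⟩
    refine ⟨R + P.diamBound, fun x τ τ' hx i e => ?_⟩
    obtain ⟨t, ht, hτ⟩ := τ.exists_tile
    have := h x Fin.elim0 τ τ' (joined_of_isEmpty _ _) hx
      (e.of_mem_tile ht (subset_supp (hτ i)) (subset_supp (hτ 0)))
    rwa [Subsingleton.elim (fun i => x + _) Fin.elim0] at this
  · rintro ⟨R, h⟩
    refine ⟨R, fun x σ τ τ' _ hx e => ?_⟩
    rw [Subsingleton.elim (fun i => x + σ i) Fin.elim0, Subsingleton.elim σ Fin.elim0]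
    exact h x τ τ' hx 0 e

theorem cochainSpace_Bd_zero {n j : ℕ} {M : ℝ} {c : P.CochainFamily 0 n} :
    (P.cochainSpace 0 n).Bd j M c ↔ ∀ τ, |c Fin.elim0 τ| ≤ M := by
  refine ⟨fun h τ => h _ τ (joined_of_isEmpty _ _), fun h σ τ _ => ?_⟩
  rw [Subsingleton.elim σ Fin.elim0]
  exact h τ

theorem mem_cochainSpace_V_zero {b : Bool} {n : ℕ} {c : P.CochainFamily 0 n} :
    c ∈ (P.cochainSpace 0 n).V b ↔ c Fin.elim0 ∈ P.peCochains b n := by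
  cases b with
  | false => exact mem_cochainSpace_S_zero
  | true =>
    change c ∈ (P.cochainSpace 0 n).W ↔ c Fin.elim0 ∈ P.wCochains n
    rw [PESpace.mem_W]
    refine and_congr ⟨fun h => ?_, fun h j => ?_⟩ ⟨fun h ε hε => ?_, fun h j ε hε => ?_⟩
    · obtain ⟨M, hM⟩ := h 0
      exact ⟨M, cochainSpace_Bd_zero.1 hM⟩
    · obtain ⟨M, hM⟩ := h
      exact ⟨M, cochainSpace_Bd_zero.2 hM⟩
    · obtain ⟨s, hs, hb⟩ := h 0 ε hε
      exact ⟨s Fin.elim0, mem_cochainSpace_S_zero.1 hs, cochainSpace_Bd_zero.1 hb⟩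
    · obtain ⟨s, hs, hb⟩ := h ε hε
      exact ⟨fun _ => s, mem_cochainSpace_S_zero.2 hs, cochainSpace_Bd_zero.2 hb⟩

theorem mem_formSpace_N_zero {q : ℕ} {ω : FormFamily d 0 q} :
    ω ∈ (P.formSpace 0 q).N ↔ ω Fin.elim0 = 0 := by
  rw [mem_formSpace_N]
  refine ⟨fun h => Subtype.ext (funext fun y => h _ y (mem_star_of_isEmpty _ _)), fun h σ y _ => ?_⟩
  rw [Subsingleton.elim σ Fin.elim0, h]
  rfl

theorem mem_cochainSpace_N_zero {n : ℕ} {c : P.CochainFamily 0 n} :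
    c ∈ (P.cochainSpace 0 n).N ↔ c Fin.elim0 = 0 := by
  rw [mem_cochainSpace_N]
  refine ⟨fun h => funext fun τ => h _ τ (joined_of_isEmpty _ _), fun h σ τ _ => ?_⟩
  rw [Subsingleton.elim σ Fin.elim0, h]
  rfl

/-! ### The pattern equivariant de Rham theorem -/

/-- Column `p = 0` of the double complex is the mapping cone of `J`, since the only tuple is empty
and null elements vanish apart from the spurious cochain component in degree zero. The two exactness
statements for it are the hypotheses of `inducesIsoOnCohomology_of_exact`. -/
theorem inducesIsoOnCohomology_J (P : SimplicialTiling d) (b : Bool) (l : ℕ) :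
    InducesIsoOnCohomology (X := fun n => smoothForms d n) (Y := P.Cochain)
      (extD d) (P.peForms b) P.dS (P.peCochains b) l (P.J l) := by
  have hE := exactDoubleComplex P b
  refine inducesIsoOnCohomology_of_exact (X := fun n => smoothForms d n) (Y := P.Cochain) P.J
    (fun l ω hω => ?_) P.J_extD (fun ω hω hd hJ => ?_) (fun l ω hω c hc hd hJ => ?_) l
  · exact mem_cochainSpace_V_zero.1 ((P.isPEOp_J 0 l).map_V
      (mem_formSpace_V_zero (ω := fun _ => ω).2 hω))
  · have hz : ((fun _ => ω, 0) : P.ConeFamily 0 0) ∈ P.coneV b 0 0 :=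
      ⟨mem_formSpace_V_zero.2 hω, zero_mem _⟩
    exact mem_formSpace_N_zero.1 (hE.exact_zero hz ⟨mem_formSpace_N_zero.2 hd,
      mem_cochainSpace_N_zero.2 ((sub_zero _).trans hJ)⟩).1
  · have hz : ((fun _ => ω, fun _ => c) : P.ConeFamily 0 (l + 1)) ∈ P.coneV b 0 (l + 1) :=
      ⟨mem_formSpace_V_zero.2 hω, mem_cochainSpace_V_zero.2 hc⟩
    obtain ⟨⟨η, a⟩, ⟨hη, ha⟩, h1, h2⟩ := hE.exact_succ hz
      ⟨mem_formSpace_N_zero.2 hd, mem_cochainSpace_N_zero.2 (sub_eq_zero.2 hJ)⟩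
    have h1' : ω - extD d l (η Fin.elim0) = 0 := mem_formSpace_N_zero.1 h1
    have h2' : c - (P.J l (η Fin.elim0) - P.prevD 0 l a Fin.elim0) = 0 :=
      mem_cochainSpace_N_zero.1 h2
    refine ⟨η Fin.elim0, mem_formSpace_V_zero.1 hη, sub_eq_zero.1 h1', ?_⟩
    rw [← sub_add, add_eq_zero_iff_eq_neg] at h2'
    rw [h2']
    cases l with
    | zero => exact neg_mem (zero_mem (⊥ : Submodule ℝ (P.Cochain 0)))
    | succ l => exact neg_mem ⟨a Fin.elim0, mem_cochainSpace_V_zero.1 ha, rfl⟩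

end SimplicialTiling

end PatternEquivariant

end

theorem mainTheorem1 {d : ℕ} (P : PatternEquivariant.SimplicialTiling d) (l : ℕ) :
    PatternEquivariant.InducesIsoOnCohomology
        (X := fun n => PatternEquivariant.smoothForms d n) (Y := P.Cochain)
        (PatternEquivariant.extD d) P.sForms P.dS P.sCochains l (P.J l) ∧
      PatternEquivariant.InducesIsoOnCohomology
        (X := fun n => PatternEquivariant.smoothForms d n) (Y := P.Cochain)
        (PatternEquivariant.extD d) P.wForms P.dS P.wCochains l (P.J l) :=
  ⟨P.inducesIsoOnCohomology_J false l, P.inducesIsoOnCohomology_J true l⟩
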